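/- Let $\alpha\in(0,1)$ be irrational and let $T$ be the rotation of angle $\alpha$, i.e. the two-interval exchange of $[0,1)$ with $Tx=x+\alpha$ on $X_1=[0,1-\alpha)$ and $Tx=x-1+\alpha$ on $X_2=[1-\alpha,1)$. Let $L$ be the language of all finite factors of the trajectories of the points of $[0,1)$ coded by the partition $\{X_1,X_2\}$, let $X_L$ be the set of one-sided infinite sequences $x_0x_1x_2\ldots$ such that $x_r\cdots x_s\in L$ for all $r<s$, and let $S$ be the shift on $X_L$. The system $(X_L,S)$ is uniquely ergodic; let $\mu$ be its unique invariant probability measure, let $e_n$ be the smallest positive value of $\mu[w]$ over the words $w\in L$ of length $n$, where $[w]$ is the set of the sequences of $X_L$ that begin with $w$, and put $\mathcal B'(\alpha)=\liminf_{n\to+\infty}\frac{1}{n e_n}$. The lower BL spectrum of the family of rotations is the set of all values $\mathcal B'(\alpha)$ for $\alpha\in(0,1)$ irrational. Theorem. The lower BL spectrum of the family of rotations has $1$ as its smallest element, and $\mathcal B'(\alpha)=1$ if and only if the continued fraction expansion of $\alpha$ has unbounded partial quotients. It is a closed set. Its two largest elements are $\frac{5-\sqrt5}{2}$ and $3-\sqrt3$,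 and it has no other element above $\frac54$. It contains the number $\sqrt5-1$, which is an accumulation point of it. It contains the interval $\left[1,\,1+\frac{4}{83+18\sqrt2}\right]$. -/

import Mathlib

open Set Filter Topology MeasureTheory
open scoped ENNReal

section SymbolicSystems

variable {A : Type*}

/-- The factor `x_r x_{r+1} ... x_{r+n-1}` of length `n` of the one-sided sequence `x`. -/
def factor (x : ℕ → A) (r n : ℕ) : List A :=
  List.ofFn fun i : Fin n => x (r + i)

/-- The one-sided shift `S (x₀x₁x₂...) = x₁x₂...`. -/
def shift (x : ℕ → A) : ℕ → A := fun n => x (n + 1)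

/-- The space `X_L` of the symbolic system associated to the language `L`: the sequences `x` such
that `x_r ... x_s` is in `L` for all `r < s`. -/
def symbolicSpace (L : Set (List A)) : Set (ℕ → A) :=
  {x | ∀ r s : ℕ, r < s → factor x r (s + 1 - r) ∈ L}

/-- The cylinder `[w]` of the points of `X_L` that begin with the word `w`. -/
def cylinderSet (L : Set (List A)) (w : List A) : Set (ℕ → A) :=
  {x ∈ symbolicSpace L | factor x 0 w.length = w}

/-- Shift-invariant probability measures on `X_L`, seen as measures on the space of all sequences
(with the product σ-algebra) for which the complement of `X_L` is null. -/
structure IsInvariantProb [MeasurableSpace A] (L : Set (List A)) (μ : Measure (ℕ → A)) :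
    Prop where
  isProbabilityMeasure : IsProbabilityMeasure μ
  measure_compl : μ (symbolicSpace L)ᶜ = 0
  measurePreserving : MeasurePreserving shift μ μ

/-- `(X_L, S)` is uniquely ergodic: it has exactly one invariant probability measure. -/
def UniquelyErgodic [MeasurableSpace A] (L : Set (List A)) : Prop :=
  ∃! μ : Measure (ℕ → A), IsInvariantProb L μ

/-- The unique invariant probability measure of a uniquely ergodic symbolic system. -/
noncomputable def UniquelyErgodic.measure [MeasurableSpace A] {L : Set (List A)}
    (h : UniquelyErgodic L) : Measure (ℕ → A) :=
  h.choose

/-- `e_n(μ)`: the smallest positive frequency `μ [w]` of the words `w` of length `n` of `L`. -/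
noncomputable def smallestFrequency [MeasurableSpace A] (L : Set (List A))
    (μ : Measure (ℕ → A)) (n : ℕ) : ℝ≥0∞ :=
  sInf {m | 0 < m ∧ ∃ w ∈ L, w.length = n ∧ μ (cylinderSet L w) = m}

/-- `𝓑' = liminf 1 / (n e_n)` for a uniquely ergodic symbolic system. -/
noncomputable def lowerB [MeasurableSpace A] {L : Set (List A)} (h : UniquelyErgodic L) : ℝ≥0∞ :=
  liminf (fun n : ℕ => 1 / ((n : ℝ≥0∞) * smallestFrequency L h.measure n)) atTop

/-- The lower BL spectrum of a family of uniquely ergodic symbolic systems, given by the languages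
`L a` for `a ∈ F`: the set of all values of `𝓑'` taken by the systems of the family. -/
def lowerBLSpectrum [MeasurableSpace A] {ι : Type*} (F : Set ι) (L : ι → Set (List A)) :
    Set ℝ≥0∞ :=
  {b | ∃ a ∈ F, ∃ h : UniquelyErgodic (L a), lowerB h = b}

/-- The trajectory of `x` under `T`, where `c y` is the label of the atom of the partition that
contains `y`. -/
def trajectory {Y : Type*} (T : Y → Y) (c : Y → A) (x : Y) : ℕ → A := fun n => c (T^[n] x)

/-- The language `L(T)` of `T` on the set `X`: all finite factors of trajectories of points
of `X`. -/
def codingLanguage {Y : Type*} (X : Set Y) (T : Y → Y) (c : Y → A) : Set (List A) :=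
  {w | ∃ x ∈ X, ∃ r n : ℕ, w = factor (trajectory T c x) r n}

end SymbolicSystems

section Rotations

/-- The rotation of angle `α` as a two-interval exchange of `[0, 1)`. -/
noncomputable def rotationMap (α x : ℝ) : ℝ := if x < 1 - α then x + α else x - 1 + α

/-- The natural partition of `[0, 1)` into `[0, 1 - α)` (letter `0`) and `[1 - α, 1)`
(letter `1`). -/
noncomputable def rotationLabel (α x : ℝ) : Fin 2 := if x < 1 - α then 0 else 1

/-- The language of the natural coding of the rotation of angle `α`. -/
def rotationLanguage (α : ℝ) : Set (List (Fin 2)) :=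
  codingLanguage (Ico (0 : ℝ) 1) (rotationMap α) (rotationLabel α)

/-- The angles of the family of rotations: the irrational numbers in `(0, 1)`. -/
def rotationAngles : Set ℝ := {α | Irrational α ∧ 0 < α ∧ α < 1}

/-- The partial quotients `b₁, b₂, ...` of the regular continued fraction of `α` are unbounded. -/
def UnboundedPartialQuotients (α : ℝ) : Prop :=
  ∀ M : ℝ, ∃ (n : ℕ) (b : ℝ), (GenContFract.of α).partDens.get? n = some b ∧ M < b

/-- The lower BL spectrum of the family of irrational rotations. -/
def rotationLowerBLSpectrum : Set ℝ≥0∞ := lowerBLSpectrum rotationAngles rotationLanguage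

end Rotations

/-! ### Infinite continued fractions and their exponential continuity. -/

section ContinuedFractions

/-! Write the partial quotients of α as a_{i+1} = d_i + 1, so that every sequence d of natural
numbers is allowed, and let p_n / q_n be the convergents. The points whose codings share n letters
form an interval whose end points are integers minus multiples jα with j ≤ n, and every invariant
measure gives a cylinder the length of its interval. Hence e_n is the distance from {α, ..., nα} to
ℤ (`smallestFrequency_rotationLanguage`), which is |q_k α - p_k| for q_k ≤ n < q_{k+1}
(`isMinDist_cfErr`). On this range 1 / (n e_n) is least at n = q_{k+1} - 1, and 1 / (q_{k+1} |q_k α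
- p_k|) = 1 + [0; a_{k+2}, a_{k+3}, ...] · [0; a_{k+1}, ..., a_1]. So the spectrum is 1 +
`prodSpectrum` (`rotationLowerBLSpectrum_eq`), and everything reduces to lower limits of products of
the two continued fractions read to the right and to the left of a moving cut.

The lower limit is 0 exactly when the quotients are unbounded. Closedness (`isClosed_prodSpectrum`)
comes from compactness and from gluing long pieces of sequences along common windows. If the
products eventually exceed 1/4, local estimates leave only two tails, all quotients 1 or 1 and 2 in
alternation (`eq_of_mem_prodSpectrum_of_quarter_lt`). A quotient 2 isolated in longer and longer
runs of 1 gives values that converge to √5 - 2.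

The interval follows Hall's method. In the Cantor set of continued fractions with quotients at most
4, gaps are shorter than the neighbouring bridges, so the products (a + x)(b + y) with a, b ≥ 5 come
arbitrarily close to every number from (5 + `hallMin`)² on (`exists_hallSet_mul_near`). A periodic
sequence in which a and b are the only large quotients has its smallest product at the cut between
them, close to 1 / ((a + x)(b + y)); closedness then gives the exact values. -/

lemma abs_one_div_sub_one_div_two_step {a b s t : ℝ} (ha : 1 ≤ a) (hb : 1 ≤ b) (hs : 0 ≤ s)
    (ht : 0 ≤ t) :
    |1 / (a + 1 / (b + s)) - 1 / (a + 1 / (b + t))| ≤ |s - t| / 4 := by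
  have hbs : 0 < b + s := by linarith
  have hbt : 0 < b + t := by linarith
  -- These two denominators, each at least 2, give the factor 1/4. A single step t ↦ 1 / (a + t) has
  -- derivative -1 at a = 1, t = 0, so only two steps together contract uniformly.
  have h1 : 2 ≤ a * (b + s) + 1 := by nlinarith
  have h2 : 2 ≤ a * (b + t) + 1 := by nlinarith
  have e : 1 / (a + 1 / (b + s)) - 1 / (a + 1 / (b + t))
      = (s - t) / ((a * (b + s) + 1) * (a * (b + t) + 1)) := by
    have : a * (b + s) + 1 ≠ 0 := by linarith
    have : a * (b + t) + 1 ≠ 0 := by linarith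
    field_simp
    ring
  rw [e, abs_div]
  have h3 : 4 ≤ (a * (b + s) + 1) * (a * (b + t) + 1) := by nlinarith
  rw [abs_of_pos (by linarith : 0 < (a * (b + s) + 1) * (a * (b + t) + 1))]
  exact div_le_div_of_nonneg_left (abs_nonneg _) (by norm_num) h3

/-- Two solutions in `[0, 1]` of the continued fraction recursion with the same first `n` partial
quotients are close to each other. -/
lemma cf_contraction (n : ℕ) : ∀ (d : ℕ → ℕ) (v w : ℕ → ℝ), (∀ i, v i ∈ Icc (0 : ℝ) 1) →
    (∀ i, w i ∈ Icc (0 : ℝ) 1) → (∀ i < n, v i = 1 / (d i + 1 + v (i + 1))) →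
    (∀ i < n, w i = 1 / (d i + 1 + w (i + 1))) → |v 0 - w 0| ≤ 2 * (1 / 2) ^ n := by
  -- The contraction is available for pairs of steps only; the constant 2 makes the case n = 1 as
  -- trivial as n = 0.
  induction n using Nat.twoStepInduction with
  | zero =>
    intro d v w hv hw _ _
    rw [abs_le]; constructor <;> norm_num <;> linarith [(hv 0).1, (hv 0).2, (hw 0).1, (hw 0).2]
  | one =>
    intro d v w hv hw _ _
    rw [abs_le]; constructor <;> norm_num <;> linarith [(hv 0).1, (hv 0).2, (hw 0).1, (hw 0).2]
  | more n ih _ =>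
    intro d v w hv hw h1 h2
    have := ih (fun i => d (i + 2)) (fun i => v (i + 2)) (fun i => w (i + 2))
      (fun i => hv _) (fun i => hw _) (fun i hi => h1 (i + 2) (by omega))
      (fun i hi => h2 (i + 2) (by omega))
    rw [h1 0 (by omega), h1 1 (by omega), h2 0 (by omega), h2 1 (by omega)]
    refine (abs_one_div_sub_one_div_two_step ?_ ?_ (hv _).1 (hw _).1).trans ?_
    · simp
    · simp
    · simp only [zero_add, one_add_one_eq_two] at this ⊢
      rw [pow_add]
      norm_num at this ⊢
      linarith

/-- The finite continued fraction `[0; d₀ + 1, ..., d_{n-1} + 1 + t]`. -/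
noncomputable def cfPrefix : ℕ → (ℕ → ℕ) → ℝ → ℝ
  | 0, _, t => t
  | n + 1, d, t => 1 / (d 0 + 1 + cfPrefix n (fun i => d (i + 1)) t)

lemma one_div_mem_Icc (m : ℕ) {t : ℝ} (ht : 0 ≤ t) : 1 / ((m : ℝ) + 1 + t) ∈ Icc (0 : ℝ) 1 := by
  have : (0 : ℝ) ≤ m := Nat.cast_nonneg m
  refine ⟨by positivity, ?_⟩
  rw [div_le_one (by positivity)]
  linarith

lemma cfPrefix_mem (n : ℕ) : ∀ (d : ℕ → ℕ) {t : ℝ}, t ∈ Icc (0 : ℝ) 1 →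
    cfPrefix n d t ∈ Icc (0 : ℝ) 1 := by
  induction n with
  | zero => intro d t ht; exact ht
  | succ n ih => intro d t ht; exact one_div_mem_Icc _ (ih _ ht).1

lemma cfPrefix_sub_le (n : ℕ) (d : ℕ → ℕ) {s t : ℝ} (hs : s ∈ Icc (0 : ℝ) 1)
    (ht : t ∈ Icc (0 : ℝ) 1) : |cfPrefix n d s - cfPrefix n d t| ≤ 2 * (1 / 2) ^ n := by
  have key : ∀ r : ℝ, ∀ i < n, cfPrefix (n - i) (fun j => d (i + j)) r
      = 1 / (d i + 1 + cfPrefix (n - (i + 1)) (fun j => d (i + 1 + j)) r) := by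
    intro r i hi
    obtain ⟨k, hk⟩ : ∃ k, n - i = k + 1 := ⟨n - i - 1, by omega⟩
    have hk' : n - (i + 1) = k := by omega
    rw [hk, hk', cfPrefix]
    simp only [add_zero]
    congr 4
    ext j; congr 1; ring
  have := cf_contraction n d (fun i => cfPrefix (n - i) (fun j => d (i + j)) s)
    (fun i => cfPrefix (n - i) (fun j => d (i + j)) t) (fun i => cfPrefix_mem _ _ hs)
    (fun i => cfPrefix_mem _ _ ht) (key s) (key t)
  simpa using this

lemma cfPrefix_succ' (n : ℕ) : ∀ (d : ℕ → ℕ) (t : ℝ),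
    cfPrefix (n + 1) d t = cfPrefix n d (1 / (d n + 1 + t)) := by
  induction n with
  | zero => intro d t; rfl
  | succ n ih => intro d t; rw [cfPrefix, ih, cfPrefix]

lemma exists_tendsto_cfPrefix (d : ℕ → ℕ) :
    ∃ x, Tendsto (fun n => cfPrefix n d 0) atTop (𝓝 x) := by
  apply cauchySeq_tendsto_of_complete
  refine cauchySeq_of_le_geometric (1 / 2) 2 (by norm_num) fun n => ?_
  rw [Real.dist_eq, cfPrefix_succ']
  exact cfPrefix_sub_le n d ⟨le_rfl, zero_le_one⟩ (one_div_mem_Icc _ le_rfl)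

/-- The value `[0; d₀ + 1, d₁ + 1, ...]` of an infinite continued fraction. -/
noncomputable def cfVal (d : ℕ → ℕ) : ℝ := (exists_tendsto_cfPrefix d).choose

lemma tendsto_cfPrefix (d : ℕ → ℕ) : Tendsto (fun n => cfPrefix n d 0) atTop (𝓝 (cfVal d)) :=
  (exists_tendsto_cfPrefix d).choose_spec

lemma cfVal_mem_Icc (d : ℕ → ℕ) : cfVal d ∈ Icc (0 : ℝ) 1 :=
  isClosed_Icc.mem_of_tendsto (tendsto_cfPrefix d)
    (Eventually.of_forall fun n => cfPrefix_mem n d ⟨le_rfl, zero_le_one⟩)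

lemma cfVal_eq (d : ℕ → ℕ) : cfVal d = 1 / (d 0 + 1 + cfVal fun i => d (i + 1)) := by
  have h1 := (tendsto_cfPrefix d).comp (tendsto_add_atTop_nat 1)
  have h2 := tendsto_cfPrefix fun i => d (i + 1)
  refine tendsto_nhds_unique h1 ?_
  have h3 : (0 : ℝ) ≤ d 0 := Nat.cast_nonneg _
  have h4 := (cfVal_mem_Icc fun i => d (i + 1)).1
  exact tendsto_const_nhds.div (tendsto_const_nhds.add h2) (by positivity)

lemma cfVal_pos (d : ℕ → ℕ) : 0 < cfVal d := by
  rw [cfVal_eq]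
  have h4 := (cfVal_mem_Icc fun i => d (i + 1)).1
  positivity

lemma cfVal_lt_one (d : ℕ → ℕ) : cfVal d < 1 := by
  rw [cfVal_eq]
  have h4 := cfVal_pos fun i => d (i + 1)
  rw [div_lt_one (by positivity)]
  have : (0 : ℝ) ≤ d 0 := Nat.cast_nonneg _
  linarith

lemma cfVal_tail_eq (d : ℕ → ℕ) (k : ℕ) : (cfVal fun i => d (k + i))
    = 1 / (d k + 1 + cfVal fun i => d (k + 1 + i)) := by
  rw [cfVal_eq]
  simp only [add_zero]
  congr 4
  ext i; congr 1; ring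

/-- The contraction forces any bounded solution of the recursion to be the continued fraction; this
evaluates periodic expansions and identifies the Gauss expansion. -/
lemma cfVal_unique {d : ℕ → ℕ} {v : ℕ → ℝ} (hv : ∀ i, v i ∈ Icc (0 : ℝ) 1)
    (h : ∀ i, v i = 1 / (d i + 1 + v (i + 1))) : v 0 = cfVal d := by
  have h1 : ∀ n : ℕ, |v 0 - cfVal d| ≤ 2 * (1 / 2) ^ n := fun n => by
    have := cf_contraction n d v (fun k => cfVal fun i => d (k + i)) hv
      (fun i => cfVal_mem_Icc _) (fun i _ => h i) (fun i _ => cfVal_tail_eq d i)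
    simpa using this
  have h2 : Tendsto (fun n : ℕ => (2 : ℝ) * (1 / 2) ^ n) atTop (𝓝 0) := by
    simpa using (tendsto_pow_atTop_nhds_zero_of_lt_one (by norm_num : (0 : ℝ) ≤ 1 / 2)
      (by norm_num)).const_mul 2
  have h3 : |v 0 - cfVal d| ≤ 0 := ge_of_tendsto' h2 h1
  exact sub_eq_zero.1 (abs_nonpos_iff.1 h3)

lemma cfVal_sub_le {n : ℕ} {d e : ℕ → ℕ} (h : ∀ i < n, d i = e i) :
    |cfVal d - cfVal e| ≤ 2 * (1 / 2) ^ n := by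
  have := cf_contraction n d (fun k => cfVal fun i => d (k + i)) (fun k => cfVal fun i => e (k + i))
    (fun i => cfVal_mem_Icc _) (fun i => cfVal_mem_Icc _) (fun i _ => cfVal_tail_eq d i)
    (fun i hi => by rw [h i hi]; exact cfVal_tail_eq e i)
  simpa using this

lemma floor_one_div_cfVal (d : ℕ → ℕ) : ⌊1 / cfVal d⌋ = d 0 + 1 := by
  rw [cfVal_eq, one_div_one_div, Int.floor_eq_iff]
  have h1 := cfVal_pos fun i => d (i + 1)
  have h2 := cfVal_lt_one fun i => d (i + 1)
  push_cast
  constructor <;> linarith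

lemma fract_one_div_cfVal (d : ℕ → ℕ) : Int.fract (1 / cfVal d) = cfVal fun i => d (i + 1) := by
  rw [Int.fract, floor_one_div_cfVal, cfVal_eq d, one_div_one_div]
  push_cast
  ring

lemma cfVal_injective : Function.Injective cfVal := by
  have key : ∀ n : ℕ, ∀ d e : ℕ → ℕ, cfVal d = cfVal e → d n = e n := by
    intro n
    induction n with
    | zero =>
      intro d e h
      have h1 := floor_one_div_cfVal d
      rw [h, floor_one_div_cfVal e] at h1
      omega
    | succ n ih =>
      intro d e h
      refine ih (fun i => d (i + 1)) (fun i => e (i + 1)) ?_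
      rw [← fract_one_div_cfVal, ← fract_one_div_cfVal, h]
  intro d e h
  ext n
  exact key n d e h

end ContinuedFractions

/-! ### Lower limits of real sequences. -/

section Liminf

/-- `ℓ` is the lower limit of the real sequence `f`. -/
def HasLiminf (f : ℕ → ℝ) (ℓ : ℝ) : Prop :=
  (∀ ε > 0, ∀ᶠ n in atTop, ℓ - ε < f n) ∧ ∀ ε > 0, ∃ᶠ n in atTop, f n < ℓ + ε

lemma exists_hasLiminf {f : ℕ → ℝ} (hf : ∀ n, f n ∈ Icc (0 : ℝ) 1) : ∃ ℓ, HasLiminf f ℓ := by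
  have hb : IsBoundedUnder (· ≥ ·) atTop f := isBoundedUnder_of ⟨0, fun n => (hf n).1⟩
  have hb' : IsBoundedUnder (· ≤ ·) atTop f := isBoundedUnder_of ⟨1, fun n => (hf n).2⟩
  have hc : IsCoboundedUnder (· ≥ ·) atTop f := hb'.isCoboundedUnder_ge
  refine ⟨liminf f atTop, fun ε hε => ?_, fun ε hε => ?_⟩
  · exact eventually_lt_of_lt_liminf (by linarith) hb
  · exact frequently_lt_of_liminf_lt hc (by linarith)

lemma HasLiminf.le_of_eventually_le {f : ℕ → ℝ} {ℓ c : ℝ} (h : HasLiminf f ℓ)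
    (hc : ∀ᶠ n in atTop, c ≤ f n) : c ≤ ℓ := by
  refine le_of_forall_pos_le_add fun ε hε => ?_
  obtain ⟨n, h1, h2⟩ := ((h.2 ε hε).and_eventually hc).exists
  linarith

lemma HasLiminf.le_of_frequently_le {f : ℕ → ℝ} {ℓ c : ℝ} (h : HasLiminf f ℓ)
    (hc : ∃ᶠ n in atTop, f n ≤ c) : ℓ ≤ c := by
  refine le_of_forall_pos_le_add fun ε hε => ?_
  obtain ⟨n, h1, h2⟩ := (hc.and_eventually (h.1 ε hε)).exists
  linarith

lemma HasLiminf.le_of_sub_tendsto {f g : ℕ → ℝ} {ℓ m : ℝ} (hf : HasLiminf f ℓ)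
    (hg : HasLiminf g m) (h : Tendsto (fun n => f n - g n) atTop (𝓝 0)) : ℓ ≤ m := by
  refine le_of_forall_pos_le_add fun ε hε => ?_
  have h1 := h.eventually (Metric.ball_mem_nhds 0 (by linarith : 0 < ε / 3))
  obtain ⟨n, h2, h3, h4⟩ := ((hg.2 (ε / 3) (by linarith)).and_eventually
    (h1.and (hf.1 (ε / 3) (by linarith)))).exists
  rw [Real.dist_eq, sub_zero, abs_lt] at h3
  linarith

lemma HasLiminf.congr {f g : ℕ → ℝ} {ℓ : ℝ} (hf : HasLiminf f ℓ)
    (h : Tendsto (fun n => f n - g n) atTop (𝓝 0)) : HasLiminf g ℓ := by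
  constructor
  · intro ε hε
    have h1 := h.eventually (Metric.ball_mem_nhds 0 (by linarith : 0 < ε / 2))
    filter_upwards [h1, hf.1 (ε / 2) (by linarith)] with n h2 h3
    rw [Real.dist_eq, sub_zero, abs_lt] at h2
    linarith
  · intro ε hε
    have h1 := h.eventually (Metric.ball_mem_nhds 0 (by linarith : 0 < ε / 2))
    refine ((hf.2 (ε / 2) (by linarith)).and_eventually h1).mono ?_
    rintro n ⟨h2, h3⟩
    rw [Real.dist_eq, sub_zero, abs_lt] at h3
    linarith

lemma HasLiminf.unique {f : ℕ → ℝ} {ℓ m : ℝ} (hf : HasLiminf f ℓ) (hg : HasLiminf f m) :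
    ℓ = m :=
  le_antisymm (hf.le_of_sub_tendsto hg (by simp)) (hg.le_of_sub_tendsto hf (by simp))

end Liminf

/-! ### Products of the two continued fractions at a cut of a bi-infinite sequence. -/

section BiInfinite

/-- The continued fraction `[0; b_k + 1, b_{k+1} + 1, ...]`. -/
noncomputable def rightVal (b : ℤ → ℕ) (k : ℤ) : ℝ := cfVal fun i => b (k + i)

/-- The continued fraction `[0; b_{k-1} + 1, b_{k-2} + 1, ...]`. -/
noncomputable def leftVal (b : ℤ → ℕ) (k : ℤ) : ℝ := cfVal fun i => b (k - 1 - i)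

/-- The product of the two continued fractions obtained by cutting `b` before position `k`. -/
noncomputable def prodVal (b : ℤ → ℕ) (k : ℤ) : ℝ := leftVal b k * rightVal b k

/-- The set of the lower limits of `k ↦ prodVal b k`. -/
def prodSpectrum : Set ℝ := {ℓ | ∃ b : ℤ → ℕ, HasLiminf (fun n : ℕ => prodVal b n) ℓ}

lemma rightVal_pos (b : ℤ → ℕ) (k : ℤ) : 0 < rightVal b k := cfVal_pos _
lemma leftVal_pos (b : ℤ → ℕ) (k : ℤ) : 0 < leftVal b k := cfVal_pos _
lemma rightVal_lt_one (b : ℤ → ℕ) (k : ℤ) : rightVal b k < 1 := cfVal_lt_one _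
lemma leftVal_lt_one (b : ℤ → ℕ) (k : ℤ) : leftVal b k < 1 := cfVal_lt_one _

lemma rightVal_eq (b : ℤ → ℕ) (k : ℤ) : rightVal b k = 1 / (b k + 1 + rightVal b (k + 1)) := by
  rw [rightVal, cfVal_eq, rightVal]
  simp only [Nat.cast_zero, add_zero]
  congr 4
  ext i; congr 1; push_cast; ring

lemma leftVal_eq (b : ℤ → ℕ) (k : ℤ) :
    leftVal b k = 1 / (b (k - 1) + 1 + leftVal b (k - 1)) := by
  rw [leftVal, cfVal_eq, leftVal]
  simp only [Nat.cast_zero, sub_zero]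
  congr 4
  ext i; congr 1; push_cast; ring

lemma prodVal_pos (b : ℤ → ℕ) (k : ℤ) : 0 < prodVal b k :=
  mul_pos (leftVal_pos b k) (rightVal_pos b k)

lemma prodVal_lt_rightVal (b : ℤ → ℕ) (k : ℤ) : prodVal b k < rightVal b k := by
  have := rightVal_pos b k
  have := leftVal_lt_one b k
  rw [prodVal]; nlinarith

lemma prodVal_mem_Icc (b : ℤ → ℕ) (k : ℤ) : prodVal b k ∈ Icc (0 : ℝ) 1 :=
  ⟨(prodVal_pos b k).le, ((prodVal_lt_rightVal b k).trans (rightVal_lt_one b k)).le⟩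

lemma rightVal_lt_one_div (b : ℤ → ℕ) (k : ℤ) : rightVal b k < 1 / (b k + 1) := by
  have h := rightVal_pos b (k + 1)
  rw [rightVal_eq]
  exact one_div_lt_one_div_of_lt (by positivity) (by linarith)

lemma abs_mul_sub_mul_le {x y x' y' : ℝ} (hy : y ∈ Icc (0 : ℝ) 1) (hx' : x' ∈ Icc (0 : ℝ) 1) :
    |x * y - x' * y'| ≤ |x - x'| + |y - y'| := by
  have e : x * y - x' * y' = (x - x') * y + x' * (y - y') := by ring
  rw [e]
  refine (abs_add_le _ _).trans ?_
  rw [abs_mul, abs_mul, abs_of_nonneg hy.1, abs_of_nonneg hx'.1]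
  nlinarith [abs_nonneg (x - x'), abs_nonneg (y - y'), hy.1, hy.2, hx'.1, hx'.2]

/-- Both factors depend exponentially little on remote digits, so a window of radius r determines
the product up to 4 / 2^r. Every transfer between sequences rests on this. -/
lemma abs_prodVal_sub_le {b c : ℤ → ℕ} {k m : ℤ} {r : ℕ}
    (h : ∀ i : ℤ, |i| ≤ r → b (k + i) = c (m + i)) :
    |prodVal b k - prodVal c m| ≤ 4 * (1 / 2) ^ r := by
  have h1 : |leftVal b k - leftVal c m| ≤ 2 * (1 / 2) ^ r := by
    refine cfVal_sub_le fun i hi => ?_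
    have := h (-1 - i) (by rw [abs_le]; omega)
    rw [show k - 1 - (i : ℤ) = k + (-1 - i) by ring, this]
    congr 1; ring
  have h2 : |rightVal b k - rightVal c m| ≤ 2 * (1 / 2) ^ r :=
    cfVal_sub_le fun i hi => h i (by rw [abs_le]; omega)
  have := abs_mul_sub_mul_le (x := leftVal b k) (y' := rightVal c m)
    (cfVal_mem_Icc fun i => b (k + i)) (cfVal_mem_Icc fun i => c (m - 1 - i))
  change |prodVal b k - prodVal c m| ≤ _ at this
  change |prodVal b k - prodVal c m| ≤ |leftVal b k - leftVal c m| +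
    |rightVal b k - rightVal c m| at this
  linarith

lemma tendsto_four_mul_half_pow :
    Tendsto (fun r : ℕ => (4 : ℝ) * (1 / 2) ^ r) atTop (𝓝 0) := by
  simpa using (tendsto_pow_atTop_nhds_zero_of_lt_one (by norm_num : (0 : ℝ) ≤ 1 / 2)
      (by norm_num)).const_mul 4

/-- Two sequences with the same tail up to a shift have asymptotically the same `prodVal`. -/
lemma tendsto_prodVal_sub_of_tail_eq {b c : ℤ → ℕ} {N : ℕ} {d : ℤ}
    (h : ∀ n : ℤ, N ≤ n → b n = c (n + d)) :
    Tendsto (fun n : ℕ => prodVal b n - prodVal c (n + d)) atTop (𝓝 0) := by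
  have h1 : Tendsto (fun n : ℕ => (4 : ℝ) * (1 / 2) ^ (n - N)) atTop (𝓝 0) :=
    tendsto_four_mul_half_pow.comp (tendsto_sub_atTop_nat N)
  refine squeeze_zero_norm' ?_ h1
  filter_upwards [eventually_ge_atTop N] with n hn
  refine abs_prodVal_sub_le fun i hi => ?_
  rw [abs_le] at hi
  rw [h _ (by omega)]
  congr 1; ring

lemma exists_hasLiminf_prodVal (b : ℤ → ℕ) : ∃ ℓ, HasLiminf (fun n : ℕ => prodVal b n) ℓ :=
  exists_hasLiminf fun n => prodVal_mem_Icc b n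

lemma prodSpectrum_subset_Icc : prodSpectrum ⊆ Icc 0 1 := by
  rintro ℓ ⟨b, hb⟩
  exact ⟨hb.le_of_eventually_le (Eventually.of_forall fun n => (prodVal_mem_Icc b n).1),
    hb.le_of_frequently_le (Frequently.of_forall fun n => (prodVal_mem_Icc b n).2)⟩

/-- The digits 0, 1, 2, ... tend to infinity, and a product is smaller than 1 over the quotient that
follows the cut. -/
lemma zero_mem_prodSpectrum : (0 : ℝ) ∈ prodSpectrum := by
  refine ⟨fun i => i.toNat, fun ε hε => Eventually.of_forall fun n => ?_,
    fun ε hε => Eventually.frequently ?_⟩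
  · linarith [prodVal_pos (fun i => i.toNat) n]
  · filter_upwards [(tendsto_one_div_add_atTop_nhds_zero_nat (𝕜 := ℝ)).eventually
      (gt_mem_nhds hε)] with n hn
    rw [zero_add]
    refine ((prodVal_lt_rightVal _ _).trans (rightVal_lt_one_div _ _)).trans ?_
    simpa using hn

end BiInfinite

/-! ### Closedness of the set of lower limits. -/

section Closedness

/-- Words cut out of sequences `c r` between two occurrences of longer and longer central blocks of
a common sequence `W` can be concatenated so that windows of the result are windows of `c r`. -/
lemma exists_concatenation {W : ℤ → ℕ} {c : ℕ → ℤ → ℕ} {s t : ℕ → ℤ}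
    (hlen : ∀ r, s r + r + 1 ≤ t r) (hs : ∀ r : ℕ, ∀ i : ℤ, |i| ≤ r → c r (s r + i) = W i)
    (ht : ∀ r : ℕ, ∀ i : ℤ, |i| ≤ r → c r (t r + i) = W i) :
    ∃ (b : ℤ → ℕ) (N : ℕ → ℤ), N 0 = 0 ∧ (∀ r, N (r + 1) = N r + (t r - s r)) ∧
      ∀ (r : ℕ) (n : ℤ), N (r + 1) ≤ n → n < N (r + 2) → ∀ i : ℤ, |i| ≤ r →
        b (n + i) = c (r + 1) (s (r + 1) + (n - N (r + 1)) + i) := by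
  set N : ℕ → ℤ := fun r => ∑ j ∈ Finset.range r, (t j - s j) with hN
  have hNs : ∀ r, N (r + 1) = N r + (t r - s r) := fun r => Finset.sum_range_succ _ _
  have hmono : ∀ r r', r ≤ r' → N r ≤ N r' := by
    refine fun r r' h => monotone_nat_of_le_succ (fun r => ?_) h
    have := hlen r
    have := hNs r
    omega
  have hgrow : ∀ r : ℕ, (r : ℤ) ≤ N r := by
    intro r
    induction r with
    | zero => simp [hN]
    | succ r ih =>
      have := hlen r
      have := hNs r
      push_cast
      omega
  have hex : ∀ n : ℤ, ∃ r, n < N (r + 1) := fun n => by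
    refine ⟨n.toNat, ?_⟩
    have := hgrow (n.toNat + 1)
    push_cast at this
    omega
  classical
  set b : ℤ → ℕ := fun n => c (Nat.find (hex n)) (s (Nat.find (hex n)) + (n - N (Nat.find (hex n))))
  have hb : ∀ (r : ℕ) (n : ℤ), N r ≤ n → n < N (r + 1) → b n = c r (s r + (n - N r)) := by
    intro r n h1 h2
    have : Nat.find (hex n) = r := by
      rw [Nat.find_eq_iff]
      refine ⟨h2, fun r' hr' h => ?_⟩
      have := hmono (r' + 1) r hr'
      omega
    simp only [b, this]
  refine ⟨b, N, by simp [hN], hNs, fun r n h1 h2 i hi => ?_⟩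
  have e1 := hNs r
  have e2 := hNs (r + 1)
  have e3 := hNs (r + 1 + 1)
  have l1 := hlen r
  have l2 := hlen (r + 1)
  have l3 := hlen (r + 1 + 1)
  push_cast at l2 l3
  have hi' := abs_le.1 hi
  rcases lt_or_ge (n + i) (N (r + 1)) with h | h
  -- The window overlaps the preceding block: just before their junction, `c r` left of `t r` and `c
  -- (r + 1)` left of `s (r + 1)` both read `W`, so one may be exchanged for the other. The last
  -- case is the same at the right junction.
  · rw [hb r (n + i) (by omega) h]
    have a1 := ht r (n + i - N (r + 1)) (by rw [abs_le]; omega)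
    have a2 := hs (r + 1) (n + i - N (r + 1)) (by rw [abs_le]; push_cast; omega)
    rw [show s r + (n + i - N r) = t r + (n + i - N (r + 1)) by omega, a1, ← a2]
    congr 1; ring
  replace h2 : n < N (r + 1 + 1) := h2
  rcases lt_or_ge (n + i) (N (r + 1 + 1)) with h' | h'
  · rw [hb (r + 1) (n + i) h h']
    congr 1; ring
  · rw [hb (r + 1 + 1) (n + i) h' (by omega)]
    have a1 := hs (r + 1 + 1) (n + i - N (r + 1 + 1)) (by rw [abs_le]; push_cast; omega)
    have a2 := ht (r + 1) (n + i - N (r + 1 + 1)) (by rw [abs_le]; push_cast; omega)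
    rw [a1, ← a2]
    congr 1
    omega

/-- Stage r contributes the piece of `c r` from an occurrence of the window with product almost at
most ℓ to a later occurrence, taken so far out that all products are almost at least ℓ. Gluing these
pieces creates only products close to those already present, and the start of each piece brings the
lower limit down to ℓ. -/
lemma mem_prodSpectrum_of_common_window {ℓ : ℝ} {W : ℤ → ℕ}
    (h : ∀ r : ℕ, ∃ c : ℤ → ℕ, (∀ᶠ n : ℕ in atTop, ℓ - 1 / (r + 1) < prodVal c n) ∧
      ∃ᶠ n : ℕ in atTop, prodVal c n < ℓ + 1 / (r + 1) ∧ ∀ i : ℤ, |i| ≤ r → c (n + i) = W i) :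
    ℓ ∈ prodSpectrum := by
  choose c hc1 hc2 using h
  have h1 : ∀ r, ∃ s : ℕ, (∀ n ≥ s, ℓ - 1 / (r + 1) < prodVal (c r) n) ∧
      prodVal (c r) s < ℓ + 1 / (r + 1) ∧ ∀ i : ℤ, |i| ≤ r → c r (s + i) = W i := fun r => by
    obtain ⟨n₀, hn₀⟩ := eventually_atTop.1 (hc1 r)
    obtain ⟨s, hs, hs'⟩ := frequently_atTop.1 (hc2 r) n₀
    exact ⟨s, fun n hn => hn₀ n (hs.trans hn), hs'⟩
  choose s hs1 hs2 hs3 using h1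
  have h2 : ∀ r, ∃ t : ℕ, s r + r + 1 ≤ t ∧ ∀ i : ℤ, |i| ≤ r → c r (t + i) = W i := fun r => by
    obtain ⟨t, ht, ht'⟩ := frequently_atTop.1 (hc2 r) (s r + r + 1)
    exact ⟨t, ht, ht'.2⟩
  choose t ht1 ht2 using h2
  obtain ⟨b, N, hN0, hN, hb⟩ := exists_concatenation (W := W) (c := c) (s := fun r => (s r : ℤ))
    (t := fun r => (t r : ℤ)) (fun r => by exact_mod_cast ht1 r) hs3 ht2
  have hstep : ∀ r, N r + r + 1 ≤ N (r + 1) := fun r => by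
    have := hN r; have := ht1 r; omega
  have hgrow : ∀ r : ℕ, (r : ℤ) ≤ N r := by
    intro r
    induction r with
    | zero => simp [hN0]
    | succ r ih => have := hstep r; push_cast; omega
  have hlim : Tendsto (fun r : ℕ => 4 * (1 / 2 : ℝ) ^ r + 1 / ((r : ℝ) + 1)) atTop (𝓝 0) := by
    simpa using tendsto_four_mul_half_pow.add (tendsto_one_div_add_atTop_nhds_zero_nat (𝕜 := ℝ))
  have hle : ∀ r : ℕ, 1 / (((r + 1 : ℕ) : ℝ) + 1) ≤ 1 / ((r : ℝ) + 1) := fun r => by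
    push_cast
    exact one_div_le_one_div_of_le (by positivity) (by linarith)
  have hmono : ∀ r r', r ≤ r' → N r ≤ N r' := by
    refine fun r r' h => monotone_nat_of_le_succ (fun r => ?_) h
    have := hstep r
    omega
  refine ⟨b, fun ε hε => ?_, fun ε hε => ?_⟩
  · obtain ⟨R, hR⟩ := eventually_atTop.1 (hlim.eventually (gt_mem_nhds hε))
    filter_upwards [eventually_ge_atTop (N (R + 1)).toNat] with n hn
    have hex : ∃ r, (n : ℤ) < N (r + 1) := ⟨n, by have := hgrow (n + 1); push_cast at this; omega⟩
    classical
    obtain ⟨r, hr⟩ : ∃ r, Nat.find hex = r := ⟨_, rfl⟩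
    rw [Nat.find_eq_iff] at hr
    have hRr : R + 1 ≤ r := by
      by_contra hlt
      have := hmono (r + 1) (R + 1) (by omega)
      omega
    obtain ⟨q, rfl⟩ : ∃ q, r = q + 1 := ⟨r - 1, by omega⟩
    have h3 : N (q + 1) ≤ n := by
      have := hr.2 q (by omega)
      omega
    have h4 := abs_prodVal_sub_le (r := q) (hb q n h3 hr.1)
    have h5 := hs1 (q + 1) (s (q + 1) + (n - N (q + 1)).toNat) (by omega)
    have h6 := hR q (by omega)
    have h7 := hle q
    push_cast at h5 h7
    rw [Int.toNat_of_nonneg (by omega)] at h5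
    have := (abs_le.1 h4).1
    linarith
  · rw [frequently_atTop]
    intro n₀
    obtain ⟨R, hR⟩ := eventually_atTop.1 (hlim.eventually (gt_mem_nhds hε))
    set q := max R n₀ with hq
    have hg := hgrow (q + 1)
    push_cast at hg
    refine ⟨(N (q + 1)).toNat, by omega, ?_⟩
    change prodVal b ((N (q + 1)).toNat : ℤ) < ℓ + ε
    rw [Int.toNat_of_nonneg (by omega)]
    have h4 := abs_prodVal_sub_le (r := q) (hb q (N (q + 1)) le_rfl
      (by have := hstep (q + 1); push_cast at this; change _ < N (q + 1 + 1); omega))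
    rw [sub_self, add_zero] at h4
    have h5 := hs2 (q + 1)
    have h6 := hR q (by omega)
    have h7 := hle q
    push_cast at h5 h7
    have := (abs_le.1 h4).2
    linarith

lemma isOpen_window (W : ℤ → ℕ) (r : ℕ) : IsOpen {w : ℤ → ℕ | ∀ i : ℤ, |i| ≤ r → w i = W i} := by
  have : {w : ℤ → ℕ | ∀ i : ℤ, |i| ≤ r → w i = W i}
      = ⋂ i ∈ Finset.Icc (-r : ℤ) r, (fun w : ℤ → ℕ => w i) ⁻¹' {W i} := by
    ext w; simp [abs_le]
  rw [this]
  exact isOpen_biInter_finset fun i _ => (isOpen_discrete _).preimage (continuous_apply i)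

/-- Positivity of ℓ bounds the digits, which makes the space of windows compact. The windows seen at
nearly minimal cuts of the j-th approximating sequence cluster at some ω j, and the ω j cluster at
W, which is the common window needed for gluing. -/
lemma mem_prodSpectrum_of_approx {ℓ : ℝ} (hℓ : 0 < ℓ)
    (h : ∀ ε > 0, ∃ m ∈ prodSpectrum, |m - ℓ| < ε) : ℓ ∈ prodSpectrum := by
  -- A product above ℓ / 2 forces the quotient that follows the cut below 2 / ℓ.
  obtain ⟨B, hB⟩ := exists_nat_gt (2 / ℓ)
  have h1 : ∀ j : ℕ, ∃ b : ℤ → ℕ, (∀ᶠ n : ℕ in atTop, ℓ - 1 / (j + 1) < prodVal b n) ∧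
      (∀ᶠ n : ℕ in atTop, b n ≤ B) ∧ ∃ᶠ n : ℕ in atTop, prodVal b n < ℓ + 1 / (j + 1) := by
    intro j
    have hj : (0 : ℝ) < 1 / (j + 1) := by positivity
    obtain ⟨m, ⟨b, hb⟩, hm⟩ := h (min (1 / ((j : ℝ) + 1)) (ℓ / 2) / 2) (by positivity)
    have e1 := min_le_left (1 / ((j : ℝ) + 1)) (ℓ / 2)
    have e2 := min_le_right (1 / ((j : ℝ) + 1)) (ℓ / 2)
    rw [abs_lt] at hm
    refine ⟨b, ?_, ?_, ?_⟩
    · filter_upwards [hb.1 (1 / (j + 1) / 2) (by positivity)] with n hn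
      linarith
    · filter_upwards [hb.1 (ℓ / 4) (by positivity)] with n hn
      have h2 : ℓ / 2 < prodVal b n := by linarith
      have h3 := h2.trans ((prodVal_lt_rightVal _ _).trans (rightVal_lt_one_div _ _))
      rw [lt_div_iff₀ (by positivity)] at h3
      rw [div_lt_iff₀ hℓ] at hB
      have h4 : (b n : ℝ) < B := by
        by_contra hc
        push Not at hc
        nlinarith
      exact_mod_cast h4.le
    · refine (hb.2 (1 / (j + 1) / 2) (by positivity)).mono fun n hn => ?_
      linarith
  choose b hb1 hb2 hb3 using h1
  set K : Set (ℤ → ℕ) := Set.univ.pi fun _ => Icc 0 B with hK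
  have hKc : IsCompact K := isCompact_univ_pi fun _ => (Set.finite_Icc 0 B).isCompact
  -- Truncation at B puts every window in the compact set `K`; far enough to the right it changes
  -- none of the digits used.
  set w : ℕ → ℕ → ℤ → ℕ := fun j n i => min (b j (n + i)) B with hw
  have hwK : ∀ j n, w j n ∈ K := fun j n i _ => ⟨Nat.zero_le _, min_le_right _ _⟩
  have h2 : ∀ j, ∃ ω ∈ K, MapClusterPt ω
      (atTop ⊓ 𝓟 {n : ℕ | prodVal (b j) n < ℓ + 1 / (j + 1)}) (w j) := fun j => by
    have : NeBot (atTop ⊓ 𝓟 {n : ℕ | prodVal (b j) n < ℓ + 1 / (j + 1)}) :=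
      frequently_mem_iff_neBot.1 (hb3 j)
    exact hKc.exists_mapClusterPt (tendsto_principal.2 (Eventually.of_forall (hwK j)))
  choose ω hωK hω using h2
  obtain ⟨W, hWK, hW⟩ := hKc.exists_mapClusterPt
    (tendsto_principal.2 (Eventually.of_forall hωK : ∀ᶠ j in atTop, ω j ∈ K))
  refine mem_prodSpectrum_of_common_window (W := W) fun r => ?_
  have h3 := hW.frequently ((isOpen_window W r).mem_nhds (fun i _ => rfl))
  obtain ⟨j, hj, hjW⟩ := frequently_atTop.1 h3 r
  have hjr : 1 / ((j : ℝ) + 1) ≤ 1 / ((r : ℝ) + 1) :=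
    one_div_le_one_div_of_le (by positivity) (by gcongr)
  refine ⟨b j, (hb1 j).mono fun n hn => by linarith, ?_⟩
  have h4 := (hω j).frequently ((isOpen_window W r).mem_nhds hjW)
  rw [frequently_inf_principal] at h4
  obtain ⟨n₁, hn₁⟩ := eventually_atTop.1 (hb2 j)
  refine (h4.and_eventually (eventually_ge_atTop (n₁ + r))).mono ?_
  rintro n ⟨⟨h5, h6⟩, h7⟩
  have h5' : prodVal (b j) n < ℓ + 1 / (j + 1) := h5
  refine ⟨by linarith, fun i hi => ?_⟩
  have h8 : min (b j (n + i)) B = W i := h6 i hi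
  rw [abs_le] at hi
  have h9 := hn₁ (n + i).toNat (by omega)
  rw [Int.toNat_of_nonneg (by omega)] at h9
  rwa [min_eq_left h9] at h8

lemma isClosed_prodSpectrum : IsClosed prodSpectrum := by
  refine isClosed_of_closure_subset fun ℓ hℓ => ?_
  have h0 : ℓ ∈ Icc (0 : ℝ) 1 := closure_minimal prodSpectrum_subset_Icc isClosed_Icc hℓ
  rcases h0.1.eq_or_lt with h | h
  · rw [← h]; exact zero_mem_prodSpectrum
  · refine mem_prodSpectrum_of_approx h fun ε hε => ?_
    obtain ⟨m, hm, hd⟩ := Metric.mem_closure_iff.1 hℓ ε hε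
    exact ⟨m, hm, by rwa [dist_comm, Real.dist_eq] at hd⟩

end Closedness

/-! ### The two isolated values, from the sequences of periods one and two. -/

section Periodic

lemma hasLiminf_of_le_of_frequently_eq {f : ℕ → ℝ} {c : ℝ} (h1 : ∀ n, c ≤ f n)
    (h2 : ∃ᶠ n in atTop, f n = c) : HasLiminf f c :=
  ⟨fun ε hε => Eventually.of_forall fun n => by linarith [h1 n],
    fun ε hε => h2.mono fun n hn => by rw [hn]; linarith⟩

lemma hasLiminf_const {f : ℕ → ℝ} {c : ℝ} (h : ∀ n, f n = c) : HasLiminf f c :=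
  hasLiminf_of_le_of_frequently_eq (fun n => (h n).ge) (Frequently.of_forall h)

lemma HasLiminf.eq_of_tail_eq {b c : ℤ → ℕ} {N : ℕ} {d : ℤ} {ℓ v : ℝ}
    (hb : HasLiminf (fun n : ℕ => prodVal b n) ℓ) (h : ∀ n : ℤ, N ≤ n → b n = c (n + d))
    (hc : ∀ k, prodVal c k = v) : ℓ = v :=
  (hb.congr (tendsto_prodVal_sub_of_tail_eq h)).unique (hasLiminf_const fun _ => hc _)

lemma cfVal_zero : (cfVal fun _ => 0) = (√5 - 1) / 2 := by
  have h1 := cfVal_eq fun _ => 0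
  have h2 := cfVal_pos fun _ => 0
  set v := cfVal fun _ => 0
  rw [eq_div_iff (by simp; linarith)] at h1
  simp only [Nat.cast_zero, zero_add] at h1
  have h5 : √5 ^ 2 = 5 := Real.sq_sqrt (by norm_num)
  have h6 : 0 < √5 := by positivity
  have h7 : (2 * v + 1 - √5) * (2 * v + 1 + √5) = 0 := by nlinarith
  rcases mul_eq_zero.1 h7 with h | h
  · linarith
  · nlinarith

lemma prodVal_zero (k : ℤ) : prodVal (fun _ => 0) k = (3 - √5) / 2 := by
  rw [prodVal, leftVal, rightVal, cfVal_zero]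
  have h5 : √5 ^ 2 = 5 := Real.sq_sqrt (by norm_num)
  nlinarith

/-- The sequence of period two with digits `1, 0`, that is with partial quotients `2, 1`. -/
def alternatingDigits (i : ℤ) : ℕ := if Even i then 1 else 0

lemma rightVal_alternating (k : ℤ) : rightVal alternatingDigits k
    = if Even k then (√3 - 1) / 2 else √3 - 1 := by
  have hp : ∀ k : ℤ, rightVal alternatingDigits (k + 2) = rightVal alternatingDigits k := by
    intro k
    unfold rightVal
    congr 1; ext i
    simp [alternatingDigits, Int.even_add]
  have key : ∀ k : ℤ, Even k → rightVal alternatingDigits k = (√3 - 1) / 2 ∧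
      rightVal alternatingDigits (k + 1) = √3 - 1 := by
    intro k hk
    have h1 := rightVal_eq alternatingDigits k
    have h2 := rightVal_eq alternatingDigits (k + 1)
    rw [add_assoc k, one_add_one_eq_two, hp] at h2
    have e1 : alternatingDigits k = 1 := if_pos hk
    have e2 : alternatingDigits (k + 1) = 0 := if_neg (by rw [Int.even_add_one]; simpa using hk)
    rw [e1] at h1
    rw [e2] at h2
    have p1 := rightVal_pos alternatingDigits k
    have p2 := rightVal_pos alternatingDigits (k + 1)
    set x := rightVal alternatingDigits k
    set y := rightVal alternatingDigits (k + 1)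
    rw [eq_div_iff (by push_cast; linarith)] at h1 h2
    push_cast at h1 h2
    -- From x (2 + y) = 1 = y (1 + x) the products x y cancel, which leaves the quadratic 2x² + 2x =
    -- 1.
    have e3 : y = 2 * x := by nlinarith
    have h5 : √3 ^ 2 = 3 := Real.sq_sqrt (by norm_num)
    have h6 : 0 < √3 := by positivity
    have h7 : (2 * x + 1 - √3) * (2 * x + 1 + √3) = 0 := by rw [e3] at h1; nlinarith
    rcases mul_eq_zero.1 h7 with h | h
    · exact ⟨by linarith, by linarith⟩
    · nlinarith
  split_ifs with h
  · exact (key k h).1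
  · have := (key (k - 1) (by rw [Int.even_sub_one]; exact h)).2
    rwa [sub_add_cancel] at this

lemma prodVal_alternating (k : ℤ) : prodVal alternatingDigits k = 2 - √3 := by
  -- The sequence is symmetric about 0. The positions k and 1 - k have opposite parity, so each cut
  -- sees one factor of each kind.
  have hl : leftVal alternatingDigits k = rightVal alternatingDigits (1 - k) := by
    unfold leftVal rightVal
    congr 1; ext i
    simp only [alternatingDigits]
    congr 1
    rw [← even_neg]
    congr 2; ring
  have h5 : √3 ^ 2 = 3 := Real.sq_sqrt (by norm_num)
  rw [prodVal, hl, rightVal_alternating, rightVal_alternating]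
  by_cases h : Even k
  · rw [if_pos h, if_neg (by rw [Int.even_sub]; simpa using h)]; nlinarith
  · rw [if_neg h, if_pos (by rw [Int.even_sub]; simpa using h)]; nlinarith

lemma three_sub_sqrt_five_mem_prodSpectrum : (3 - √5) / 2 ∈ prodSpectrum :=
  ⟨_, hasLiminf_const fun n => prodVal_zero n⟩

lemma two_sub_sqrt_three_mem_prodSpectrum : 2 - √3 ∈ prodSpectrum :=
  ⟨_, hasLiminf_const fun n => prodVal_alternating n⟩

end Periodic

/-! ### Sequences whose products eventually exceed 1/4. -/

section LargestElements

lemma rightVal_mul (b : ℤ → ℕ) (k : ℤ) : rightVal b k * (b k + 1 + rightVal b (k + 1)) = 1 := by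
  have := rightVal_pos b (k + 1)
  conv_lhs => rw [rightVal_eq]
  field_simp

lemma leftVal_mul (b : ℤ → ℕ) (k : ℤ) :
    leftVal b k * (b (k - 1) + 1 + leftVal b (k - 1)) = 1 := by
  have := leftVal_pos b (k - 1)
  conv_lhs => rw [leftVal_eq]
  field_simp

lemma gt_of_mul_eq_one_of_lt {x s a : ℝ} (h : x * s = 1) (ha : 0 < a) (has : a < s) :
    x < 1 / a := by
  rw [eq_one_div_of_mul_eq_one_left h]
  exact one_div_lt_one_div_of_lt ha has

lemma lt_of_mul_eq_one_of_lt {x s a : ℝ} (h : x * s = 1) (hs : 0 < s) (has : s < a) :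
    1 / a < x := by
  rw [eq_one_div_of_mul_eq_one_left h]
  exact one_div_lt_one_div_of_lt hs has

variable {b : ℤ → ℕ} {K : ℤ}

lemma digit_le_two_of_prodVal (h : ∀ k ≥ K, 1 / 4 < prodVal b k) {k : ℤ} (hk : K ≤ k) :
    b k ≤ 2 := by
  have h1 := (h k hk).trans ((prodVal_lt_rightVal b k).trans (rightVal_lt_one_div b k))
  rw [one_div_lt_one_div (by norm_num) (by positivity)] at h1
  have : (b k : ℝ) < 3 := by linarith
  have : b k < 3 := by exact_mod_cast this
  omega

/-- A quotient 3 at k makes the right factor there less than 1/3, so the left factor exceeds 3/4. At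
the next cut the left factor is then below 4/15 and the right one below 4/5, and 16/75 < 1/4. -/
lemma digit_le_one_of_prodVal (h : ∀ k ≥ K, 1 / 4 < prodVal b k) {k : ℤ} (hk : K < k) :
    b k ≤ 1 := by
  have h2 := digit_le_two_of_prodVal h hk.le
  by_contra hc
  have hb : b k = 2 := by omega
  have u0 := h k hk.le
  have u1 := h (k + 1) (by omega)
  rw [prodVal] at u0 u1
  have r0 := rightVal_mul b k
  have r1 := rightVal_mul b (k + 1)
  have r2 := rightVal_mul b (k + 1 + 1)
  have l0 := leftVal_mul b k
  have l1 := leftVal_mul b (k + 1)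
  rw [add_sub_cancel_right, hb] at l1
  rw [hb] at r0
  push_cast at r0 l1
  have b2 := digit_le_two_of_prodVal h (k := k + 1 + 1) (by omega)
  have b2' : (b (k + 1 + 1) : ℝ) ≤ 2 := by exact_mod_cast b2
  have p0 := rightVal_pos b k
  have p1 := rightVal_pos b (k + 1)
  have p2 := rightVal_pos b (k + 1 + 1)
  have p3 := rightVal_lt_one b (k + 1 + 1 + 1)
  have q0 := leftVal_pos b k
  have q1 := leftVal_pos b (k + 1)
  have q2 := leftVal_lt_one b (k - 1)
  have q3 := leftVal_pos b (k - 1)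
  have b0 : (0 : ℝ) ≤ b (k + 1) := Nat.cast_nonneg _
  have r0' : rightVal b k < 1 / 3 := by nlinarith
  have l0' : 3 / 4 < leftVal b k := by nlinarith
  have l1' : leftVal b (k + 1) < 4 / 15 := by nlinarith
  have r2' : 1 / 4 < rightVal b (k + 1 + 1) := by nlinarith
  have r1' : rightVal b (k + 1) < 4 / 5 := by nlinarith
  nlinarith

/-- At a cut between two quotients 2 both factors are below 1/2. -/
lemma digit_succ_of_prodVal (h : ∀ k ≥ K, 1 / 4 < prodVal b k) {k : ℤ} (hk : K < k)
    (hb : b k = 1) : b (k + 1) = 0 := by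
  have h1 := digit_le_one_of_prodVal h (k := k + 1) (by omega)
  by_contra hc
  have hb1 : b (k + 1) = 1 := by omega
  have u1 := h (k + 1) (by omega)
  have r := rightVal_lt_one_div b (k + 1)
  have l := leftVal_mul b (k + 1)
  rw [add_sub_cancel_right, hb] at l
  rw [hb1] at r
  push_cast at l r
  norm_num at r
  have q0 := leftVal_pos b k
  have q1 := leftVal_pos b (k + 1)
  have l' : leftVal b (k + 1) < 1 / 2 := by nlinarith
  have p0 := rightVal_pos b (k + 1)
  rw [prodVal] at u1
  nlinarith

/-- The pattern of quotients 1, 2, 1, 1 is impossible: the cut just after the 2 has left factor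
below 7/18 and right factor below 7/11. The margin is thin, 49/198 against 49/196, hence the
expansion several digits deep on both sides and the distance 3 from K. -/
lemma digit_add_two_of_prodVal (h : ∀ k ≥ K, 1 / 4 < prodVal b k) {k : ℤ} (hk : K + 3 < k)
    (hb : b k = 1) : b (k + 2) = 1 := by
  have h0 := digit_le_one_of_prodVal h (k := k + 2) (by omega)
  by_contra hc
  have b2 : b (k + 2) = 0 := by omega
  have b1 := digit_succ_of_prodVal h (by omega) hb
  have bm : b (k - 1) = 0 := by
    by_contra hm
    have := digit_le_one_of_prodVal h (k := k - 1) (by omega)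
    have := digit_succ_of_prodVal h (k := k - 1) (by omega) (by omega)
    rw [sub_add_cancel] at this
    omega
  have u1 := h (k + 1) (by omega)
  rw [prodVal] at u1
  have l1 := leftVal_mul b (k + 1)
  rw [add_sub_cancel_right, hb] at l1
  have l0 := leftVal_mul b k
  rw [bm] at l0
  have l2 := leftVal_mul b (k - 1)
  have l3 := leftVal_mul b (k - 1 - 1)
  have r1 := rightVal_mul b (k + 1)
  rw [b1, show k + 1 + 1 = k + 2 by ring] at r1
  have r2 := rightVal_mul b (k + 2)
  rw [b2] at r2
  have r3 := rightVal_mul b (k + 2 + 1)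
  have r4 := rightVal_mul b (k + 2 + 1 + 1)
  have d1 : (b (k - 1 - 1 - 1) : ℝ) ≤ 1 := by
    exact_mod_cast digit_le_one_of_prodVal h (k := k - 1 - 1 - 1) (by omega)
  have d2 : (b (k + 2 + 1 + 1) : ℝ) ≤ 1 := by
    exact_mod_cast digit_le_one_of_prodVal h (k := k + 2 + 1 + 1) (by omega)
  have d3 : (0 : ℝ) ≤ b (k - 1 - 1) := Nat.cast_nonneg _
  have d4 : (0 : ℝ) ≤ b (k + 2 + 1) := Nat.cast_nonneg _
  push_cast at l1 l0 r1 r2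
  have p5 := rightVal_lt_one b (k + 2 + 1 + 1 + 1)
  have q4 := leftVal_lt_one b (k - 1 - 1 - 1)
  have p5' := rightVal_pos b (k + 2 + 1 + 1 + 1)
  have q4' := leftVal_pos b (k - 1 - 1 - 1)
  have e1 : 1 / 3 < leftVal b (k - 1 - 1) := lt_of_mul_eq_one_of_lt l3 (by positivity) (by linarith)
  have e2 : leftVal b (k - 1) < 1 / (4 / 3) :=
    gt_of_mul_eq_one_of_lt l2 (by norm_num) (by linarith)
  have e3 : 1 / (7 / 4) < leftVal b k :=
    lt_of_mul_eq_one_of_lt l0 (by linarith [leftVal_pos b (k - 1)]) (by norm_num at e2 ⊢; linarith)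
  have e4 : leftVal b (k + 1) < 1 / (18 / 7) :=
    gt_of_mul_eq_one_of_lt l1 (by norm_num) (by norm_num at e3 ⊢; linarith)
  have f1 : 1 / 3 < rightVal b (k + 2 + 1 + 1) :=
    lt_of_mul_eq_one_of_lt r4 (by positivity) (by linarith)
  have f2 : rightVal b (k + 2 + 1) < 1 / (4 / 3) :=
    gt_of_mul_eq_one_of_lt r3 (by norm_num) (by linarith)
  have f3 : 1 / (7 / 4) < rightVal b (k + 2) :=
    lt_of_mul_eq_one_of_lt r2 (by linarith [rightVal_pos b (k + 2 + 1)])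
      (by norm_num at f2 ⊢; linarith)
  have f4 : rightVal b (k + 1) < 1 / (11 / 7) :=
    gt_of_mul_eq_one_of_lt r1 (by norm_num) (by norm_num at f3 ⊢; linarith)
  have := mul_lt_mul'' e4 f4 (leftVal_pos _ _).le (rightVal_pos _ _).le
  norm_num at this u1
  linarith

/-- One quotient 2 far enough out forces strict alternation with 1 ever after; without one the tail
is all 1. The tail decides the lower limit. -/
lemma eq_of_mem_prodSpectrum_of_quarter_lt {ℓ : ℝ} (hℓ : ℓ ∈ prodSpectrum) (h4 : 1 / 4 < ℓ) :
    ℓ = (3 - √5) / 2 ∨ ℓ = 2 - √3 := by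
  obtain ⟨b, hb⟩ := hℓ
  obtain ⟨K, hK⟩ := eventually_atTop.1 (hb.1 (ℓ - 1 / 4) (by linarith))
  have h : ∀ k ≥ (K : ℤ), 1 / 4 < prodVal b k := fun k hk => by
    have : ℓ - (ℓ - 1 / 4) < prodVal b (k.toNat : ℤ) := hK k.toNat (by omega)
    rw [Int.toNat_of_nonneg (by omega)] at this
    linarith
  by_cases hz : ∀ k > (K + 3 : ℤ), b k = 0
  · exact Or.inl (hb.eq_of_tail_eq (N := K + 4) (d := 0)
      (fun n hn => hz n (by push_cast at hn; omega)) prodVal_zero)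
  · push Not at hz
    obtain ⟨k, hk, hk1⟩ := hz
    have hk2 : b k = 1 := by
      have := digit_le_one_of_prodVal h (k := k) (by omega)
      omega
    have h1 : ∀ n : ℕ, b (k + 2 * n) = 1 := by
      intro n
      induction n with
      | zero => simpa using hk2
      | succ n ih =>
        have := digit_add_two_of_prodVal h (by omega) ih
        rwa [add_assoc, show 2 * (n : ℤ) + 2 = 2 * ((n + 1 : ℕ) : ℤ) by push_cast; ring] at this
    refine Or.inr (hb.eq_of_tail_eq (N := k.toNat) (d := -k) (fun n hn => ?_) prodVal_alternating)
    have e := Int.mul_ediv_add_emod (n - k) 2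
    have e1 := h1 ((n - k) / 2).toNat
    rw [Int.toNat_of_nonneg (by omega)] at e1
    rcases Int.emod_two_eq_zero_or_one (n - k) with e2 | e2
    · rw [show k + 2 * ((n - k) / 2) = n by omega] at e1
      rw [e1, alternatingDigits, if_pos (by rw [Int.even_iff]; omega)]
    · have e3 := digit_succ_of_prodVal h (by omega) e1
      rw [show k + 2 * ((n - k) / 2) + 1 = n by omega] at e3
      rw [e3, alternatingDigits, if_neg (by rw [Int.even_iff]; omega)]

end LargestElements

/-! ### Isolated quotients 2 in runs of 1, and the limit √5 - 2. -/

section AccumulationPoint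

/-- The periodic sequence with a digit `1` followed by `n` digits `0`. -/
def sparseDigits (n : ℕ) (i : ℤ) : ℕ := if ((n + 1 : ℕ) : ℤ) ∣ i then 1 else 0

/-- The sequence is symmetric, so the two cuts beside a quotient 2 both give ξ / (2 + ξ), which is
at most 1/4 when ξ < 2/3. Every other cut lies between two quotients 1, where both factors exceed
1/2. -/
lemma sparseDigits_mem {n : ℕ} : rightVal (sparseDigits n) 1 < 2 / 3 →
    rightVal (sparseDigits n) 1 / (2 + rightVal (sparseDigits n) 1) ∈ prodSpectrum := by
  intro hξ
  set c := sparseDigits n with hc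
  have hξ0 := rightVal_pos c 1
  set ξ := rightVal c 1 with hξd
  have hη : rightVal c 0 = 1 / (2 + ξ) := by
    rw [rightVal_eq, zero_add, hc, sparseDigits, if_pos (dvd_zero _)]
    push_cast; congr 2; norm_num
  have hdiv : ξ / (2 + ξ) = ξ * (1 / (2 + ξ)) := by ring
  have h1 : ∀ k : ℤ, ((n + 1 : ℕ) : ℤ) ∣ k → prodVal c k = ξ / (2 + ξ) := by
    intro k hk
    have e1 : rightVal c k = rightVal c 0 := by
      unfold rightVal
      congr 1; ext i
      simp only [hc, sparseDigits]
      congr 1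
      rw [dvd_add_right hk, zero_add]
    have e2 : leftVal c k = ξ := by
      rw [hξd]; unfold leftVal rightVal
      congr 1; ext i
      simp only [hc, sparseDigits]
      congr 1
      rw [show k - 1 - (i : ℤ) = k + -(1 + i) by ring, dvd_add_right hk, dvd_neg]
    rw [prodVal, e1, e2, hη, hdiv]
  have h2 : ∀ k : ℤ, ((n + 1 : ℕ) : ℤ) ∣ k - 1 → prodVal c k = ξ / (2 + ξ) := by
    intro k hk
    have e1 : rightVal c k = ξ := by
      rw [hξd]; unfold rightVal
      congr 1; ext i
      simp only [hc, sparseDigits]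
      congr 1
      rw [show k + (i : ℤ) = (k - 1) + (1 + i) by ring, dvd_add_right hk]
    have e2 : leftVal c k = rightVal c 0 := by
      unfold leftVal rightVal
      congr 1; ext i
      simp only [hc, sparseDigits]
      congr 1
      rw [sub_eq_add_neg, dvd_add_right hk, dvd_neg, zero_add]
    rw [prodVal, e1, e2, hη, hdiv, mul_comm]
  refine ⟨c, hasLiminf_of_le_of_frequently_eq (fun k => ?_) ?_⟩
  · by_cases d1 : ((n + 1 : ℕ) : ℤ) ∣ (k : ℤ)
    · exact (h1 k d1).ge
    by_cases d2 : ((n + 1 : ℕ) : ℤ) ∣ (k : ℤ) - 1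
    · exact (h2 k d2).ge
    have e1 := rightVal_mul c k
    have e2 := leftVal_mul c k
    have z1 : c k = 0 := if_neg d1
    have z2 : c (k - 1) = 0 := if_neg d2
    rw [z1] at e1
    rw [z2] at e2
    have p1 := rightVal_pos c k
    have p2 := rightVal_lt_one c (k + 1)
    have q1 := leftVal_pos c k
    have q2 := leftVal_lt_one c (k - 1)
    push_cast at e1 e2
    have r1 : 1 / 2 < rightVal c k := by nlinarith
    have r2 : 1 / 2 < leftVal c k := by nlinarith
    have : ξ / (2 + ξ) ≤ 1 / 4 := by
      rw [div_le_div_iff₀ (by linarith) (by norm_num)]; linarith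
    rw [prodVal]
    nlinarith
  · rw [frequently_atTop]
    intro N
    refine ⟨(n + 1) * N, Nat.le_mul_of_pos_left _ (by omega), h1 _ ?_⟩
    push_cast
    exact dvd_mul_right _ _

lemma tendsto_rightVal_sparseDigits :
    Tendsto (fun n => rightVal (sparseDigits n) 1) atTop (𝓝 ((√5 - 1) / 2)) := by
  rw [tendsto_iff_norm_sub_tendsto_zero]
  have h2 : Tendsto (fun n : ℕ => (2 : ℝ) * (1 / 2) ^ n) atTop (𝓝 0) := by
    simpa using (tendsto_pow_atTop_nhds_zero_of_lt_one (by norm_num : (0 : ℝ) ≤ 1 / 2)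
      (by norm_num)).const_mul 2
  refine squeeze_zero (fun _ => norm_nonneg _) (fun n => ?_) h2
  rw [← cfVal_zero, Real.norm_eq_abs]
  refine cfVal_sub_le fun i hi => if_neg fun hd => ?_
  have := Int.le_of_dvd (by omega) hd
  push_cast at this
  omega

lemma rightVal_sparseDigits_ne (n : ℕ) : rightVal (sparseDigits n) 1 ≠ (√5 - 1) / 2 := by
  rw [← cfVal_zero]
  intro h
  have := congrFun (cfVal_injective h) n
  rw [sparseDigits, if_pos (by push_cast; rw [add_comm])] at this
  exact one_ne_zero this

/-- `√5 - 2` is a limit of elements of `prodSpectrum` that are different from it. -/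
lemma exists_seq_prodSpectrum_tendsto : ∃ v : ℕ → ℝ, (∀ n, v n ∈ prodSpectrum ∧ v n ≠ √5 - 2) ∧
    Tendsto v atTop (𝓝 (√5 - 2)) := by
  have h5 : √5 ^ 2 = 5 := Real.sq_sqrt (by norm_num)
  have h6 : 0 < √5 := by positivity
  have h7 : √5 < 7 / 3 := by nlinarith
  have hlim := tendsto_rightVal_sparseDigits
  -- The limit of ξ is (√5 - 1)/2, below the threshold 2/3 precisely because √5 < 7/3.
  obtain ⟨N, hN⟩ := eventually_atTop.1 (hlim.eventually (gt_mem_nhds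
    (show (√5 - 1) / 2 < 2 / 3 by linarith)))
  have hval : (√5 - 1) / 2 / (2 + (√5 - 1) / 2) = √5 - 2 := by
    rw [div_eq_iff (by linarith)]; nlinarith
  refine ⟨fun n => rightVal (sparseDigits (n + N)) 1 / (2 + rightVal (sparseDigits (n + N)) 1),
    fun n => ⟨sparseDigits_mem (hN _ (by omega)), fun h => ?_⟩, ?_⟩
  · refine rightVal_sparseDigits_ne (n + N) ?_
    have := rightVal_pos (sparseDigits (n + N)) 1
    rw [← hval, div_eq_div_iff (by linarith) (by linarith)] at h
    linarith
  · rw [← hval]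
    have h8 := hlim.comp (tendsto_add_atTop_nat N)
    exact h8.div (tendsto_const_nhds.add h8) (by linarith)

lemma sqrt_five_sub_two_mem_prodSpectrum : √5 - 2 ∈ prodSpectrum := by
  obtain ⟨v, hv, hlim⟩ := exists_seq_prodSpectrum_tendsto
  exact isClosed_prodSpectrum.mem_of_tendsto hlim (Eventually.of_forall fun n => (hv n).1)

end AccumulationPoint

/-! ### The Cantor set of continued fractions with quotients at most 4. -/

section HallCantorSet

/-- The set of the continued fractions `[0; a₁, a₂, ...]` with all partial quotients at most `4`. -/
def hallSet : Set ℝ := {x | ∃ d : ℕ → ℕ, (∀ i, d i ≤ 3) ∧ cfVal d = x}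

/-- The minimum `[0; 4, 1, 4, 1, ...]` of `hallSet`. -/
noncomputable def hallMin : ℝ := (√2 - 1) / 2

/-- The maximum `[0; 1, 4, 1, 4, ...]` of `hallSet`. -/
noncomputable def hallMax : ℝ := 2 * √2 - 2

lemma sqrt_two_bounds : (141421 : ℝ) / 100000 < √2 ∧ √2 < 141422 / 100000 :=
  ⟨Real.lt_sqrt_of_sq_lt (by norm_num), (Real.sqrt_lt' (by norm_num)).2 (by norm_num)⟩

lemma hallMin_eq : hallMin = 1 / (4 + hallMax) := by
  have h := sqrt_two_bounds
  have h5 : √2 ^ 2 = 2 := Real.sq_sqrt (by norm_num)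
  rw [hallMin, hallMax, eq_div_iff (by linarith)]; nlinarith

lemma hallMax_eq : hallMax = 1 / (1 + hallMin) := by
  have h := sqrt_two_bounds
  have h5 : √2 ^ 2 = 2 := Real.sq_sqrt (by norm_num)
  rw [hallMin, hallMax, eq_div_iff (by linarith)]; nlinarith

lemma hallMin_bounds : (20710 : ℝ) / 100000 ≤ hallMin ∧ hallMin ≤ 20711 / 100000 := by
  have h := sqrt_two_bounds
  rw [hallMin]; constructor <;> linarith

lemma hallMax_bounds : (82842 : ℝ) / 100000 ≤ hallMax ∧ hallMax ≤ 82844 / 100000 := by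
  have h := sqrt_two_bounds
  rw [hallMax]; constructor <;> linarith

lemma hallMin_mem_and_hallMax_mem : hallMin ∈ hallSet ∧ hallMax ∈ hallSet := by
  have h1 := hallMin_bounds
  have h2 := hallMax_bounds
  constructor
  · refine ⟨fun i => if Even i then 3 else 0, fun i => by dsimp only; split_ifs <;> norm_num, ?_⟩
    refine (cfVal_unique (v := fun i => if Even i then hallMin else hallMax) (fun i => ?_)
      fun i => ?_).symm.trans (by simp)
    · split_ifs <;> constructor <;> linarith
    · by_cases hi : Even i
      · have : ¬ Even (i + 1) := by rw [Nat.even_add_one]; simpa using hi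
        simp only [if_pos hi, if_neg this]
        rw [hallMin_eq]; push_cast; congr 2; norm_num
      · have : Even (i + 1) := by rwa [Nat.even_add_one]
        simp only [if_neg hi, if_pos this]
        rw [hallMax_eq]; push_cast; congr 2; norm_num
  · refine ⟨fun i => if Even i then 0 else 3, fun i => by dsimp only; split_ifs <;> norm_num, ?_⟩
    refine (cfVal_unique (v := fun i => if Even i then hallMax else hallMin) (fun i => ?_)
      fun i => ?_).symm.trans (by simp)
    · split_ifs <;> constructor <;> linarith
    · by_cases hi : Even i
      · have : ¬ Even (i + 1) := by rw [Nat.even_add_one]; simpa using hi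
        simp only [if_pos hi, if_neg this]
        rw [hallMax_eq]; push_cast; congr 2; norm_num
      · have : Even (i + 1) := by rwa [Nat.even_add_one]
        simp only [if_neg hi, if_pos this]
        rw [hallMin_eq]; push_cast; congr 2; norm_num

lemma one_div_add_mem_hallSet {c : ℕ} (hc : c ≤ 3) {t : ℝ} (ht : t ∈ hallSet) :
    1 / ((c : ℝ) + 1 + t) ∈ hallSet := by
  obtain ⟨d, hd, rfl⟩ := ht
  refine ⟨fun i => Nat.casesOn i c d, fun i => ?_, ?_⟩
  · cases i with
    | zero => exact hc
    | succ i => exact hd i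
  · exact cfVal_eq _

lemma hallSet_bounds {x : ℝ} (hx : x ∈ hallSet) : 1 / 5 < x ∧ x < 5 / 6 := by
  have key : ∀ d : ℕ → ℕ, (∀ i, d i ≤ 3) → 1 / 5 < cfVal d := fun d hd => by
    rw [cfVal_eq]
    have h1 := cfVal_pos fun i => d (i + 1)
    have h2 := cfVal_lt_one fun i => d (i + 1)
    have h3 : (d 0 : ℝ) ≤ 3 := by exact_mod_cast hd 0
    exact one_div_lt_one_div_of_lt (by positivity) (by linarith)
  obtain ⟨d, hd, rfl⟩ := hx
  refine ⟨key d hd, ?_⟩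
  have h1 := key (fun i => d (i + 1)) fun i => hd _
  rw [cfVal_eq, div_lt_iff₀ (by positivity)]
  have h3 : (0 : ℝ) ≤ d 0 := Nat.cast_nonneg _
  linarith

/-- `g` is a Möbius map given by a finite continued fraction with partial quotients at most `4`;
`s` is its orientation and `q + q' t` its denominator. -/
structure IsHallBranch (g : ℝ → ℝ) (s q q' : ℝ) : Prop where
  mapsTo : ∀ t ∈ hallSet, g t ∈ hallSet
  sign : s = 1 ∨ s = -1
  pos : 0 < q
  nonneg : 0 ≤ q'
  le : q' ≤ q
  sub_eq : ∀ t t' : ℝ, 0 ≤ t → 0 ≤ t' →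
    g t' - g t = s * ((t' - t) / ((q + q' * t) * (q + q' * t')))

lemma IsHallBranch.id : IsHallBranch (fun t => t) 1 1 0 :=
  ⟨fun _ h => h, Or.inl rfl, one_pos, le_rfl, zero_le_one, fun t t' _ _ => by simp⟩

/-- Appending a partial quotient reverses the orientation and updates the denominators by the usual
continuant recursion; `q' ≤ q` persists because the quotient is at least 1. -/
lemma IsHallBranch.comp {g : ℝ → ℝ} {s q q' : ℝ} (h : IsHallBranch g s q q') {c : ℕ}
    (hc : c ≤ 3) :
    IsHallBranch (fun t => g (1 / ((c : ℝ) + 1 + t))) (-s) (q * (c + 1) + q') q := by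
  have hc0 : (0 : ℝ) ≤ c := Nat.cast_nonneg c
  have hq := h.pos
  have hq' := h.nonneg
  refine ⟨fun t ht => h.mapsTo _ (one_div_add_mem_hallSet hc ht), ?_, ?_, h.pos.le, ?_, ?_⟩
  · rcases h.sign with h | h <;> simp [h]
  · positivity
  · nlinarith
  · intro t t' ht ht'
    rw [h.sub_eq _ _ (by positivity) (by positivity), neg_mul, ← mul_neg]
    congr 1
    have h1 : 0 < q * ((c : ℝ) + 1 + t) + q' := by positivity
    have h2 : 0 < q * ((c : ℝ) + 1 + t') + q' := by positivity
    have h3 : 0 < (c : ℝ) + 1 + t := by positivity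
    have h4 : 0 < (c : ℝ) + 1 + t' := by positivity
    have e1 : q * ((c : ℝ) + 1) + q' + q * t = q * (c + 1 + t) + q' := by ring
    have e2 : q * ((c : ℝ) + 1) + q' + q * t' = q * (c + 1 + t') + q' := by ring
    have e3 : q + q' * (1 / ((c : ℝ) + 1 + t)) = (q * (c + 1 + t) + q') / (c + 1 + t) := by
      field_simp
    have e4 : q + q' * (1 / ((c : ℝ) + 1 + t')) = (q * (c + 1 + t') + q') / (c + 1 + t') := by
      field_simp
    rw [e1, e2, e3, e4]
    field_simp
    ring

/-- `x` and `y` are the end points of a bridge of the construction of `hallSet`; `x` is the image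
of `hallMin`. -/
def IsBridge (x y : ℝ) : Prop := ∃ g s q q', IsHallBranch g s q q' ∧ x = g hallMin ∧
  (y = g hallMax ∨ y = g (1 / (2 + hallMin)) ∨ y = g (1 / (3 + hallMin)))

lemma two_inv_mem : 1 / (2 + hallMin) ∈ hallSet := by
  have := one_div_add_mem_hallSet (c := 1) (by norm_num) hallMin_mem_and_hallMax_mem.1
  norm_num at this ⊢; exact this

lemma three_inv_mem : 1 / (3 + hallMin) ∈ hallSet := by
  have := one_div_add_mem_hallSet (c := 2) (by norm_num) hallMin_mem_and_hallMax_mem.1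
  norm_num at this ⊢; exact this

lemma IsBridge.mem {x y : ℝ} (h : IsBridge x y) : x ∈ hallSet ∧ y ∈ hallSet := by
  obtain ⟨g, s, q, q', hg, rfl, h⟩ := h
  refine ⟨hg.mapsTo _ hallMin_mem_and_hallMax_mem.1, ?_⟩
  rcases h with rfl | rfl | rfl
  exacts [hg.mapsTo _ hallMin_mem_and_hallMax_mem.2, hg.mapsTo _ two_inv_mem,
    hg.mapsTo _ three_inv_mem]

/-- The lengths of the two children and of the gap of a bridge, compared with its length. -/
lemma bridge_ratios {q q' t₀ t₁ t₂ t₃ l₀ l₁ l₂ l₃ u₀ u₁ u₂ u₃ : ℝ} (hq : 0 < q) (hq' : 0 ≤ q')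
    (hle : q' ≤ q) (hl : 0 < l₀) (h0 : l₀ ≤ t₀ ∧ t₀ ≤ u₀) (h1 : l₁ ≤ t₁ ∧ t₁ ≤ u₁)
    (h2 : l₂ ≤ t₂ ∧ t₂ ≤ u₂) (h3 : l₃ ≤ t₃ ∧ t₃ ≤ u₃) (h01 : u₀ < l₁) (h12 : u₁ < l₂)
    (h23 : u₂ < l₃) (c1 : 7 / 25 * (u₃ - l₀) ≤ l₁ - u₀) (c2 : 7 / 25 * (u₃ - l₀) ≤ l₃ - u₂)
    (c2' : 7 / 25 * (u₃ - l₀) * (1 + u₂) ≤ (l₃ - u₂) * (1 + l₀))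
    (c3 : u₂ - l₁ ≤ 6 / 25 * (l₃ - u₀)) (c3' : (u₂ - l₁) * (u₀ + u₃) ≤ 6 / 25 * (l₃ - u₀) * (l₁ + l₂))
    (c3'' : (u₂ - l₁) * (u₀ * u₃) ≤ 6 / 25 * (l₃ - u₀) * (l₁ * l₂)) :
    0 < (t₃ - t₀) / ((q + q' * t₀) * (q + q' * t₃)) ∧
    0 < (t₂ - t₁) / ((q + q' * t₁) * (q + q' * t₂)) ∧
    7 / 25 * ((t₃ - t₀) / ((q + q' * t₀) * (q + q' * t₃)))
      ≤ (t₁ - t₀) / ((q + q' * t₀) * (q + q' * t₁)) ∧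
    7 / 25 * ((t₃ - t₀) / ((q + q' * t₀) * (q + q' * t₃)))
      ≤ (t₃ - t₂) / ((q + q' * t₂) * (q + q' * t₃)) ∧
    (t₂ - t₁) / ((q + q' * t₁) * (q + q' * t₂))
      ≤ 6 / 25 * ((t₃ - t₀) / ((q + q' * t₀) * (q + q' * t₃))) := by
  obtain ⟨a0, b0⟩ := h0
  obtain ⟨a1, b1⟩ := h1
  obtain ⟨a2, b2⟩ := h2
  obtain ⟨a3, b3⟩ := h3
  have p0 : 0 < q + q' * t₀ := by have : 0 < t₀ := by linarith
                                  positivity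
  have p1 : 0 < q + q' * t₁ := by have : 0 < t₁ := by linarith
                                  positivity
  have p2 : 0 < q + q' * t₂ := by have : 0 < t₂ := by linarith
                                  positivity
  have p3 : 0 < q + q' * t₃ := by have : 0 < t₃ := by linarith
                                  positivity
  have d03 : 0 < t₃ - t₀ := by linarith
  have d12 : 0 < t₂ - t₁ := by linarith
  refine ⟨by positivity, by positivity, ?_, ?_, ?_⟩
  -- After cancellation each ratio is a polynomial inequality in q and q', to be checked for 0 ≤ q'
  -- ≤ q. For the first child the distortion factor only helps, since t₁ ≤ t₃.
  · rw [← mul_div_assoc, div_le_div_iff₀ (by positivity) (by positivity)]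
    have e : 7 / 25 * (t₃ - t₀) ≤ t₁ - t₀ := by linarith
    have e' : q + q' * t₁ ≤ q + q' * t₃ := by
      have := mul_le_mul_of_nonneg_left (show t₁ ≤ t₃ by linarith) hq'
      linarith
    exact mul_le_mul e (mul_le_mul_of_nonneg_left e' p0.le) (by positivity) (by linarith)
  · rw [← mul_div_assoc, div_le_div_iff₀ (by positivity) (by positivity)]
    have e : 7 / 25 * (t₃ - t₀) ≤ t₃ - t₂ := by linarith
    have e2 : 7 / 25 * (t₃ - t₀) * (1 + t₂) ≤ (t₃ - t₂) * (1 + t₀) := by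
      refine le_trans ?_ (c2'.trans ?_)
      · apply mul_le_mul _ (by linarith) (by linarith) (by linarith)
        linarith
      · apply mul_le_mul (by linarith) (by linarith) (by linarith) (by linarith)
    -- Linear in q', hence a combination of the extreme cases q' = 0 and q' = q with weights q - q'
    -- and q'.
    have e3 : 7 / 25 * (t₃ - t₀) * (q + q' * t₂) ≤ (t₃ - t₂) * (q + q' * t₀) := by
      have f1 := mul_le_mul_of_nonneg_left e (sub_nonneg.2 hle)
      have f2 := mul_le_mul_of_nonneg_left e2 hq'
      linarith
    have := mul_le_mul_of_nonneg_right e3 p3.le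
    linarith
  · rw [← mul_div_assoc, div_le_div_iff₀ (by positivity) (by positivity)]
    -- For the gap the coefficients of q², q q' and q'² are compared one by one.
    have z : 0 ≤ 6 / 25 * (l₃ - u₀) := by linarith
    have z' : 6 / 25 * (l₃ - u₀) ≤ 6 / 25 * (t₃ - t₀) := by linarith
    have e : t₂ - t₁ ≤ 6 / 25 * (t₃ - t₀) := by linarith
    have e' : (t₂ - t₁) * (t₀ + t₃) ≤ 6 / 25 * (t₃ - t₀) * (t₁ + t₂) := by
      refine le_trans ?_ (c3'.trans ?_)
      · exact mul_le_mul (by linarith) (by linarith) (by linarith) (by linarith)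
      · exact mul_le_mul z' (by linarith) (by linarith) (by linarith)
    have e'' : (t₂ - t₁) * (t₀ * t₃) ≤ 6 / 25 * (t₃ - t₀) * (t₁ * t₂) := by
      refine le_trans ?_ (c3''.trans ?_)
      · refine mul_le_mul (by linarith) ?_ ?_ (by linarith)
        · exact mul_le_mul (by linarith) (by linarith) (by linarith) (by linarith)
        · exact mul_nonneg (by linarith) (by linarith)
      · refine mul_le_mul z' ?_ ?_ (by linarith)
        · exact mul_le_mul (by linarith) (by linarith) (by linarith) (by linarith)
        · exact mul_nonneg (by linarith) (by linarith)
    have f1 := mul_le_mul_of_nonneg_left e (mul_nonneg hq.le hq.le)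
    have f2 := mul_le_mul_of_nonneg_left e' (mul_nonneg hq.le hq')
    have f3 := mul_le_mul_of_nonneg_left e'' (mul_nonneg hq' hq')
    linarith

lemma one_div_bounds {x a b : ℝ} (ha : 0 < a) (h : a ≤ x ∧ x ≤ b) {l u : ℝ} (hl : l ≤ 1 / b)
    (hu : 1 / a ≤ u) : l ≤ 1 / x ∧ 1 / x ≤ u :=
  ⟨hl.trans (one_div_le_one_div_of_le (ha.trans_le h.1) h.2),
    (one_div_le_one_div_of_le ha h.1).trans hu⟩

/-- Removing one gap at a time keeps the ratios favourable: the three shapes of bridge allow the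
quotients 1 to 4, 2 to 4, and 3 to 4, and each split detaches the points with the smallest allowed
quotient. A child with a single leading quotient is again a full copy of the hull. The sign `s`
covers both orientations. -/
lemma IsBridge.exists_split {x y : ℝ} (h : IsBridge x y) : ∃ x' y' s D₀ D₁ D₂ D₃ : ℝ,
    (IsBridge x x' ∨ IsBridge x' x) ∧ (IsBridge y y' ∨ IsBridge y' y) ∧ (s = 1 ∨ s = -1) ∧
    y - x = s * D₀ ∧ x' - x = s * D₁ ∧ y' - x' = s * D₂ ∧ y - y' = s * D₃ ∧ 0 < D₀ ∧ 0 < D₂ ∧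
    7 / 25 * D₀ ≤ D₁ ∧ 7 / 25 * D₀ ≤ D₃ ∧ D₂ ≤ 6 / 25 * D₀ := by
  obtain ⟨g, s, q, q', hg, rfl, h⟩ := h
  have bm := hallMin_bounds
  have bM := hallMax_bounds
  have b4m : (23769 : ℝ) / 100000 ≤ 1 / (4 + hallMin) ∧ 1 / (4 + hallMin) ≤ 23770 / 100000 :=
    one_div_bounds (a := 4 + 20710 / 100000) (b := 4 + 20711 / 100000) (by norm_num)
      ⟨by linarith, by linarith⟩ (by norm_num) (by norm_num)
  have b3M : (26120 : ℝ) / 100000 ≤ 1 / (3 + hallMax) ∧ 1 / (3 + hallMax) ≤ 26121 / 100000 :=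
    one_div_bounds (a := 3 + 82842 / 100000) (b := 3 + 82844 / 100000) (by norm_num)
      ⟨by linarith, by linarith⟩ (by norm_num) (by norm_num)
  have b3m : (31180 : ℝ) / 100000 ≤ 1 / (3 + hallMin) ∧ 1 / (3 + hallMin) ≤ 31182 / 100000 :=
    one_div_bounds (a := 3 + 20710 / 100000) (b := 3 + 20711 / 100000) (by norm_num)
      ⟨by linarith, by linarith⟩ (by norm_num) (by norm_num)
  have b2M : (35355 : ℝ) / 100000 ≤ 1 / (2 + hallMax) ∧ 1 / (2 + hallMax) ≤ 35356 / 100000 :=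
    one_div_bounds (a := 2 + 82842 / 100000) (b := 2 + 82844 / 100000) (by norm_num)
      ⟨by linarith, by linarith⟩ (by norm_num) (by norm_num)
  have b2m : (45308 : ℝ) / 100000 ≤ 1 / (2 + hallMin) ∧ 1 / (2 + hallMin) ≤ 45309 / 100000 :=
    one_div_bounds (a := 2 + 20710 / 100000) (b := 2 + 20711 / 100000) (by norm_num)
      ⟨by linarith, by linarith⟩ (by norm_num) (by norm_num)
  have b1M : (54690 : ℝ) / 100000 ≤ 1 / (1 + hallMax) ∧ 1 / (1 + hallMax) ≤ 54693 / 100000 :=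
    one_div_bounds (a := 1 + 82842 / 100000) (b := 1 + 82844 / 100000) (by norm_num)
      ⟨by linarith, by linarith⟩ (by norm_num) (by norm_num)
  have hsub : ∀ t t', 0 ≤ t → 0 ≤ t' →
      g t' - g t = s * ((t' - t) / ((q + q' * t) * (q + q' * t'))) := hg.sub_eq
  have hchild : ∀ c : ℕ, c ≤ 3 →
      IsBridge (g (1 / ((c : ℝ) + 1 + hallMin))) (g (1 / ((c : ℝ) + 1 + hallMax))) := fun c hc =>
    ⟨_, _, _, _, hg.comp hc, rfl, Or.inl rfl⟩
  rcases h with rfl | rfl | rfl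
  · obtain ⟨h1, h2, h3, h4, h5⟩ := bridge_ratios hg.pos hg.nonneg hg.le (by norm_num) bm b2m b1M bM
      (by norm_num) (by norm_num) (by norm_num) (by norm_num) (by norm_num) (by norm_num)
      (by norm_num) (by norm_num) (by norm_num)
    refine ⟨g (1 / (2 + hallMin)), g (1 / (1 + hallMax)), s, _, _, _, _,
      Or.inl ⟨g, s, q, q', hg, rfl, Or.inr (Or.inl rfl)⟩, Or.inl ?_, hg.sign,
      hsub _ _ ?_ ?_, hsub _ _ ?_ ?_, hsub _ _ ?_ ?_, hsub _ _ ?_ ?_, h1, h2, h3, h4, h5⟩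
    · have := hchild 0 (by norm_num)
      norm_num at this
      rwa [← one_div, ← one_div, ← hallMax_eq] at this
    all_goals linarith
  · obtain ⟨h1, h2, h3, h4, h5⟩ := bridge_ratios hg.pos hg.nonneg hg.le (by norm_num) bm b3m b2M b2m
      (by norm_num) (by norm_num) (by norm_num) (by norm_num) (by norm_num) (by norm_num)
      (by norm_num) (by norm_num) (by norm_num)
    refine ⟨g (1 / (3 + hallMin)), g (1 / (2 + hallMax)), s, _, _, _, _,
      Or.inl ⟨g, s, q, q', hg, rfl, Or.inr (Or.inr rfl)⟩, Or.inl ?_, hg.sign,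
      hsub _ _ ?_ ?_, hsub _ _ ?_ ?_, hsub _ _ ?_ ?_, hsub _ _ ?_ ?_, h1, h2, h3, h4, h5⟩
    · have := hchild 1 (by norm_num)
      norm_num at this
      rwa [← one_div, ← one_div] at this
    all_goals linarith
  · obtain ⟨h1, h2, h3, h4, h5⟩ := bridge_ratios hg.pos hg.nonneg hg.le (by norm_num) bm b4m b3M b3m
      (by norm_num) (by norm_num) (by norm_num) (by norm_num) (by norm_num) (by norm_num)
      (by norm_num) (by norm_num) (by norm_num)
    refine ⟨g (1 / (4 + hallMin)), g (1 / (3 + hallMax)), s, _, _, _, _,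
      Or.inr ?_, Or.inl ?_, hg.sign,
      hsub _ _ ?_ ?_, hsub _ _ ?_ ?_, hsub _ _ ?_ ?_, hsub _ _ ?_ ?_, h1, h2, h3, h4, h5⟩
    · have := hchild 3 (by norm_num)
      norm_num at this
      rwa [← one_div, ← one_div, ← hallMin_eq] at this
    · have := hchild 2 (by norm_num)
      norm_num at this
      rwa [← one_div, ← one_div] at this
    all_goals linarith

/-- A bridge, with its end points in increasing order. -/
def IsOrderedBridge (x y : ℝ) : Prop := x < y ∧ (IsBridge x y ∨ IsBridge y x)

lemma IsOrderedBridge.mem {x y : ℝ} (h : IsOrderedBridge x y) : x ∈ hallSet ∧ y ∈ hallSet := by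
  rcases h.2 with h | h
  exacts [h.mem, h.mem.symm]

lemma IsOrderedBridge.exists_split {x y : ℝ} (h : IsOrderedBridge x y) : ∃ x' y',
    IsOrderedBridge x x' ∧ IsOrderedBridge y' y ∧ x' < y' ∧ 7 / 25 * (y - x) ≤ x' - x ∧
    7 / 25 * (y - x) ≤ y - y' ∧ y' - x' ≤ 6 / 25 * (y - x) := by
  have key : ∀ x y : ℝ, x < y → IsBridge x y → ∃ x' y',
    IsOrderedBridge x x' ∧ IsOrderedBridge y' y ∧ x' < y' ∧ 7 / 25 * (y - x) ≤ x' - x ∧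
    7 / 25 * (y - x) ≤ y - y' ∧ y' - x' ≤ 6 / 25 * (y - x) := by
    intro x y hxy h
    obtain ⟨x', y', s, D₀, D₁, D₂, D₃, h1, h2, hs, e0, e1, e2, e3, p0, p2, r1, r3, r2⟩ :=
      h.exists_split
    rcases hs with rfl | rfl
    · rw [one_mul] at e0 e1 e2 e3
      exact ⟨x', y', ⟨by linarith, h1⟩, ⟨by linarith, h2.symm⟩, by linarith, by linarith,
        by linarith, by linarith⟩
    · linarith
  have key' : ∀ x y : ℝ, x < y → IsBridge y x → ∃ x' y',
    IsOrderedBridge x x' ∧ IsOrderedBridge y' y ∧ x' < y' ∧ 7 / 25 * (y - x) ≤ x' - x ∧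
    7 / 25 * (y - x) ≤ y - y' ∧ y' - x' ≤ 6 / 25 * (y - x) := by
    intro x y hxy h
    obtain ⟨y', x', s, D₀, D₁, D₂, D₃, h1, h2, hs, e0, e1, e2, e3, p0, p2, r1, r3, r2⟩ :=
      h.exists_split
    rcases hs with rfl | rfl
    · linarith
    · exact ⟨x', y', ⟨by linarith, h2⟩, ⟨by linarith, h1.symm⟩, by linarith, by linarith,
        by linarith, by linarith⟩
  rcases h.2 with h' | h'
  exacts [key x y h.1 h', key' x y h.1 h']

lemma isOrderedBridge_hull : IsOrderedBridge hallMin hallMax :=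
  ⟨by linarith [hallMin_bounds.2, hallMax_bounds.1],
    Or.inl ⟨_, _, _, _, IsHallBranch.id, rfl, Or.inl rfl⟩⟩

end HallCantorSet

/-! ### Products of two translates of the Cantor set. -/

section HallProducts

/-- Two bridges of comparable length, the products of whose translates by `a` and `b` surround
`M`. -/
structure IsLinkedPair (a b M i₀ i₁ j₀ j₁ : ℝ) : Prop where
  left : IsOrderedBridge i₀ i₁
  right : IsOrderedBridge j₀ j₁
  lower : (a + i₀) * (b + j₀) ≤ M
  upper : M ≤ (a + i₁) * (b + j₁)
  le_right : 7 / 25 * ((i₁ - i₀) * (b + 1 / 5)) ≤ (j₁ - j₀) * (a + 1 / 5)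
  le_left : 7 / 25 * ((j₁ - j₀) * (a + 1 / 5)) ≤ (i₁ - i₀) * (b + 1 / 5)

lemma IsLinkedPair.swap {a b M i₀ i₁ j₀ j₁ : ℝ} (h : IsLinkedPair a b M i₀ i₁ j₀ j₁) :
    IsLinkedPair b a M j₀ j₁ i₀ i₁ :=
  ⟨h.right, h.left, by rw [mul_comm]; exact h.lower, by rw [mul_comm]; exact h.upper,
    h.le_left, h.le_right⟩

/-- The sum of the weighted lengths of a pair of bridges. -/
noncomputable def pairSize (a b i₀ i₁ j₀ j₁ : ℝ) : ℝ :=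
  (i₁ - i₀) * (b + 1 / 5) + (j₁ - j₀) * (a + 1 / 5)

/-- Split the bridge of larger weighted length. The ranges of products given by its two children
overlap, so one child still surrounds M; being at least 7/25 of its parent, it stays comparable with
the other bridge. -/
lemma IsLinkedPair.exists_smaller_of_le {a b M i₀ i₁ j₀ j₁ : ℝ} (hb : 5 ≤ b)
    (h : IsLinkedPair a b M i₀ i₁ j₀ j₁)
    (hle : (j₁ - j₀) * (a + 1 / 5) ≤ (i₁ - i₀) * (b + 1 / 5)) :
    ∃ i₀' i₁' j₀' j₁', IsLinkedPair a b M i₀' i₁' j₀' j₁' ∧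
      pairSize a b i₀' i₁' j₀' j₁' ≤ 43 / 50 * pairSize a b i₀ i₁ j₀ j₁ := by
  obtain ⟨g₀, g₁, hI, hI', hg, r1, r2, r3⟩ := h.left.exists_split
  have hl := h.le_right
  have hr := h.le_left
  have hB : 0 < b + 1 / 5 := by linarith
  have f1 := mul_le_mul_of_nonneg_right r1 hB.le
  have f2 := mul_le_mul_of_nonneg_right r2 hB.le
  have f3 := mul_le_mul_of_nonneg_right r3 hB.le
  have f4 := mul_pos (sub_pos.2 hg) hB
  have f5 := mul_pos (sub_pos.2 hI.1) hB
  have f6 := mul_pos (sub_pos.2 hI'.1) hB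
  have bj := (hallSet_bounds h.right.mem.1).2
  have bg := (hallSet_bounds hI.mem.2).1
  have hj := h.right.1
  -- The heart of the method: the gap contributes at most 6/25 · 9/8 = 27/100 of the larger weighted
  -- length, and the other bridge at least 28/100. The factor 9/8 bounds (b + j₀) / (b + 1/5), which
  -- uses 5 ≤ b and j₀ < 5/6.
  have hcover : (a + g₁) * (b + j₀) ≤ (a + g₀) * (b + j₁) := by
    have k1 : (g₁ - g₀) * (b + j₀) ≤ (g₁ - g₀) * (9 / 8 * (b + 1 / 5)) := by
      refine mul_le_mul_of_nonneg_left ?_ (by linarith)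
      linarith
    have k2 : (j₁ - j₀) * (a + 1 / 5) ≤ (j₁ - j₀) * (a + g₀) :=
      mul_le_mul_of_nonneg_left (by linarith) (by linarith)
    linarith
  rcases le_total M ((a + g₀) * (b + j₁)) with hM | hM
  · refine ⟨i₀, g₀, j₀, j₁, ⟨hI, h.right, h.lower, hM, ?_, ?_⟩, ?_⟩
    · linarith
    · linarith
    -- At least 7/25 of the larger half is discarded, that is 7/50 of the total; hence 43/50.
    · rw [pairSize, pairSize]; linarith
  · refine ⟨g₁, i₁, j₀, j₁, ⟨hI', h.right, hcover.trans hM, h.upper, ?_, ?_⟩, ?_⟩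
    · linarith
    · linarith
    · rw [pairSize, pairSize]; linarith

lemma IsLinkedPair.exists_smaller {a b M i₀ i₁ j₀ j₁ : ℝ} (ha : 5 ≤ a) (hb : 5 ≤ b)
    (h : IsLinkedPair a b M i₀ i₁ j₀ j₁) :
    ∃ i₀' i₁' j₀' j₁', IsLinkedPair a b M i₀' i₁' j₀' j₁' ∧
      pairSize a b i₀' i₁' j₀' j₁' ≤ 43 / 50 * pairSize a b i₀ i₁ j₀ j₁ := by
  rcases le_total ((j₁ - j₀) * (a + 1 / 5)) ((i₁ - i₀) * (b + 1 / 5)) with hle | hle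
  · exact h.exists_smaller_of_le hb hle
  · obtain ⟨j₀', j₁', i₀', i₁', h1, h2⟩ := h.swap.exists_smaller_of_le ha hle
    refine ⟨i₀', i₁', j₀', j₁', h1.swap, ?_⟩
    rw [pairSize, pairSize] at h2 ⊢
    linarith

/-- Repeated splitting of the hull pair, which is linked because a and b differ by at most 1. The
weighted size shrinks geometrically and controls the spread of the products. An approximation is
enough, so the intersection of the nested bridges is never needed. -/
lemma exists_hallSet_mul_near_of_mem {a b M : ℝ} (ha : 5 ≤ a) (hb : 5 ≤ b) (hab : a ≤ b)
    (hba : b ≤ a + 1) (h1 : (a + hallMin) * (b + hallMin) ≤ M)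
    (h2 : M ≤ (a + hallMax) * (b + hallMax)) {ε : ℝ} (hε : 0 < ε) :
    ∃ x ∈ hallSet, ∃ y ∈ hallSet, |(a + x) * (b + y) - M| < ε := by
  have hd : 0 < hallMax - hallMin := sub_pos.2 isOrderedBridge_hull.1
  have key : ∀ n : ℕ, ∃ i₀ i₁ j₀ j₁, IsLinkedPair a b M i₀ i₁ j₀ j₁ ∧
      pairSize a b i₀ i₁ j₀ j₁ ≤ (43 / 50) ^ n * pairSize a b hallMin hallMax hallMin hallMax := by
    intro n
    induction n with
    | zero =>
      refine ⟨hallMin, hallMax, hallMin, hallMax,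
        ⟨isOrderedBridge_hull, isOrderedBridge_hull, h1, h2, ?_, ?_⟩, by simp⟩
      · nlinarith
      · nlinarith
    | succ n ih =>
      obtain ⟨i₀, i₁, j₀, j₁, h, hs⟩ := ih
      obtain ⟨i₀', i₁', j₀', j₁', h', hs'⟩ := h.exists_smaller ha hb
      refine ⟨i₀', i₁', j₀', j₁', h', hs'.trans ?_⟩
      rw [pow_succ', mul_assoc]
      exact mul_le_mul_of_nonneg_left hs (by norm_num)
  have hlim : Tendsto (fun n : ℕ => (43 / 50 : ℝ) ^ n *
      pairSize a b hallMin hallMax hallMin hallMax) atTop (𝓝 0) := by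
    simpa using (tendsto_pow_atTop_nhds_zero_of_lt_one (by norm_num : (0 : ℝ) ≤ 43 / 50)
      (by norm_num)).mul_const (pairSize a b hallMin hallMax hallMin hallMax)
  obtain ⟨n, hn⟩ := (hlim.eventually (gt_mem_nhds (by linarith : 0 < ε / 2))).exists
  obtain ⟨i₀, i₁, j₀, j₁, h, hs⟩ := key n
  refine ⟨i₀, h.left.mem.1, j₀, h.right.mem.1, ?_⟩
  have b1 := (hallSet_bounds h.right.mem.2).2
  have b2 := (hallSet_bounds h.left.mem.1).2
  have b3 := (hallSet_bounds h.right.mem.2).1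
  have k1 : (i₁ - i₀) * (b + j₁) ≤ (i₁ - i₀) * (2 * (b + 1 / 5)) :=
    mul_le_mul_of_nonneg_left (by linarith) (sub_pos.2 h.left.1).le
  have k2 : (j₁ - j₀) * (a + i₀) ≤ (j₁ - j₀) * (2 * (a + 1 / 5)) :=
    mul_le_mul_of_nonneg_left (by linarith) (sub_pos.2 h.right.1).le
  have hsz := hs.trans_lt hn
  rw [pairSize] at hsz
  rw [abs_sub_lt_iff]
  have l := h.lower
  have u := h.upper
  constructor
  · linarith
  · nlinarith

/-- Every number from `(5 + hallMin) ^ 2` on is almost a product of two continued fractions with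
integer parts at least `5` and the other partial quotients at most `4`. -/
lemma exists_hallSet_mul_near {M : ℝ} (hM : (5 + hallMin) ^ 2 ≤ M) : ∃ a b : ℕ, 5 ≤ a ∧ 5 ≤ b ∧
    ∀ ε > 0, ∃ x ∈ hallSet, ∃ y ∈ hallSet, |((a : ℝ) + x) * (b + y) - M| < ε := by
  have bm := hallMin_bounds
  have bM := hallMax_bounds
  have hM0 : 0 < M := lt_of_lt_of_le (by nlinarith) hM
  have hs : 5 + hallMin ≤ √M := Real.le_sqrt_of_sq_le hM
  obtain ⟨n, hn⟩ : ∃ n : ℕ, n = ⌊√M - hallMin⌋₊ := ⟨_, rfl⟩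
  have hn1 : (n : ℝ) ≤ √M - hallMin := hn ▸ Nat.floor_le (by linarith)
  have hn2 : √M - hallMin < n + 1 := hn ▸ Nat.lt_floor_add_one _
  have hn5 : 5 ≤ n := by
    rw [hn]; exact Nat.le_floor (by push_cast; linarith)
  have hn5' : (5 : ℝ) ≤ n := by exact_mod_cast hn5
  have hsq : √M ^ 2 = M := Real.sq_sqrt hM0.le
  have l1 : ((n : ℝ) + hallMin) * (n + hallMin) ≤ M := by nlinarith
  have l2 : M ≤ ((n : ℝ) + 1 + hallMin) * (n + 1 + hallMin) := by nlinarith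
  -- The ranges for (n, n), (n, n + 1) and (n + 1, n + 1) overlap: `hallMax` - `hallMin` is about
  -- 0.62, more than the half step between the geometric means.
  rcases le_total M (((n : ℝ) + hallMax) * (n + hallMax)) with h | h
  · exact ⟨n, n, hn5, hn5, fun ε hε => exists_hallSet_mul_near_of_mem hn5' hn5' le_rfl
      (by linarith) l1 h hε⟩
  · refine ⟨n, n + 1, hn5, by omega, fun ε hε => ?_⟩
    push_cast
    exact exists_hallSet_mul_near_of_mem hn5' (by linarith) (by linarith) le_rfl
      (le_trans (by nlinarith) h) (l2.trans (by nlinarith)) hε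

end HallProducts

/-! ### Realisation of these products by periodic sequences. -/

section HallRay

/-- The bi-infinite sequence `... x₁ x₀ . y₀ y₁ ...`. -/
def joinDigits (x y : ℕ → ℕ) (i : ℤ) : ℕ := if 0 ≤ i then y i.toNat else x (-1 - i).toNat

/-- The periodic sequence that repeats the central block of length `2 n` of `Z`. -/
def repeatBlock (Z : ℤ → ℕ) (n : ℕ) (i : ℤ) : ℕ :=
  if i % (2 * n : ℕ) < n then Z (i % (2 * n : ℕ)) else Z (i % (2 * n : ℕ) - (2 * n : ℕ))

lemma repeatBlock_add_mul (Z : ℤ → ℕ) (n : ℕ) (i k : ℤ) :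
    repeatBlock Z n (i + (2 * n : ℕ) * k) = repeatBlock Z n i := by
  simp only [repeatBlock, Int.add_mul_emod_self_left]

lemma repeatBlock_of_lt {Z : ℤ → ℕ} {n : ℕ} {i : ℤ} (h1 : -(n : ℤ) ≤ i) (h2 : i < n) :
    repeatBlock Z n i = Z i := by
  rcases lt_or_ge i 0 with h | h
  · have : i % (2 * n : ℕ) = i + (2 * n : ℕ) := by
      rw [← Int.add_emod_right, Int.emod_eq_of_lt] <;> push_cast <;> omega
    rw [repeatBlock, this, if_neg (by push_cast; omega), add_sub_cancel_right]
  · have : i % (2 * n : ℕ) = i := Int.emod_eq_of_lt h (by push_cast; omega)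
    rw [repeatBlock, this, if_pos h2]

lemma repeatBlock_of_ge {Z : ℤ → ℕ} {n : ℕ} {i : ℤ} (h1 : (n : ℤ) ≤ i) (h2 : i < 2 * n) :
    repeatBlock Z n i = Z (i - 2 * n) := by
  rw [← repeatBlock_of_lt (Z := Z) (n := n) (i := i - 2 * n) (by omega) (by omega),
    ← repeatBlock_add_mul Z n (i - 2 * n) 1]
  congr 1; push_cast; ring

lemma prodVal_eq_of_digits {b c : ℤ → ℕ} {k m : ℤ} (h : ∀ i, b (k + i) = c (m + i)) :
    prodVal b k = prodVal c m := by
  have h1 : leftVal b k = leftVal c m := by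
    unfold leftVal
    congr 1; ext i
    have := h (-1 - i)
    rwa [show k + (-1 - (i : ℤ)) = k - 1 - i by ring,
      show m + (-1 - (i : ℤ)) = m - 1 - i by ring] at this
  have h2 : rightVal b k = rightVal c m := by
    unfold rightVal
    congr 1; ext i
    exact h i
  rw [prodVal, prodVal, h1, h2]

lemma leftVal_lt_one_div (b : ℤ → ℕ) (k : ℤ) : leftVal b k < 1 / (b (k - 1) + 1) := by
  have h := leftVal_pos b (k - 1)
  rw [leftVal_eq]
  exact one_div_lt_one_div_of_lt (by positivity) (by linarith)

lemma one_fifth_lt_rightVal {b : ℤ → ℕ} {k : ℤ} (h : b k ≤ 3) : 1 / 5 < rightVal b k := by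
  have h1 := rightVal_lt_one b (k + 1)
  have h2 := rightVal_pos b (k + 1)
  have h3 : (b k : ℝ) ≤ 3 := by exact_mod_cast h
  rw [rightVal_eq]
  exact one_div_lt_one_div_of_lt (by positivity) (by linarith)

lemma one_fifth_lt_leftVal {b : ℤ → ℕ} {k : ℤ} (h : b (k - 1) ≤ 3) : 1 / 5 < leftVal b k := by
  have h1 := leftVal_lt_one b (k - 1)
  have h2 := leftVal_pos b (k - 1)
  have h3 : (b (k - 1) : ℝ) ≤ 3 := by exact_mod_cast h
  rw [leftVal_eq]
  exact one_div_lt_one_div_of_lt (by positivity) (by linarith)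

/-- A long block with the large quotients a, b at its centre and quotients at most 4 elsewhere is
repeated periodically. The cut between a and b has almost the required product, and no other cut
within a period has a product below that of the unrepeated sequence. -/
lemma exists_prodSpectrum_near {a b : ℕ} (ha : 5 ≤ a) (hb : 5 ≤ b) {x y : ℝ} (hx : x ∈ hallSet)
    (hy : y ∈ hallSet) {ε : ℝ} (hε : 0 < ε) :
    ∃ ℓ ∈ prodSpectrum, |ℓ - 1 / ((a + x) * (b + y))| ≤ ε := by
  have bx := (hallSet_bounds hx).1
  have by' := (hallSet_bounds hy).1
  obtain ⟨X, hX, rfl⟩ := hx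
  obtain ⟨Y, hY, rfl⟩ := hy
  have ha' : (5 : ℝ) ≤ a := by exact_mod_cast ha
  have hb' : (5 : ℝ) ≤ b := by exact_mod_cast hb
  set Z := joinDigits (fun i => Nat.casesOn i (a - 1) X) (fun i => Nat.casesOn i (b - 1) Y) with hZ
  have hZ0 : Z 0 = b - 1 := rfl
  have hZm : Z (-1) = a - 1 := rfl
  have hZpos : ∀ i : ℤ, 1 ≤ i → Z i ≤ 3 := fun i hi => by
    simp only [hZ, joinDigits]
    rw [if_pos (by omega)]
    obtain ⟨j, hj⟩ : ∃ j, i.toNat = j + 1 := ⟨i.toNat - 1, by omega⟩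
    rw [hj]; exact hY j
  have hZneg : ∀ i : ℤ, i ≤ -2 → Z i ≤ 3 := fun i hi => by
    simp only [hZ, joinDigits]
    rw [if_neg (by omega)]
    obtain ⟨j, hj⟩ : ∃ j, (-1 - i).toNat = j + 1 := ⟨(-1 - i).toNat - 1, by omega⟩
    rw [hj]; exact hX j
  have hv : prodVal Z 0 = 1 / ((a + cfVal X) * (b + cfVal Y)) := by
    have e1 : rightVal Z 0 = 1 / (b + cfVal Y) := by
      rw [rightVal_eq, hZ0, Nat.cast_sub (by omega)]
      push_cast
      rw [sub_add_cancel, rightVal]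
      congr 4; ext i
      simp only [hZ, joinDigits]
      rw [if_pos (by omega), show (1 + (i : ℤ)).toNat = i + 1 by omega]
    have e2 : leftVal Z 0 = 1 / (a + cfVal X) := by
      rw [leftVal_eq, zero_sub, hZm, Nat.cast_sub (by omega)]
      push_cast
      rw [sub_add_cancel, leftVal]
      congr 4; ext i
      simp only [hZ, joinDigits]
      rw [if_neg (by omega), show (-1 - (-1 - 1 - (i : ℤ))).toNat = i + 1 by omega]
    rw [prodVal, e1, e2, one_div_mul_one_div]
  rw [← hv]
  -- A cut between two quotients at most 4 has both factors above 1/5, while the central product is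
  -- at most 1/25.
  have hle1 : ∀ t : ℝ, 1 / 5 < t → ∀ s : ℝ, 1 / 5 < s → prodVal Z 0 ≤ t * s := fun t ht s hs => by
    have h1 : prodVal Z 0 ≤ 1 / 25 := by
      rw [hv]
      exact one_div_le_one_div_of_le (by norm_num) (by nlinarith)
    nlinarith
  obtain ⟨n₀, hn₀⟩ := eventually_atTop.1 (tendsto_four_mul_half_pow.eventually (gt_mem_nhds hε))
  set n := n₀ + 3 with hn
  set c := repeatBlock Z n with hc
  have hshift : ∀ k i : ℤ, c (k + i) = c (k % (2 * n : ℕ) + i) := fun k i => by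
    rw [hc, ← repeatBlock_add_mul Z n (k % (2 * n : ℕ) + i) (k / (2 * n : ℕ))]
    congr 1
    have := Int.mul_ediv_add_emod k (2 * n : ℕ)
    linarith
  have hcentre : |prodVal c 0 - prodVal Z 0| ≤ ε := by
    refine (abs_prodVal_sub_le (r := n₀) fun i hi => ?_).trans (hn₀ n₀ le_rfl).le
    rw [abs_le] at hi
    exact repeatBlock_of_lt (by push_cast [hn]; omega) (by push_cast [hn]; omega)
  have hsmall : ∀ i : ℤ, 1 ≤ i → i ≤ 2 * n - 2 → c i ≤ 3 := fun i h1 h2 => by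
    rcases lt_or_ge i n with h | h
    · rw [hc, repeatBlock_of_lt (by omega) h]; exact hZpos i h1
    · rw [hc, repeatBlock_of_ge h (by omega)]; exact hZneg _ (by omega)
  have hc0 : c 0 = b - 1 := (repeatBlock_of_lt (by omega) (by omega)).trans hZ0
  have hcm : c (-1) = a - 1 := (repeatBlock_of_lt (by push_cast [hn]; omega) (by omega)).trans hZm
  have hlow : ∀ k : ℤ, k % (2 * n : ℕ) ≠ 0 → prodVal Z 0 ≤ prodVal c k := by
    intro k hk
    rw [prodVal_eq_of_digits (hshift k)]
    have r0 := Int.emod_nonneg k (show ((2 * n : ℕ) : ℤ) ≠ 0 by push_cast [hn]; omega)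
    have r1 := Int.emod_lt_of_pos k (show (0 : ℤ) < (2 * n : ℕ) by push_cast [hn]; omega)
    generalize k % (2 * n : ℕ) = r at *
    have hn3 : (3 : ℤ) ≤ n := by push_cast [hn]; omega
    have r1' : r < 2 * n := by push_cast at r1; exact r1
    -- The cut just after b: its left factor is 1 / (b + t) with t < 1/a ≤ 1/5, and 1/5 is less than
    -- y, so it beats the central factor 1 / (b + y); the right factor exceeds 1/5. The cut just
    -- before a is its mirror image.
    rcases eq_or_ne r 1 with rfl | h1
    · have e1 := one_fifth_lt_rightVal (hsmall 1 (by omega) (by omega))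
      have e2 := leftVal_eq c 1
      have e3 := leftVal_lt_one_div c 0
      rw [sub_self, hc0, Nat.cast_sub (by omega)] at e2
      rw [zero_sub, hcm, Nat.cast_sub (by omega)] at e3
      push_cast at e2 e3
      rw [sub_add_cancel] at e2 e3
      have e4 : leftVal c 0 < 1 / 5 := e3.trans_le (one_div_le_one_div_of_le (by norm_num) ha')
      have p := leftVal_pos c 0
      rw [hv, prodVal, e2]
      have e5 : 1 / (((a : ℝ) + cfVal X) * (b + cfVal Y)) ≤ 1 / (b + leftVal c 0) * (1 / 5) := by
        rw [one_div_mul_one_div]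
        exact one_div_le_one_div_of_le (by positivity) (by nlinarith)
      exact e5.trans (mul_le_mul_of_nonneg_left e1.le (by positivity))
    rcases eq_or_ne r (2 * n - 1) with h2 | h2
    · have e1 := one_fifth_lt_leftVal (hsmall (r - 1) (by omega) (by omega))
      have e2 := rightVal_eq c r
      have e3 := rightVal_lt_one_div c (r + 1)
      have z1 : c r = a - 1 := by
        rw [← hcm, hc, ← repeatBlock_add_mul Z n (-1) 1]
        congr 1; push_cast; omega
      have z2 : c (r + 1) = b - 1 := by
        rw [← hc0, hc, ← repeatBlock_add_mul Z n 0 1]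
        congr 1; push_cast; omega
      rw [z1, Nat.cast_sub (by omega)] at e2
      rw [z2, Nat.cast_sub (by omega)] at e3
      push_cast at e2 e3
      rw [sub_add_cancel] at e2 e3
      have e4 : rightVal c (r + 1) < 1 / 5 :=
        e3.trans_le (one_div_le_one_div_of_le (by norm_num) hb')
      have p := rightVal_pos c (r + 1)
      rw [hv, prodVal, e2]
      have e5 : 1 / (((a : ℝ) + cfVal X) * (b + cfVal Y))
          ≤ 1 / 5 * (1 / (a + rightVal c (r + 1))) := by
        rw [one_div_mul_one_div]
        exact one_div_le_one_div_of_le (by positivity) (by nlinarith)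
      exact e5.trans (mul_le_mul_of_nonneg_right e1.le (by positivity))
    · exact hle1 _ (one_fifth_lt_leftVal (hsmall (r - 1) (by omega) (by omega))) _
        (one_fifth_lt_rightVal (hsmall r (by omega) (by omega)))
  have hzero : ∀ k : ℤ, k % (2 * n : ℕ) = 0 → prodVal c k = prodVal c 0 := fun k hk =>
    prodVal_eq_of_digits fun i => by rw [hshift k i, hk]
  rw [abs_le] at hcentre
  obtain ⟨ℓ, hℓ⟩ := exists_hasLiminf_prodVal c
  refine ⟨ℓ, ⟨c, hℓ⟩, ?_⟩
  rw [abs_le]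
  constructor
  · have := hℓ.le_of_eventually_le (c := prodVal Z 0 - ε) (Eventually.of_forall fun k => by
      by_cases hk : (k : ℤ) % (2 * n : ℕ) = 0
      · rw [hzero k hk]; linarith
      · linarith [hlow k hk])
    linarith
  · have := hℓ.le_of_frequently_le (c := prodVal Z 0 + ε) (by
      rw [frequently_atTop]
      intro N
      refine ⟨2 * n * N, Nat.le_mul_of_pos_left _ (by omega), ?_⟩
      rw [hzero _ (by push_cast; exact Int.mul_emod_right _ _)]
      linarith)
    linarith

/-- Two approximations are combined, of M by a product and of its reciprocal by a spectrum value;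
closedness absorbs both errors. -/
lemma one_div_mem_prodSpectrum {M : ℝ} (hM : (5 + hallMin) ^ 2 ≤ M) : 1 / M ∈ prodSpectrum := by
  obtain ⟨a, b, ha, hb, h⟩ := exists_hallSet_mul_near hM
  have ha' : (5 : ℝ) ≤ a := by exact_mod_cast ha
  have hb' : (5 : ℝ) ≤ b := by exact_mod_cast hb
  have hM1 : 1 ≤ M := by have := hallMin_bounds.1; nlinarith
  have hM0 : 0 < M := by linarith
  refine isClosed_prodSpectrum.closure_subset (Metric.mem_closure_iff.2 fun ε hε => ?_)
  obtain ⟨x, hx, y, hy, hxy⟩ := h (ε / 2) (by linarith)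
  obtain ⟨ℓ, hℓ, hd⟩ := exists_prodSpectrum_near ha hb hx hy (show 0 < ε / 4 by linarith)
  refine ⟨ℓ, hℓ, ?_⟩
  have bx := (hallSet_bounds hx).1
  have by' := (hallSet_bounds hy).1
  set P := ((a : ℝ) + x) * (b + y) with hP
  have hP1 : 1 ≤ P := by nlinarith
  have hP0 : 0 < P := by linarith
  have e : 1 / M - 1 / P = (P - M) / (M * P) := by field_simp
  have h1 : |1 / M - 1 / P| ≤ |P - M| := by
    rw [e, abs_div]
    refine div_le_self (abs_nonneg _) ?_
    rw [abs_of_pos (by positivity)]; nlinarith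
  rw [Real.dist_eq]
  have h2 := abs_sub_le (1 / M) (1 / P) ℓ
  rw [abs_sub_comm (1 / P) ℓ] at h2
  linarith

lemma Icc_subset_prodSpectrum : Icc 0 (4 / (83 + 18 * √2)) ⊆ prodSpectrum := by
  rintro s ⟨h0, h1⟩
  rcases h0.eq_or_lt with h | h
  · rw [← h]; exact zero_mem_prodSpectrum
  · have h2 : (5 + hallMin) ^ 2 ≤ 1 / s := by
      have h5 : √2 ^ 2 = 2 := Real.sq_sqrt (by norm_num)
      have e : (5 + hallMin) ^ 2 = (83 + 18 * √2) / 4 := by rw [hallMin]; nlinarith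
      rw [e, ← one_div_div]
      exact one_div_le_one_div_of_le h h1
    have := one_div_mem_prodSpectrum h2
    rwa [one_div_one_div] at this

end HallRay

/-! ### Agreement with the regular continued fraction expansion. -/

section GaussDigits

/-- The orbit of α under the Gauss map stays irrational in (0, 1) and solves the recursion that
characterises `cfVal`. -/
lemma exists_eq_cfVal {α : ℝ} (hα : Irrational α) (h0 : 0 < α) (h1 : α < 1) :
    ∃ d, α = cfVal d := by
  set v : ℕ → ℝ := fun n => (fun x => Int.fract (1 / x))^[n] α with hv
  have hv1 : ∀ n, v (n + 1) = Int.fract (1 / v n) := fun n =>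
    Function.iterate_succ_apply' (fun x : ℝ => Int.fract (1 / x)) n α
  have key : ∀ n, Irrational (v n) ∧ 0 < v n ∧ v n < 1 := by
    intro n
    induction n with
    | zero => exact ⟨hα, h0, h1⟩
    | succ n ih =>
      have hirr : Irrational (v (n + 1)) := by
        rw [hv1, Int.fract, one_div]
        exact (irrational_inv_iff.2 ih.1).sub_intCast _
      refine ⟨hirr, ?_, ?_⟩
      · exact lt_of_le_of_ne (by rw [hv1]; exact Int.fract_nonneg _) hirr.ne_zero.symm
      · rw [hv1]; exact Int.fract_lt_one _
  refine ⟨fun n => (⌊1 / v n⌋ - 1).toNat, cfVal_unique (v := v)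
    (fun i => ⟨(key i).2.1.le, (key i).2.2.le⟩) fun i => ?_⟩
  have h2 : 1 ≤ ⌊1 / v i⌋ := by
    rw [Int.le_floor]
    push_cast
    rw [le_div_iff₀ (key i).2.1]
    linarith [(key i).2.2]
  have h3 : (((⌊1 / v i⌋ - 1).toNat : ℕ) : ℝ) = (⌊1 / v i⌋ : ℝ) - 1 := by
    have : (((⌊1 / v i⌋ - 1).toNat : ℤ) : ℝ) = ((⌊1 / v i⌋ - 1 : ℤ) : ℝ) := by
      rw [Int.toNat_of_nonneg (by omega)]
    push_cast at this ⊢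
    exact this
  rw [h3, hv1, sub_add_cancel, Int.floor_add_fract, one_div_one_div]

lemma stream_cfVal (d : ℕ → ℕ) (n : ℕ) : ∃ p, GenContFract.IntFractPair.stream (cfVal d) n = some p ∧
    p.fr = cfVal fun i => d (n + i) := by
  induction n with
  | zero =>
    refine ⟨_, GenContFract.IntFractPair.stream_zero _, ?_⟩
    simp only [GenContFract.IntFractPair.of, zero_add]
    exact Int.fract_eq_self.2 ⟨(cfVal_pos d).le, cfVal_lt_one d⟩
  | succ n ih =>
    obtain ⟨p, hp, hfr⟩ := ih
    refine ⟨_, GenContFract.IntFractPair.stream_succ_of_some hp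
      (by rw [hfr]; exact (cfVal_pos _).ne'), ?_⟩
    simp only [GenContFract.IntFractPair.of]
    rw [hfr, ← one_div, fract_one_div_cfVal]
    congr 1; ext i; congr 1; ring

/-- The fractional parts in the Gauss expansion are the tails, all positive, so the expansion never
terminates. -/
lemma irrational_cfVal (d : ℕ → ℕ) : Irrational (cfVal d) := by
  rintro ⟨q, hq⟩
  obtain ⟨n, hn⟩ := (GenContFract.terminates_iff_rat (cfVal d)).2 ⟨q, hq.symm⟩
  rw [← GenContFract.TerminatedAt,
    GenContFract.of_terminatedAt_n_iff_succ_nth_intFractPair_stream_eq_none] at hn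
  obtain ⟨p, hp, -⟩ := stream_cfVal d (n + 1)
  rw [hp] at hn
  exact Option.some_ne_none _ hn

lemma partDens_cfVal (d : ℕ → ℕ) (n : ℕ) :
    (GenContFract.of (cfVal d)).partDens.get? n = some ((d n : ℝ) + 1) := by
  obtain ⟨p, hp, hfr⟩ := stream_cfVal d n
  have h := GenContFract.get?_of_eq_some_of_get?_intFractPair_stream_fr_ne_zero hp
    (by rw [hfr]; exact (cfVal_pos _).ne')
  rw [GenContFract.partDen_eq_s_b h]
  simp only [GenContFract.IntFractPair.of]
  rw [hfr, ← one_div, floor_one_div_cfVal]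
  push_cast; rfl

lemma unboundedPartialQuotients_cfVal (d : ℕ → ℕ) :
    UnboundedPartialQuotients (cfVal d) ↔ ∀ M : ℝ, ∃ n, M < d n + 1 := by
  unfold UnboundedPartialQuotients
  refine forall_congr' fun M => exists_congr fun n => ?_
  rw [partDens_cfVal]
  simp

/-- The bi-infinite sequence that coincides with `d` on the nonnegative integers. -/
def extendDigits (d : ℕ → ℕ) (i : ℤ) : ℕ := d i.toNat

lemma rightVal_extendDigits (d : ℕ → ℕ) (n : ℕ) :
    rightVal (extendDigits d) n = cfVal fun i => d (n + i) := by
  unfold rightVal extendDigits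
  congr 1

lemma hasLiminf_extendDigits_eq_zero_iff {d : ℕ → ℕ} {ℓ : ℝ}
    (h : HasLiminf (fun n : ℕ => prodVal (extendDigits d) n) ℓ) :
    ℓ = 0 ↔ ∀ M : ℝ, ∃ n, M < d n + 1 := by
  constructor
  · intro hℓ
    by_contra! hM
    obtain ⟨M, hM⟩ := hM
    have hb : ∀ k, (extendDigits d k : ℝ) + 1 ≤ M := fun k => hM _
    have hM0 : 0 < M := lt_of_lt_of_le (by positivity) (hb 0)
    have hr : ∀ k : ℤ, 1 / (M + 1) ≤ rightVal (extendDigits d) k := fun k => by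
      rw [rightVal_eq]
      have h1 := rightVal_pos (extendDigits d) (k + 1)
      have h2 := rightVal_lt_one (extendDigits d) (k + 1)
      exact one_div_le_one_div_of_le (by positivity) (by linarith [hb k])
    have hl : ∀ k : ℤ, 1 / (M + 1) ≤ leftVal (extendDigits d) k := fun k => by
      rw [leftVal_eq]
      have h1 := leftVal_pos (extendDigits d) (k - 1)
      have h2 := leftVal_lt_one (extendDigits d) (k - 1)
      exact one_div_le_one_div_of_le (by positivity) (by linarith [hb (k - 1)])
    have hpos : 0 < 1 / (M + 1) * (1 / (M + 1)) := by positivity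
    have := h.le_of_eventually_le (c := 1 / (M + 1) * (1 / (M + 1)))
      (Eventually.of_forall fun n => mul_le_mul (hl n) (hr n) (by positivity) (leftVal_pos _ _).le)
    linarith
  · intro hM
    have h0 : 0 ≤ ℓ := h.le_of_eventually_le (Eventually.of_forall fun n => (prodVal_pos _ _).le)
    refine le_antisymm (le_of_forall_pos_le_add fun ε hε => ?_) h0
    rw [zero_add]
    refine h.le_of_frequently_le (frequently_atTop.2 fun N => ?_)
    -- Adding the first N quotients to the bound excludes every index below N, so that large
    -- quotients occur arbitrarily far out.
    obtain ⟨n, hn⟩ := hM (1 / ε + ∑ i ∈ Finset.range N, ((d i : ℝ) + 1))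
    have hN : N ≤ n := by
      by_contra hlt
      have := Finset.single_le_sum (f := fun i => (d i : ℝ) + 1) (fun i _ => by positivity)
        (Finset.mem_range.2 (not_le.1 hlt))
      have h3 : 0 < 1 / ε := by positivity
      linarith
    refine ⟨n, hN, ?_⟩
    have h4 := (prodVal_lt_rightVal (extendDigits d) n).trans (rightVal_lt_one_div _ _)
    have h5 : 0 ≤ ∑ i ∈ Finset.range N, ((d i : ℝ) + 1) :=
      Finset.sum_nonneg fun i _ => by positivity
    refine h4.le.trans ?_
    rw [one_div_le (by positivity) hε]
    change 1 / ε ≤ (d (Int.toNat n) : ℝ) + 1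
    rw [Int.toNat_natCast]
    linarith

end GaussDigits

/-! ### Convergents, best approximation and the lower limit of 1 / (N δ_N). -/

section Convergents

/-- The denominators `q_n` of the convergents. -/
def cfDen (d : ℕ → ℕ) : ℕ → ℕ
  | 0 => 1
  | 1 => d 0 + 1
  | n + 2 => (d (n + 1) + 1) * cfDen d (n + 1) + cfDen d n

/-- The numerators `p_n` of the convergents. -/
def cfNum (d : ℕ → ℕ) : ℕ → ℕ
  | 0 => 0
  | 1 => 1
  | n + 2 => (d (n + 1) + 1) * cfNum d (n + 1) + cfNum d n

/-- The signed error `q_n α - p_n` for `α = cfVal d`. -/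
noncomputable def cfErr (d : ℕ → ℕ) (n : ℕ) : ℝ := cfDen d n * cfVal d - cfNum d n

lemma cfDen_pos (d : ℕ → ℕ) : ∀ n, 0 < cfDen d n
  | 0 => Nat.one_pos
  | 1 => Nat.succ_pos _
  | n + 2 => by
    rw [cfDen]
    have := cfDen_pos d n
    omega

lemma cfDen_le_succ (d : ℕ → ℕ) (n : ℕ) : cfDen d n ≤ cfDen d (n + 1) := by
  cases n with
  | zero => simp [cfDen]
  | succ n => rw [cfDen]; nlinarith [cfDen_pos d (n + 1)]

lemma cfDen_mono (d : ℕ → ℕ) : Monotone (cfDen d) := monotone_nat_of_le_succ (cfDen_le_succ d)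

lemma le_cfDen (d : ℕ → ℕ) (n : ℕ) : n ≤ cfDen d n := by
  induction n with
  | zero => exact Nat.zero_le _
  | succ n ih =>
    cases n with
    | zero => simp [cfDen]
    | succ n => rw [cfDen]; nlinarith [cfDen_pos d n]

lemma cf_det (d : ℕ → ℕ) (n : ℕ) : (cfNum d n * cfDen d (n + 1) : ℤ) - cfNum d (n + 1) * cfDen d n
    = 1 ∨ (cfNum d n * cfDen d (n + 1) : ℤ) - cfNum d (n + 1) * cfDen d n = -1 := by
  induction n with
  | zero => right; simp [cfNum, cfDen]
  | succ n ih =>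
    have : (cfNum d (n + 1) * cfDen d (n + 1 + 1) : ℤ) - cfNum d (n + 1 + 1) * cfDen d (n + 1)
      = -((cfNum d n * cfDen d (n + 1) : ℤ) - cfNum d (n + 1) * cfDen d n) := by
      rw [cfNum, cfDen]; push_cast; ring
    rw [this]
    rcases ih with h | h <;> rw [h] <;> simp

lemma cfErr_succ (d : ℕ → ℕ) (n : ℕ) :
    cfErr d (n + 1) = -(cfVal fun i => d (n + 1 + i)) * cfErr d n := by
  have hstep : ∀ k, (cfVal fun i => d (k + i)) * (d k + 1 + cfVal fun i => d (k + 1 + i)) = 1 := by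
    intro k
    have := cfVal_pos fun i => d (k + 1 + i)
    rw [cfVal_tail_eq d k]
    field_simp
  induction n with
  | zero =>
    have h := hstep 0
    simp only [zero_add] at h
    change (cfVal d) * _ = 1 at h
    simp only [cfErr, cfDen, cfNum]
    push_cast
    linarith
  | succ n ih =>
    have h := hstep (n + 1)
    have e : cfErr d (n + 1 + 1) = (d (n + 1) + 1) * cfErr d (n + 1) + cfErr d n := by
      simp only [cfErr, cfDen, cfNum]; push_cast; ring
    rw [e, ih]
    linear_combination -(cfErr d n) * h

lemma cfErr_mul_cfErr_succ (d : ℕ → ℕ) (n : ℕ) : cfErr d n * cfErr d (n + 1) ≤ 0 := by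
  rw [cfErr_succ]
  nlinarith [cfVal_pos fun i => d (n + 1 + i), sq_nonneg (cfErr d n)]

/-- The bracket obeys the recursion inverse to that of the errors, so the product stays at its
initial value 1. Division by q_{n+1} displays the right and left continued fractions of the cut. -/
lemma abs_cfErr_mul (d : ℕ → ℕ) (n : ℕ) :
    |cfErr d n| * (cfDen d (n + 1) + (cfVal fun i => d (n + 1 + i)) * cfDen d n) = 1 := by
  induction n with
  | zero =>
    have h : cfVal d * (d 0 + 1 + cfVal fun i => d (0 + 1 + i)) = 1 := by
      have := cfVal_pos fun i => d (0 + 1 + i)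
      have e := cfVal_tail_eq d 0
      simp only [zero_add] at e this ⊢
      change cfVal d = _ at e
      rw [e]; field_simp
    simp only [cfErr, cfDen, cfNum]
    push_cast
    rw [one_mul, sub_zero, abs_of_pos (cfVal_pos d), mul_one]
    exact h
  | succ n ih =>
    have hv := cfVal_pos fun i => d (n + 1 + i)
    have hv' := cfVal_pos fun i => d (n + 1 + 1 + i)
    have e := cfVal_tail_eq d (n + 1)
    rw [eq_div_iff (by positivity)] at e
    rw [cfErr_succ, abs_mul, abs_neg, abs_of_pos hv, cfDen]
    push_cast
    refine Eq.trans ?_ ih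
    linear_combination |cfErr d n| * (cfDen d (n + 1)) * e

/-- `δ` is the distance to `ℤ` of the set `{α, 2 α, ..., N α}`. -/
def IsMinDist (α : ℝ) (N : ℕ) (δ : ℝ) : Prop :=
  (∃ k l : ℤ, 1 ≤ k ∧ k ≤ N ∧ |k * α - l| = δ) ∧
    ∀ k l : ℤ, 1 ≤ k → k ≤ N → δ ≤ |k * α - l|

lemma abs_le_abs_add_of_mul_nonneg {x y : ℝ} (h : 0 ≤ x * y) : |x| ≤ |x + y| := by
  rw [← sq_le_sq]; nlinarith [sq_nonneg y]

/-- Consecutive convergents form a basis of ℤ². In it the bounds on k force x ≠ 0 and x y ≤ 0; as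
consecutive errors have opposite signs, the two terms reinforce each other and the first is already
at least |q_n α - p_n|. -/
lemma abs_cfErr_le (d : ℕ → ℕ) (n : ℕ) {k l : ℤ} (hk : 1 ≤ k) (hk' : k < cfDen d (n + 1)) :
    |cfErr d n| ≤ |k * cfVal d - l| := by
  obtain ⟨x, y, hx, hy⟩ : ∃ x y : ℤ, k = x * cfDen d n + y * cfDen d (n + 1) ∧
      l = x * cfNum d n + y * cfNum d (n + 1) := by
    rcases cf_det d n with h | h
    · refine ⟨l * cfDen d (n + 1) - k * cfNum d (n + 1), k * cfNum d n - l * cfDen d n, ?_, ?_⟩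
      · linear_combination -k * h
      · linear_combination -l * h
    · refine ⟨-(l * cfDen d (n + 1) - k * cfNum d (n + 1)), -(k * cfNum d n - l * cfDen d n),
        ?_, ?_⟩
      · linear_combination k * h
      · linear_combination l * h
  have e : (k : ℝ) * cfVal d - l = x * cfErr d n + y * cfErr d (n + 1) := by
    rw [hx, hy, cfErr, cfErr]; push_cast; ring
  have q0 : (0 : ℤ) < cfDen d n := by exact_mod_cast cfDen_pos d n
  have q1 : (0 : ℤ) < cfDen d (n + 1) := by exact_mod_cast cfDen_pos d (n + 1)
  have hx0 : x ≠ 0 := by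
    rintro rfl
    rw [zero_mul, zero_add] at hx
    have : 0 < y := by
      by_contra hy0
      nlinarith
    nlinarith
  have hxy : x * y ≤ 0 := by
    by_contra hpos
    push Not at hpos
    rcases pos_and_pos_or_neg_and_neg_of_mul_pos hpos with ⟨h1, h2⟩ | ⟨h1, h2⟩ <;> nlinarith
  have hxy' : (x : ℝ) * y ≤ 0 := by exact_mod_cast hxy
  have h1 : (1 : ℝ) ≤ |(x : ℝ)| := by exact_mod_cast Int.one_le_abs hx0
  rw [e]
  refine le_trans ?_ (abs_le_abs_add_of_mul_nonneg ?_)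
  · rw [abs_mul]
    exact le_mul_of_one_le_left (abs_nonneg _) h1
  · have := mul_nonneg_of_nonpos_of_nonpos hxy' (cfErr_mul_cfErr_succ d n)
    linarith

lemma isMinDist_cfErr (d : ℕ → ℕ) {n N : ℕ} (h1 : cfDen d n ≤ N) (h2 : N < cfDen d (n + 1)) :
    IsMinDist (cfVal d) N |cfErr d n| := by
  refine ⟨⟨cfDen d n, cfNum d n, by exact_mod_cast cfDen_pos d n, by exact_mod_cast h1, ?_⟩,
    fun k l hk hk' => abs_cfErr_le d n hk (by omega)⟩
  rw [cfErr]; push_cast; rfl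

lemma IsMinDist.unique {α : ℝ} {N : ℕ} {δ δ' : ℝ} (h : IsMinDist α N δ) (h' : IsMinDist α N δ') :
    δ = δ' := by
  obtain ⟨k, l, h1, h2, h3⟩ := h.1
  obtain ⟨k', l', h1', h2', h3'⟩ := h'.1
  exact le_antisymm (h3' ▸ h.2 k' l' h1' h2') (h3 ▸ h'.2 k l h1 h2)

lemma exists_cfDen_le_lt (d : ℕ → ℕ) {N : ℕ} (hN : 1 ≤ N) :
    ∃ n, cfDen d n ≤ N ∧ N < cfDen d (n + 1) := by
  have hex : ∃ n, N < cfDen d (n + 1) := ⟨N, lt_of_lt_of_le (by omega) (le_cfDen d (N + 1))⟩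
  classical
  obtain ⟨n, hn⟩ : ∃ n, Nat.find hex = n := ⟨_, rfl⟩
  rw [Nat.find_eq_iff] at hn
  refine ⟨n, ?_, hn.1⟩
  cases n with
  | zero => exact hN
  | succ n => exact not_lt.1 (hn.2 n (by omega))

/-- The ratios q_k / q_{k+1} satisfy the recursion of the left continued fractions, so N common
digits give the bound, whatever the extension to the negative side. -/
lemma abs_cfDen_div_sub_leftVal_le (d : ℕ → ℕ) (N : ℕ) :
    |(cfDen d N : ℝ) / cfDen d (N + 1) - leftVal (extendDigits d) ((N + 1 : ℕ) : ℤ)|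
      ≤ 2 * (1 / 2) ^ N := by
  have hq : ∀ n, (0 : ℝ) < cfDen d n := fun n => by exact_mod_cast cfDen_pos d n
  refine cf_contraction N (fun i => d (N - i))
    (fun i => (cfDen d (N - i) : ℝ) / cfDen d (N - i + 1))
    (fun i => leftVal (extendDigits d) ((N - i + 1 : ℕ) : ℤ)) (fun i => ?_)
    (fun i => ⟨(leftVal_pos _ _).le, (leftVal_lt_one _ _).le⟩) (fun i hi => ?_) (fun i hi => ?_)
  · refine ⟨by have := hq (N - i); have := hq (N - i + 1); positivity, ?_⟩
    rw [div_le_one (hq _)]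
    exact_mod_cast cfDen_le_succ d (N - i)
  · obtain ⟨k, hk⟩ : ∃ k, N - i = k + 1 := ⟨N - i - 1, by omega⟩
    have hk' : N - (i + 1) = k := by omega
    simp only [hk, hk']
    have h0 := hq k
    have h1 := hq (k + 1)
    rw [cfDen]
    push_cast
    field_simp
  · obtain ⟨k, hk⟩ : ∃ k, N - i = k + 1 := ⟨N - i - 1, by omega⟩
    have hk' : N - (i + 1) = k := by omega
    simp only [hk, hk']
    rw [leftVal_eq]
    have e : (((k + 1 + 1 : ℕ) : ℤ)) - 1 = ((k + 1 : ℕ) : ℤ) := by push_cast; ring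
    rw [e, extendDigits, Int.toNat_natCast]

lemma HasLiminf.succ {f : ℕ → ℝ} {ℓ : ℝ} (h : HasLiminf f ℓ) :
    HasLiminf (fun n => f (n + 1)) ℓ := by
  refine ⟨fun ε hε => (tendsto_add_atTop_nat 1).eventually (h.1 ε hε), fun ε hε => ?_⟩
  rw [frequently_atTop]
  intro N
  obtain ⟨n, hn, hn'⟩ := frequently_atTop.1 (h.2 ε hε) (N + 1)
  refine ⟨n - 1, by omega, ?_⟩
  change f (n - 1 + 1) < ℓ + ε
  rwa [Nat.sub_add_cancel (by omega)]

lemma hasLiminf_cfVal_mul_cfDen_div {d : ℕ → ℕ} {ℓ : ℝ}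
    (h : HasLiminf (fun n : ℕ => prodVal (extendDigits d) n) ℓ) :
    HasLiminf (fun n => (cfVal fun i => d (n + 1 + i)) * (cfDen d n / cfDen d (n + 1))) ℓ := by
  refine h.succ.congr ?_
  have h2 : Tendsto (fun n : ℕ => (2 : ℝ) * (1 / 2) ^ n) atTop (𝓝 0) := by
    simpa using (tendsto_pow_atTop_nhds_zero_of_lt_one (by norm_num : (0 : ℝ) ≤ 1 / 2)
      (by norm_num)).const_mul 2
  refine squeeze_zero_norm (fun n => ?_) h2
  rw [prodVal, rightVal_extendDigits, Real.norm_eq_abs, mul_comm, ← mul_sub, abs_mul, abs_sub_comm]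
  refine (mul_le_of_le_one_left (abs_nonneg _) ?_).trans (abs_cfDen_div_sub_leftVal_le d n)
  rw [abs_of_pos (cfVal_pos _)]
  exact (cfVal_lt_one _).le

/-- The lower limit of `1 / (N δ_N)`, where `δ_N` is the distance of `{α, ..., N α}` to `ℤ`. -/
lemma hasLiminf_one_div_mul_minDist {d : ℕ → ℕ} {ℓ : ℝ}
    (h : HasLiminf (fun n : ℕ => prodVal (extendDigits d) n) ℓ) {δ : ℕ → ℝ}
    (hδ : ∀ N, 1 ≤ N → IsMinDist (cfVal d) N (δ N)) :
    HasLiminf (fun N => 1 / (N * δ N)) (1 + ℓ) := by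
  have hw := hasLiminf_cfVal_mul_cfDen_div h
  set w : ℕ → ℝ := fun n => (cfVal fun i => d (n + 1 + i)) * (cfDen d n / cfDen d (n + 1)) with hwd
  have hq : ∀ n, (0 : ℝ) < cfDen d n := fun n => by exact_mod_cast cfDen_pos d n
  have hE : ∀ n, 1 / (cfDen d (n + 1) * |cfErr d n|) = 1 + w n := fun n => by
    have h1 := abs_cfErr_mul d n
    have hE0 : |cfErr d n| ≠ 0 := fun h0 => by rw [h0, zero_mul] at h1; exact zero_ne_one h1
    have := hq (n + 1)
    have e : (1 + w n) * (cfDen d (n + 1) * |cfErr d n|) = 1 := by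
      refine Eq.trans ?_ h1
      rw [hwd]
      field_simp
    exact eq_div_of_mul_eq (by positivity) e |>.symm
  have hEpos : ∀ n, 0 < |cfErr d n| := fun n => by
    refine (abs_nonneg _).lt_of_ne' fun h0 => ?_
    have h1 := abs_cfErr_mul d n
    rw [h0, zero_mul] at h1
    exact zero_ne_one h1
  have hw1 : ∀ n, w n ≤ 1 := fun n => by
    refine mul_le_one₀ (cfVal_lt_one _).le (by have := hq n; have := hq (n + 1); positivity) ?_
    rw [div_le_one (hq _)]
    exact_mod_cast cfDen_le_succ d n
  constructor
  · intro ε hε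
    obtain ⟨n₀, hn₀⟩ := eventually_atTop.1 (hw.1 ε hε)
    filter_upwards [eventually_ge_atTop (cfDen d n₀)] with N hN
    have hN1 : 1 ≤ N := (cfDen_pos d n₀).trans_le hN
    obtain ⟨n, h1, h2⟩ := exists_cfDen_le_lt d hN1
    rw [(hδ N hN1).unique (isMinDist_cfErr d h1 h2)]
    have hn : n₀ ≤ n := by
      by_contra hlt
      exact absurd (cfDen_mono d (show n + 1 ≤ n₀ by omega)) (by omega)
    have h3 := hn₀ n hn
    -- The minimal distance is constant for q_n ≤ N < q_{n+1}, so the quotient there is bounded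
    -- below by its value at q_{n+1}.
    have h4 : 1 / (cfDen d (n + 1) * |cfErr d n|) ≤ 1 / (N * |cfErr d n|) := by
      have hN' : (0 : ℝ) < N := by exact_mod_cast hN1
      have := hEpos n
      refine one_div_le_one_div_of_le (by positivity) (mul_le_mul_of_nonneg_right ?_ this.le)
      exact_mod_cast h2.le
    rw [hE] at h4
    linarith
  · intro ε hε
    rw [frequently_atTop]
    intro N₀
    have hlim := (tendsto_const_div_atTop_nhds_zero_nat (2 : ℝ)).eventually
      (gt_mem_nhds (show 0 < ε / 2 by linarith))
    obtain ⟨n, hn, h1, h2⟩ := (((hw.2 (ε / 2) (by linarith)).and_eventually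
      (hlim.and (eventually_ge_atTop (N₀ + 1))))).exists
    -- An index of at least 1 makes q_n < q_{n+1} strict; q_0 = q_1 is possible.
    obtain ⟨m, rfl⟩ : ∃ m, n = m + 1 := ⟨n - 1, by omega⟩
    have hgt : cfDen d (m + 1) < cfDen d (m + 1 + 1) := by
      rw [cfDen]; nlinarith [cfDen_pos d m, cfDen_pos d (m + 1)]
    have hge := le_cfDen d (m + 1)
    set Q := cfDen d (m + 1 + 1) with hQ
    -- The last N with this minimal distance; replacing Q by Q - 1 costs a factor 1 + 1/(Q - 1),
    -- which tends to 1.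
    refine ⟨Q - 1, by omega, ?_⟩
    have hN1 : 1 ≤ Q - 1 := by omega
    simp only
    rw [(hδ (Q - 1) hN1).unique (isMinDist_cfErr d (n := m + 1) (by omega) (by omega))]
    have hQm : ((m + 1 : ℕ) : ℝ) ≤ ((Q - 1 : ℕ) : ℝ) := by
      exact_mod_cast (show m + 1 ≤ Q - 1 by omega)
    have hm0 : (0 : ℝ) < ((m + 1 : ℕ) : ℝ) := by positivity
    have hQ0 : (0 : ℝ) < ((Q - 1 : ℕ) : ℝ) := by linarith
    have hQc : (Q : ℝ) = ((Q - 1 : ℕ) : ℝ) + 1 := by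
      rw [← Nat.cast_add_one, Nat.sub_add_cancel (by omega)]
    have e : 1 / (((Q - 1 : ℕ) : ℝ) * |cfErr d (m + 1)|)
        = (1 + w (m + 1)) * (1 + 1 / ((Q - 1 : ℕ) : ℝ)) := by
      rw [← hE, ← hQ, hQc]
      have := hEpos (m + 1)
      field_simp
    have h3 : 1 / ((Q - 1 : ℕ) : ℝ) ≤ 1 / ((m + 1 : ℕ) : ℝ) := one_div_le_one_div_of_le hm0 hQm
    have h4 : (1 + w (m + 1)) * (1 / ((Q - 1 : ℕ) : ℝ)) ≤ 2 * (1 / ((m + 1 : ℕ) : ℝ)) := by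
      refine mul_le_mul (by linarith [hw1 (m + 1)]) h3 (by positivity) (by norm_num)
    rw [e, mul_add, mul_one]
    rw [← mul_one_div] at h1
    linarith

end Convergents

/-! ### Sturmian coding and the cells of the rotation. -/

section RotationCoding

variable {α : ℝ}

lemma rotationMap_eq_fract (h0 : 0 < α) (h1 : α < 1) {x : ℝ} (hx : x ∈ Ico (0 : ℝ) 1) :
    rotationMap α x = Int.fract (x + α) := by
  obtain ⟨hx0, hx1⟩ := hx
  rw [rotationMap, eq_comm, Int.fract_eq_iff]
  split_ifs with h
  · exact ⟨by linarith, by linarith, 0, by simp⟩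
  · exact ⟨by linarith, by linarith, 1, by push_cast; ring⟩

lemma iterate_rotationMap (h0 : 0 < α) (h1 : α < 1) {x : ℝ} (hx : x ∈ Ico (0 : ℝ) 1) (n : ℕ) :
    (rotationMap α)^[n] x = Int.fract (x + n * α) := by
  induction n with
  | zero => simpa using (Int.fract_eq_self.2 hx).symm
  | succ n ih =>
    rw [Function.iterate_succ_apply', ih, rotationMap_eq_fract h0 h1
      ⟨Int.fract_nonneg _, Int.fract_lt_one _⟩, Int.fract_eq_fract]
    refine ⟨-⌊x + n * α⌋, ?_⟩
    rw [Int.fract]; push_cast; ring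

lemma iterate_rotationMap_mem (h0 : 0 < α) (h1 : α < 1) {x : ℝ} (hx : x ∈ Ico (0 : ℝ) 1) (n : ℕ) :
    (rotationMap α)^[n] x ∈ Ico (0 : ℝ) 1 := by
  rw [iterate_rotationMap h0 h1 hx]
  exact ⟨Int.fract_nonneg _, Int.fract_lt_one _⟩

/-- The coding of the orbit of `x` under the rotation of angle `α`. -/
noncomputable def rotationCode (α x : ℝ) : ℕ → Fin 2 :=
  trajectory (rotationMap α) (rotationLabel α) x

/-- The letter 1 marks the passages of the orbit of the lift through an integer. Words thus become
lists of integer parts. -/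
lemma floor_add_succ_mul (h0 : 0 < α) (h1 : α < 1) {x : ℝ} (hx : x ∈ Ico (0 : ℝ) 1) (n : ℕ) :
    ⌊x + (n + 1 : ℕ) * α⌋ = ⌊x + n * α⌋ + ((rotationCode α x n : ℕ) : ℤ) := by
  have e : x + ((n + 1 : ℕ) : ℝ) * α = Int.fract (x + n * α) + α + ⌊x + n * α⌋ := by
    rw [Int.fract]; push_cast; ring
  have f0 := Int.fract_nonneg (x + n * α)
  have f1 := Int.fract_lt_one (x + n * α)
  rw [e, Int.floor_add_intCast, add_comm]
  congr 1
  rw [rotationCode, trajectory, iterate_rotationMap h0 h1 hx, rotationLabel, Int.floor_eq_iff]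
  split_ifs with h
  · constructor <;> simp <;> linarith
  · constructor <;> simp <;> linarith

lemma factor_eq_factor_iff {A : Type*} {x y : ℕ → A} {r s n : ℕ} :
    factor x r n = factor y s n ↔ ∀ i < n, x (r + i) = y (s + i) := by
  rw [factor, factor, List.ofFn_inj, funext_iff]
  exact ⟨fun h i hi => h ⟨i, hi⟩, fun h i => h i i.2⟩

lemma length_factor {A : Type*} (x : ℕ → A) (r n : ℕ) : (factor x r n).length = n :=
  List.length_ofFn

lemma factor_rotationCode (α x : ℝ) (r n : ℕ) :
    factor (rotationCode α x) r n = factor (rotationCode α ((rotationMap α)^[r] x)) 0 n := by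
  rw [factor_eq_factor_iff]
  intro i _
  rw [rotationCode, rotationCode, trajectory, trajectory, zero_add, ← Function.iterate_add_apply,
    add_comm]

lemma mem_rotationLanguage_iff (h0 : 0 < α) (h1 : α < 1) {w : List (Fin 2)} :
    w ∈ rotationLanguage α ↔ ∃ x ∈ Ico (0 : ℝ) 1, w = factor (rotationCode α x) 0 w.length := by
  constructor
  · rintro ⟨x, hx, r, n, rfl⟩
    refine ⟨(rotationMap α)^[r] x, iterate_rotationMap_mem h0 h1 hx r, ?_⟩
    rw [length_factor]
    exact factor_rotationCode α x r n
  · rintro ⟨x, hx, h⟩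
    exact ⟨x, hx, 0, w.length, h⟩

lemma factor_mem_rotationLanguage {x : ℝ} (hx : x ∈ Ico (0 : ℝ) 1) (r n : ℕ) :
    factor (rotationCode α x) r n ∈ rotationLanguage α := ⟨x, hx, r, n, rfl⟩

lemma factor_rotationCode_eq_iff (h0 : 0 < α) (h1 : α < 1) {x y : ℝ} (hx : x ∈ Ico (0 : ℝ) 1)
    (hy : y ∈ Ico (0 : ℝ) 1) (n : ℕ) :
    factor (rotationCode α y) 0 n = factor (rotationCode α x) 0 n ↔
      ∀ j ≤ n, ⌊y + (j : ℕ) * α⌋ = ⌊x + (j : ℕ) * α⌋ := by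
  rw [factor_eq_factor_iff]
  constructor
  · intro h j
    induction j with
    | zero =>
      intro _
      simp only [Nat.cast_zero, zero_mul, add_zero]
      rw [Int.floor_eq_zero_iff.2 hx, Int.floor_eq_zero_iff.2 hy]
    | succ j ih =>
      intro hj
      have := h j (by omega)
      rw [zero_add] at this
      rw [floor_add_succ_mul h0 h1 hx, floor_add_succ_mul h0 h1 hy, ih (by omega), this]
  · intro h i hi
    have e1 := h i hi.le
    have e2 := h (i + 1) hi
    rw [floor_add_succ_mul h0 h1 hx, floor_add_succ_mul h0 h1 hy, e1] at e2
    rw [zero_add]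
    apply Fin.ext
    omega

/-- The set of the points whose coding begins with the same `n` letters as that of `x`. -/
def rotationCell (α x : ℝ) (n : ℕ) : Set ℝ := {y | ∀ j ≤ n, ⌊y + (j : ℕ) * α⌋ = ⌊x + (j : ℕ) * α⌋}

lemma rotationCell_subset {x : ℝ} (hx : x ∈ Ico (0 : ℝ) 1) (n : ℕ) :
    rotationCell α x n ⊆ Ico 0 1 := by
  intro y hy
  have := hy 0 (Nat.zero_le _)
  simp only [Nat.cast_zero, zero_mul, add_zero] at this
  rw [Int.floor_eq_zero_iff.2 hx] at this
  exact Int.floor_eq_zero_iff.1 this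

/-- An intersection of n + 1 unit intervals, whose end points are the largest left one and the
smallest right one. The length is therefore 1 or of the form |kα - l| with 1 ≤ k ≤ n. -/
lemma exists_rotationCell_eq_Ico (α x : ℝ) (n : ℕ) : ∃ i ≤ n, ∃ j ≤ n,
    rotationCell α x n = Ico (⌊x + (i : ℕ) * α⌋ - i * α) (⌊x + (j : ℕ) * α⌋ + 1 - j * α) := by
  obtain ⟨i, hi, hi'⟩ := Finset.exists_max_image (Finset.range (n + 1))
    (fun i : ℕ => (⌊x + i * α⌋ : ℝ) - i * α) ⟨0, by simp⟩
  obtain ⟨j, hj, hj'⟩ := Finset.exists_min_image (Finset.range (n + 1))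
    (fun j : ℕ => (⌊x + j * α⌋ : ℝ) + 1 - j * α) ⟨0, by simp⟩
  rw [Finset.mem_range] at hi hj
  refine ⟨i, by omega, j, by omega, ?_⟩
  ext y
  constructor
  · intro hy
    have h1 := (Int.floor_eq_iff.1 (hy i (by omega))).1
    have h2 := (Int.floor_eq_iff.1 (hy j (by omega))).2
    exact ⟨by linarith, by linarith⟩
  · rintro ⟨h1, h2⟩ k hk
    have h3 := hi' k (by simpa using Nat.lt_succ_of_le hk)
    have h4 := hj' k (by simpa using Nat.lt_succ_of_le hk)
    rw [Int.floor_eq_iff]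
    exact ⟨by linarith, by linarith⟩

lemma mem_rotationCell_self (α x : ℝ) (n : ℕ) : x ∈ rotationCell α x n := fun _ _ => rfl

lemma IsMinDist.lt_one {n : ℕ} {δ : ℝ} (h : IsMinDist α n δ) (h0 : 0 < α) (h1 : α < 1)
    (hn : 1 ≤ n) : δ < 1 := by
  have := h.2 1 0 le_rfl (by exact_mod_cast hn)
  rw [Int.cast_one, one_mul, Int.cast_zero, sub_zero, abs_of_pos h0] at this
  linarith

lemma IsMinDist.pos {n : ℕ} {δ : ℝ} (h : IsMinDist α n δ) (hα : Irrational α) : 0 < δ := by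
  obtain ⟨k, l, hk, -, rfl⟩ := h.1
  rw [abs_pos]
  exact ((hα.intCast_mul (by omega : k ≠ 0)).sub_intCast l).ne_zero

/-- A cell of order `n` is at least as long as the minimal distance. -/
lemma IsMinDist.le_sub_of_rotationCell_eq {n : ℕ} {δ : ℝ} (h : IsMinDist α n δ) (h0 : 0 < α)
    (h1 : α < 1) (hn : 1 ≤ n) {x lo hi : ℝ} (hc : rotationCell α x n = Ico lo hi) :
    δ ≤ hi - lo := by
  obtain ⟨i, hi', j, hj', hc'⟩ := exists_rotationCell_eq_Ico α x n
  have hmem := mem_rotationCell_self α x n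
  have hlt : lo < hi := by
    rw [hc] at hmem; exact hmem.1.trans_lt hmem.2
  rw [hc] at hc'
  obtain ⟨rfl, rfl⟩ := (Ico_eq_Ico_iff (Or.inl hlt)).1 hc'
  have hpos := sub_pos.2 hlt
  rcases lt_trichotomy i j with hij | rfl | hij
  · have := h.2 ((j : ℤ) - i) (⌊x + j * α⌋ + 1 - ⌊x + i * α⌋) (by omega) (by omega)
    push_cast at this
    rw [abs_sub_comm, abs_of_pos (by linarith)] at this
    linarith
  · have := h.lt_one h0 h1 hn
    linarith
  · have := h.2 ((i : ℤ) - j) (⌊x + i * α⌋ - ⌊x + j * α⌋ - 1) (by omega) (by omega)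
    push_cast at this
    rw [abs_of_pos (by linarith)] at this
    linarith

/-- Some cell of order `n` is not longer than the minimal distance. -/
lemma IsMinDist.exists_rotationCell_subset {n : ℕ} {δ : ℝ} (h : IsMinDist α n δ)
    (hα : Irrational α) (h0 : 0 < α) (h1 : α < 1) (hn : 1 ≤ n) :
    ∃ x ∈ Ico (0 : ℝ) 1, ∃ a, rotationCell α x n ⊆ Ico a (a + δ) := by
  have hδ := h.pos hα
  have hδ1 := h.lt_one h0 h1 hn
  obtain ⟨k, l, hk, hkn, hkl⟩ := h.1
  obtain ⟨m, rfl⟩ := Int.eq_ofNat_of_zero_le (by omega : 0 ≤ k)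
  have hm : m ≤ n := by exact_mod_cast hkn
  -- The extremal multiple mα lies δ above or below an integer, so a discontinuity of the coding
  -- lies at distance δ from 1 or from 0, and the cell at that end of [0, 1) is short enough.
  rcases abs_choice ((m : ℤ) * α - l) with hs | hs
  · have hk' : (m : ℝ) * α = l + δ := by
      rw [hkl] at hs; push_cast at hs; linarith
    refine ⟨1 - δ, ⟨by linarith, by linarith⟩, 1 - δ, fun y hy => ⟨?_, ?_⟩⟩
    · have e := hy m hm
      have e2 : ⌊1 - δ + m * α⌋ = l + 1 := by
        rw [Int.floor_eq_iff]; push_cast; constructor <;> linarith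
      rw [e2, Int.floor_eq_iff] at e
      push_cast at e
      linarith [e.1]
    · have := (rotationCell_subset ⟨by linarith, by linarith⟩ n hy).2
      linarith
  · have hk' : (m : ℝ) * α = l - δ := by
      rw [hkl] at hs; push_cast at hs; linarith
    refine ⟨0, ⟨le_rfl, one_pos⟩, 0, fun y hy => ⟨?_, ?_⟩⟩
    · exact (rotationCell_subset ⟨le_rfl, one_pos⟩ n hy).1
    · have e := hy m hm
      have e2 : ⌊0 + m * α⌋ = l - 1 := by
        rw [Int.floor_eq_iff]; push_cast; constructor <;> linarith
      rw [e2, Int.floor_eq_iff] at e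
      push_cast at e
      linarith [e.2]

end RotationCoding

/-! ### Visits to an interval along a convergent denominator. -/

section Counting

/-- Multiplication by p followed by a translation permutes the residues modulo q. -/
lemma sum_emod_eq {p : ℤ} {q : ℕ} (hq : 0 < q) (hpq : IsCoprime p q) (m : ℤ) :
    ∑ i ∈ Finset.range q, (m + i * p) % (q : ℤ) = ∑ i ∈ Finset.range q, (i : ℤ) := by
  have hq' : (q : ℤ) ≠ 0 := by omega
  have hinj : Set.InjOn (fun i : ℕ => ((m + i * p) % (q : ℤ)).toNat) (Finset.range q) := by
    intro i hi j hj hij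
    simp only [Finset.coe_range, mem_Iio] at hi hj
    have e : (m + i * p) % (q : ℤ) = (m + j * p) % (q : ℤ) := by
      have a := Int.emod_nonneg (m + i * p) hq'
      have b := Int.emod_nonneg (m + j * p) hq'
      simp only at hij
      omega
    have h1 : (q : ℤ) ∣ (m + i * p) - (m + j * p) := Int.ModEq.dvd (Int.ModEq.symm e)
    rw [show (m + i * p) - (m + j * p) = ((i : ℤ) - j) * p by ring] at h1
    have h2 : (q : ℤ) ∣ (i : ℤ) - j := hpq.symm.dvd_of_dvd_mul_right h1
    have h3 := Int.eq_zero_of_abs_lt_dvd h2 (by rw [abs_lt]; omega)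
    omega
  have himg : Finset.image (fun i : ℕ => ((m + i * p) % (q : ℤ)).toNat) (Finset.range q)
      = Finset.range q := by
    refine Finset.eq_of_subset_of_card_le (fun r hr => ?_) ?_
    · obtain ⟨i, -, rfl⟩ := Finset.mem_image.1 hr
      have a := Int.emod_nonneg (m + i * p) hq'
      have b := Int.emod_lt_of_pos (m + i * p) (show (0 : ℤ) < q by omega)
      rw [Finset.mem_range]; omega
    · rw [Finset.card_image_of_injOn hinj]
  conv_rhs => rw [← himg]
  rw [Finset.sum_image hinj]
  exact Finset.sum_congr rfl fun i _ => (Int.toNat_of_nonneg (Int.emod_nonneg _ hq')).symm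

/-- A form of Hermite's identity: q ⌊z + ip/q⌋ is ⌊qz⌋ + ip minus its residue modulo q, and the sum
of the residues does not depend on z. -/
lemma sum_floor_sub_sum_floor {p : ℤ} {q : ℕ} (hq : 0 < q) (hpq : IsCoprime p q) (z z' : ℝ) :
    ∑ i ∈ Finset.range q, ⌊z + i * (p / q : ℝ)⌋ - ∑ i ∈ Finset.range q, ⌊z' + i * (p / q : ℝ)⌋
      = ⌊q * z⌋ - ⌊q * z'⌋ := by
  have hq' : (0 : ℝ) < q := by exact_mod_cast hq
  have key : ∀ z : ℝ, (q : ℤ) * ∑ i ∈ Finset.range q, ⌊z + i * (p / q : ℝ)⌋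
      = q * ⌊q * z⌋ + (∑ i ∈ Finset.range q, (i : ℤ) * p - ∑ i ∈ Finset.range q, (i : ℤ)) := by
    intro z
    have h1 : ∀ i : ℕ, (q : ℤ) * ⌊z + i * (p / q : ℝ)⌋
        = ⌊q * z⌋ + i * p - (⌊q * z⌋ + i * p) % (q : ℤ) := fun i => by
      have e : z + i * (p / q : ℝ) = (q * z + ((i * p : ℤ) : ℝ)) / (q : ℕ) := by
        push_cast; field_simp
      rw [e, Int.floor_div_natCast, Int.floor_add_intCast]
      have := Int.mul_ediv_add_emod (⌊q * z⌋ + i * p) q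
      linarith
    rw [Finset.mul_sum, Finset.sum_congr rfl fun i _ => h1 i, Finset.sum_sub_distrib,
      sum_emod_eq hq hpq, Finset.sum_add_distrib, Finset.sum_const, Finset.card_range, nsmul_eq_mul]
    ring
  have e1 := key z
  have e2 := key z'
  have hq0 : (q : ℤ) ≠ 0 := by omega
  apply mul_left_cancel₀ hq0
  linarith

lemma floor_sub_sub_floor_sub {t lo hi : ℝ} (h0 : 0 ≤ lo) (hlh : lo ≤ hi) (h1 : hi ≤ 1) :
    ⌊t - lo⌋ - ⌊t - hi⌋ = if Int.fract t ∈ Ico lo hi then 1 else 0 := by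
  have f0 := Int.fract_nonneg t
  have f1 := Int.fract_lt_one t
  have e : ∀ s : ℝ, ⌊t - s⌋ = ⌊Int.fract t - s⌋ + ⌊t⌋ := fun s => by
    rw [← Int.floor_add_intCast]; congr 1; rw [Int.fract]; ring
  have a0 : ∀ s : ℝ, 0 ≤ s → s ≤ 1 → s ≤ Int.fract t → ⌊Int.fract t - s⌋ = 0 := fun s _ _ _ => by
    rw [Int.floor_eq_iff]; push_cast; constructor <;> linarith
  have a1 : ∀ s : ℝ, 0 ≤ s → s ≤ 1 → Int.fract t < s → ⌊Int.fract t - s⌋ = -1 := fun s _ _ _ => by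
    rw [Int.floor_eq_iff]; push_cast; constructor <;> linarith
  rw [e lo, e hi]
  rcases le_or_gt lo (Int.fract t) with hl | hl <;> rcases le_or_gt hi (Int.fract t) with hh | hh
  · rw [a0 lo h0 (by linarith) hl, a0 hi (by linarith) h1 hh, if_neg (fun h => by linarith [h.2])]
    ring
  · rw [a0 lo h0 (by linarith) hl, a1 hi (by linarith) h1 hh, if_pos ⟨hl, hh⟩]; ring
  · linarith
  · rw [a1 lo h0 (by linarith) hl, a1 hi (by linarith) h1 hh, if_neg (fun h => by linarith [h.1])]
    ring

/-- In `q` steps, where `p / q` is a good approximation of `α`, the number of visits of the rotation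
in an interval is `q` times its length up to an error of at most `3`. -/
lemma abs_card_visits_sub_le {α : ℝ} {p : ℤ} {q : ℕ} (hq : 0 < q) (hpq : IsCoprime p q)
    (hα : |q * α - p| ≤ 1 / q) {lo hi : ℝ} (h0 : 0 ≤ lo) (hlh : lo ≤ hi) (h1 : hi ≤ 1) (y : ℝ) :
    |(∑ i ∈ Finset.range q, if Int.fract (y + i * α) ∈ Ico lo hi then (1 : ℝ) else 0)
      - q * (hi - lo)| ≤ 3 := by
  have hq' : (0 : ℝ) < q := by exact_mod_cast hq
  have hsum : (∑ i ∈ Finset.range q, if Int.fract (y + i * α) ∈ Ico lo hi then (1 : ℝ) else 0)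
      = ((∑ i ∈ Finset.range q, ⌊y - lo + i * α⌋ - ∑ i ∈ Finset.range q, ⌊y - hi + i * α⌋ : ℤ) : ℝ)
      := by
    rw [← Finset.sum_sub_distrib, Int.cast_sum]
    refine Finset.sum_congr rfl fun i _ => ?_
    have := floor_sub_sub_floor_sub (t := y + i * α) h0 hlh h1
    rw [show y - lo + i * α = y + i * α - lo by ring, show y - hi + i * α = y + i * α - hi by ring,
      this]
    split_ifs <;> simp
  -- During q steps α can be replaced by p / q at the price of a shift by 1 / q; the two shifts cost
  -- 2 in the count and the rounding of the integer parts costs 1.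
  have hclose : ∀ i ∈ Finset.range q, |i * α - i * (p / q : ℝ)| ≤ 1 / q := fun i hi' => by
    have hi2 : (i : ℝ) ≤ q := by exact_mod_cast (Finset.mem_range.1 hi').le
    have e : i * α - i * (p / q : ℝ) = i / q * (q * α - p) := by field_simp
    rw [e, abs_mul, abs_of_nonneg (by positivity)]
    exact (mul_le_of_le_one_left (abs_nonneg _) ((div_le_one hq').2 hi2)).trans hα
  have up : ∀ z : ℝ, ∑ i ∈ Finset.range q, ⌊z + i * α⌋
      ≤ ∑ i ∈ Finset.range q, ⌊z + 1 / q + i * (p / q : ℝ)⌋ := fun z =>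
    Finset.sum_le_sum fun i hi' => Int.floor_le_floor (by
      have := (abs_le.1 (hclose i hi')).2; linarith)
  have down : ∀ z : ℝ, ∑ i ∈ Finset.range q, ⌊z - 1 / q + i * (p / q : ℝ)⌋
      ≤ ∑ i ∈ Finset.range q, ⌊z + i * α⌋ := fun z =>
    Finset.sum_le_sum fun i hi' => Int.floor_le_floor (by
      have := (abs_le.1 (hclose i hi')).1; linarith)
  have e1 := sum_floor_sub_sum_floor hq hpq (y - lo + 1 / q) (y - hi - 1 / q)
  have e2 := sum_floor_sub_sum_floor hq hpq (y - lo - 1 / q) (y - hi + 1 / q)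
  have u1 := up (y - lo)
  have u2 := up (y - hi)
  have d1 := down (y - lo)
  have d2 := down (y - hi)
  have c1 : (∑ i ∈ Finset.range q, ⌊y - lo + i * α⌋ - ∑ i ∈ Finset.range q, ⌊y - hi + i * α⌋ : ℤ)
      ≤ ⌊q * (y - lo + 1 / q)⌋ - ⌊q * (y - hi - 1 / q)⌋ := by linarith
  have c2 : ⌊q * (y - lo - 1 / q)⌋ - ⌊q * (y - hi + 1 / q)⌋ ≤
      (∑ i ∈ Finset.range q, ⌊y - lo + i * α⌋ - ∑ i ∈ Finset.range q, ⌊y - hi + i * α⌋ : ℤ) := by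
    linarith
  have c1' := (Int.cast_le (R := ℝ)).2 c1
  have c2' := (Int.cast_le (R := ℝ)).2 c2
  rw [← hsum] at c1' c2'
  push_cast at c1' c2'
  have g1 := Int.floor_le ((q : ℝ) * (y - lo + 1 / q))
  have g2 := Int.lt_floor_add_one ((q : ℝ) * (y - hi - 1 / q))
  have g3 := Int.lt_floor_add_one ((q : ℝ) * (y - lo - 1 / q))
  have g4 := Int.floor_le ((q : ℝ) * (y - hi + 1 / q))
  have hone : (q : ℝ) * (1 / q) = 1 := by field_simp
  rw [abs_le]
  constructor <;> linarith

end Counting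

/-! ### Measurability of cylinders and of the symbolic space. -/

section Measurability

lemma measurableSet_factor (L : Set (List (Fin 2))) (r n : ℕ) :
    MeasurableSet {x : ℕ → Fin 2 | factor x r n ∈ L} := by
  have h : Measurable fun (x : ℕ → Fin 2) (i : Fin n) => x (r + i) :=
    measurable_pi_iff.2 fun i => measurable_pi_apply _
  exact h (Set.toFinite {f : Fin n → Fin 2 | List.ofFn f ∈ L}).measurableSet

lemma measurableSet_symbolicSpace (L : Set (List (Fin 2))) : MeasurableSet (symbolicSpace L) := by
  have : symbolicSpace L = ⋂ r : ℕ, ⋂ s : ℕ, ⋂ _ : r < s, {x | factor x r (s + 1 - r) ∈ L} := by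
    ext x; simp [symbolicSpace]
  rw [this]
  exact MeasurableSet.iInter fun r => MeasurableSet.iInter fun s => MeasurableSet.iInter fun _ =>
    measurableSet_factor L r _

lemma measurable_shift : Measurable (shift : (ℕ → Fin 2) → ℕ → Fin 2) :=
  measurable_pi_iff.2 fun n => measurable_pi_apply (n + 1)

/-- The sequences that begin with the word `w`. -/
def prefixSet (w : List (Fin 2)) : Set (ℕ → Fin 2) := {x | factor x 0 w.length = w}

lemma measurableSet_prefixSet (w : List (Fin 2)) : MeasurableSet (prefixSet w) :=
  measurableSet_factor {w} 0 w.length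

lemma iterate_shift (x : ℕ → Fin 2) (i j : ℕ) : (shift^[i] x) j = x (i + j) := by
  induction i generalizing x with
  | zero => simp
  | succ i ih => rw [Function.iterate_succ_apply, ih, shift]; congr 1; omega

lemma factor_iterate_shift (x : ℕ → Fin 2) (i n : ℕ) :
    factor (shift^[i] x) 0 n = factor x i n := by
  rw [factor_eq_factor_iff]
  intro j _
  rw [iterate_shift, zero_add]

lemma IsInvariantProb.measure_cylinderSet {L : Set (List (Fin 2))} {μ : Measure (ℕ → Fin 2)}
    (h : IsInvariantProb L μ) (w : List (Fin 2)) : μ (cylinderSet L w) = μ (prefixSet w) := by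
  have : cylinderSet L w = prefixSet w ∩ symbolicSpace L := by
    ext x; simp only [cylinderSet, prefixSet, mem_ofPred_eq, mem_inter_iff]; tauto
  rw [this]
  exact measure_inter_conull h.measure_compl

end Measurability

/-! ### The unique invariant measure and the smallest frequency. -/

section UniqueErgodicity

lemma isCoprime_cfNum_cfDen (d : ℕ → ℕ) (n : ℕ) : IsCoprime (cfNum d n : ℤ) (cfDen d n : ℕ) := by
  rcases cf_det d n with h | h
  · exact ⟨cfDen d (n + 1), -cfNum d (n + 1), by linarith⟩
  · exact ⟨-cfDen d (n + 1), cfNum d (n + 1), by linarith⟩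

lemma abs_cfErr_le_one_div (d : ℕ → ℕ) (n : ℕ) : |cfErr d n| ≤ 1 / cfDen d n := by
  have hq : (0 : ℝ) < cfDen d n := by exact_mod_cast cfDen_pos d n
  have hq' : (cfDen d n : ℝ) ≤ cfDen d (n + 1) := by exact_mod_cast cfDen_le_succ d n
  rw [le_div_iff₀ hq, ← abs_cfErr_mul d n]
  refine mul_le_mul_of_nonneg_left ?_ (abs_nonneg _)
  have := mul_pos (cfVal_pos fun i => d (n + 1 + i)) hq
  linarith

lemma exists_rotationCode_of_mem_symbolicSpace {α : ℝ} (h0 : 0 < α) (h1 : α < 1) {z : ℕ → Fin 2}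
    (hz : z ∈ symbolicSpace (rotationLanguage α)) (N : ℕ) :
    ∃ y ∈ Ico (0 : ℝ) 1, ∀ i < N, z i = rotationCode α y i := by
  have h := hz 0 (N + 1) (Nat.succ_pos _)
  obtain ⟨y, hy, e⟩ := (mem_rotationLanguage_iff h0 h1).1 h
  rw [length_factor, factor_eq_factor_iff] at e
  refine ⟨y, hy, fun i hi => ?_⟩
  have := e i (by omega)
  simpa using this

/-- All invariant probability measures give to a cylinder the length of the corresponding cell. -/
lemma IsInvariantProb.measureReal_prefixSet {d : ℕ → ℕ} {ν : Measure (ℕ → Fin 2)}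
    (hν : IsInvariantProb (rotationLanguage (cfVal d)) ν) {x : ℝ} (hx : x ∈ Ico (0 : ℝ) 1) {n : ℕ}
    {lo hi : ℝ} (hc : rotationCell (cfVal d) x n = Ico lo hi) :
    ν.real (prefixSet (factor (rotationCode (cfVal d) x) 0 n)) = hi - lo := by
  set α := cfVal d with hα
  have h0 : 0 < α := cfVal_pos d
  have h1 : α < 1 := cfVal_lt_one d
  set w := factor (rotationCode α x) 0 n with hw
  have hwl : w.length = n := length_factor _ _ _
  have hprob := hν.isProbabilityMeasure
  have hsub := rotationCell_subset (α := α) hx n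
  have hmem := mem_rotationCell_self α x n
  rw [hc] at hsub hmem
  have hlt : lo < hi := hmem.1.trans_lt hmem.2
  obtain ⟨hlo, hhi⟩ := (Ico_subset_Ico_iff hlt).1 hsub
  have hae : ∀ᵐ z ∂ν, z ∈ symbolicSpace (rotationLanguage α) := hν.measure_compl
  -- Invariance equates q ν(w) with the integral of the number of occurrences of w in q steps. That
  -- number is q (hi - lo) within 3 almost everywhere, so no ergodic theorem is needed.
  have key : ∀ k ≥ 1, |ν.real (prefixSet w) - (hi - lo)| ≤ 3 / (k : ℕ) := by
    intro k hk
    set q := cfDen d k with hq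
    have hq0 : 0 < q := cfDen_pos d k
    have hq0' : (0 : ℝ) < q := by exact_mod_cast hq0
    set f : (ℕ → Fin 2) → ℝ := fun z =>
      ∑ i ∈ Finset.range q, (prefixSet w).indicator (fun _ => (1 : ℝ)) (shift^[i] z) with hf
    have hpre : ∀ i, MeasurableSet (shift^[i] ⁻¹' prefixSet w) := fun i =>
      (measurable_shift.iterate i) (measurableSet_prefixSet w)
    have hind : ∀ i z, (prefixSet w).indicator (fun _ => (1 : ℝ)) (shift^[i] z)
        = (shift^[i] ⁻¹' prefixSet w).indicator (fun _ => (1 : ℝ)) z := fun i z => rfl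
    have hint : ∀ i ∈ Finset.range q, Integrable
        (fun z => (prefixSet w).indicator (fun _ => (1 : ℝ)) (shift^[i] z)) ν := fun i _ => by
      simp only [hind]
      exact (integrable_const (1 : ℝ)).indicator (hpre i)
    have hfint : ∫ z, f z ∂ν = q * ν.real (prefixSet w) := by
      rw [hf, integral_finsetSum _ hint]
      have : ∀ i ∈ Finset.range q,
          ∫ z, (prefixSet w).indicator (fun _ => (1 : ℝ)) (shift^[i] z) ∂ν
            = ν.real (prefixSet w) := fun i _ => by
        simp only [hind]
        rw [integral_indicator_const _ (hpre i), smul_eq_mul, mul_one]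
        exact (hν.measurePreserving.iterate i).measureReal_preimage
          (measurableSet_prefixSet w).nullMeasurableSet
      rw [Finset.sum_congr rfl this, Finset.sum_const, Finset.card_range, nsmul_eq_mul]
    have hbound : ∀ᵐ z ∂ν, ‖f z - q * (hi - lo)‖ ≤ 3 := by
      filter_upwards [hae] with z hz
      -- A point of the symbolic space need not be the coding of an orbit, but its first q + n
      -- letters are, and these contain all the occurrences counted.
      obtain ⟨y, hy, hzy⟩ := exists_rotationCode_of_mem_symbolicSpace h0 h1 hz (q + n)
      have hvis := abs_card_visits_sub_le hq0 (isCoprime_cfNum_cfDen d k)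
        (show |(q : ℝ) * α - ((cfNum d k : ℤ) : ℝ)| ≤ 1 / q by
          have := abs_cfErr_le_one_div d k
          rw [cfErr] at this
          exact_mod_cast this) hlo hlt.le hhi y
      have e : f z = ∑ i ∈ Finset.range q,
          if Int.fract (y + i * α) ∈ Ico lo hi then (1 : ℝ) else 0 := by
        refine Finset.sum_congr rfl fun i hi' => ?_
        have hi'' := Finset.mem_range.1 hi'
        classical
        rw [indicator_apply]
        refine if_congr ?_ rfl rfl
        have e1 : factor z i n = factor (rotationCode α ((rotationMap α)^[i] y)) 0 n := by
          rw [← factor_rotationCode, factor_eq_factor_iff]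
          exact fun j hj => hzy _ (by omega)
        change factor (shift^[i] z) 0 w.length = w ↔ _
        rw [hwl, factor_iterate_shift, e1, hw, factor_rotationCode_eq_iff h0 h1 hx
          (iterate_rotationMap_mem h0 h1 hy i), ← hc, ← iterate_rotationMap h0 h1 hy]
        rfl
      rw [e]
      exact hvis
    have h3 := norm_integral_le_of_norm_le_const hbound
    rw [integral_sub (integrable_finsetSum _ hint) (integrable_const _), hfint, integral_const,
      probReal_univ, one_smul, mul_one, ← mul_sub, norm_mul, Real.norm_eq_abs,
      Real.norm_eq_abs, abs_of_pos hq0'] at h3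
    have hk' : (0 : ℝ) < k := by exact_mod_cast hk
    have hkq : (k : ℝ) ≤ q := by exact_mod_cast le_cfDen d k
    rw [le_div_iff₀ hk', mul_comm]
    exact (mul_le_mul_of_nonneg_right hkq (abs_nonneg _)).trans h3
  have h4 : |ν.real (prefixSet w) - (hi - lo)| ≤ 0 :=
    ge_of_tendsto (tendsto_const_div_atTop_nhds_zero_nat 3) (eventually_atTop.2 ⟨1, key⟩)
  exact sub_eq_zero.1 (abs_nonpos_iff.1 h4)

/-- Finite marginals determine the measure. Lengths from 2 on suffice, and the symbolic space
constrains only factors x_r ... x_s with r < s. -/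
lemma measure_ext_of_prefixSet {μ ν : Measure (ℕ → Fin 2)} [IsProbabilityMeasure μ]
    [IsProbabilityMeasure ν]
    (h : ∀ w : List (Fin 2), 2 ≤ w.length → μ (prefixSet w) = ν (prefixSet w)) : μ = ν := by
  have hpre : ∀ n, 2 ≤ n → μ.map (fun (x : ℕ → Fin 2) (i : Fin n) => x i)
      = ν.map fun (x : ℕ → Fin 2) (i : Fin n) => x i := by
    intro n hn
    have hm : Measurable fun (x : ℕ → Fin 2) (i : Fin n) => x i :=
      measurable_pi_iff.2 fun i => measurable_pi_apply _
    refine Measure.ext_of_singleton fun f => ?_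
    rw [Measure.map_apply hm (measurableSet_singleton f),
      Measure.map_apply hm (measurableSet_singleton f)]
    have e : (fun (x : ℕ → Fin 2) (i : Fin n) => x i) ⁻¹' {f} = prefixSet (List.ofFn f) := by
      ext x
      rw [prefixSet, mem_ofPred_eq, List.length_ofFn, factor, List.ofFn_inj]
      simp only [zero_add]
      rfl
    rw [e]
    exact h _ (by simpa using hn)
  refine IsProjectiveLimit.unique (P := fun I : Finset ℕ => ν.map I.restrict) (fun I => ?_)
    fun I => rfl
  obtain ⟨n, hn⟩ : ∃ n, ∀ i ∈ I, i < n := ⟨I.sup id + 1, fun i hi =>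
    Nat.lt_succ_of_le (Finset.le_sup (f := id) hi)⟩
  have hm : Measurable fun (x : ℕ → Fin 2) (i : Fin (n + 2)) => x i :=
    measurable_pi_iff.2 fun i => measurable_pi_apply _
  have hg : Measurable fun (f : Fin (n + 2) → Fin 2) (i : I) =>
      f ⟨i, (hn i i.2).trans (by omega)⟩ := measurable_pi_iff.2 fun i => measurable_pi_apply _
  have e : (I.restrict : (ℕ → Fin 2) → I → Fin 2) = (fun (f : Fin (n + 2) → Fin 2) (i : I) =>
      f ⟨i, (hn i i.2).trans (by omega)⟩) ∘ fun (x : ℕ → Fin 2) (i : Fin (n + 2)) => x i := rfl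
  change μ.map I.restrict = ν.map I.restrict
  rw [e, ← Measure.map_map hg hm, ← Measure.map_map hg hm, hpre (n + 2) (by omega)]

lemma IsInvariantProb.prefixSet_eq_zero {L : Set (List (Fin 2))} {μ : Measure (ℕ → Fin 2)}
    (h : IsInvariantProb L μ) {w : List (Fin 2)} (hw : w ∉ L) (hl : 2 ≤ w.length) :
    μ (prefixSet w) = 0 := by
  refine measure_mono_null (t := (symbolicSpace L)ᶜ) (fun x hx hxL => hw ?_) h.measure_compl
  have := hxL 0 (w.length - 1) (by omega)
  rw [Nat.sub_add_cancel (by omega), Nat.sub_zero] at this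
  rwa [← show factor x 0 w.length = w from hx]

lemma IsInvariantProb.eq {d : ℕ → ℕ} {μ ν : Measure (ℕ → Fin 2)}
    (hμ : IsInvariantProb (rotationLanguage (cfVal d)) μ)
    (hν : IsInvariantProb (rotationLanguage (cfVal d)) ν) : μ = ν := by
  have := hμ.isProbabilityMeasure
  have := hν.isProbabilityMeasure
  refine measure_ext_of_prefixSet fun w hw => ?_
  by_cases hwL : w ∈ rotationLanguage (cfVal d)
  · obtain ⟨x, hx, e⟩ := (mem_rotationLanguage_iff (cfVal_pos d) (cfVal_lt_one d)).1 hwL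
    obtain ⟨i, -, j, -, hc⟩ := exists_rotationCell_eq_Ico (cfVal d) x w.length
    have e1 := hμ.measureReal_prefixSet hx hc
    have e2 := hν.measureReal_prefixSet hx hc
    rw [← e] at e1 e2
    rw [← measureReal_eq_measureReal_iff, e1, e2]
  · rw [hμ.prefixSet_eq_zero hwL hw, hν.prefixSet_eq_zero hwL hw]

lemma measurable_rotationMap (α : ℝ) : Measurable (rotationMap α) :=
  Measurable.ite measurableSet_Iio (measurable_id.add_const α)
    ((measurable_id.sub_const 1).add_const α)

lemma measurable_rotationLabel (α : ℝ) : Measurable (rotationLabel α) :=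
  Measurable.ite measurableSet_Iio measurable_const measurable_const

lemma measurable_rotationCode (α : ℝ) : Measurable (rotationCode α) :=
  measurable_pi_iff.2 fun n =>
    (measurable_rotationLabel α).comp ((measurable_rotationMap α).iterate n)

lemma measurePreserving_rotationMap {α : ℝ} (h0 : 0 < α) (h1 : α < 1) :
    MeasurePreserving (rotationMap α) (volume.restrict (Ico (0 : ℝ) 1))
      (volume.restrict (Ico (0 : ℝ) 1)) := by
  refine ⟨measurable_rotationMap α, Measure.ext fun s hs => ?_⟩
  have hT := measurable_rotationMap α hs
  rw [Measure.map_apply (measurable_rotationMap α) hs, Measure.restrict_apply hT,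
    Measure.restrict_apply hs]
  have e1 : rotationMap α ⁻¹' s ∩ Ico 0 1 = ((fun x => x + α) ⁻¹' (s ∩ Ico α 1)) ∪
      ((fun x => x + (α - 1)) ⁻¹' (s ∩ Ico 0 α)) := by
    ext x
    simp only [mem_inter_iff, mem_preimage, mem_Ico, mem_union, rotationMap]
    constructor
    · rintro ⟨h, hx0, hx1⟩
      split_ifs at h with hlt
      · exact Or.inl ⟨h, by linarith, by linarith⟩
      · refine Or.inr ⟨?_, by linarith, by linarith⟩
        convert h using 1; ring
    · rintro (⟨h, h2, h3⟩ | ⟨h, h2, h3⟩)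
      · rw [if_pos (by linarith)]
        exact ⟨h, by linarith, by linarith⟩
      · rw [if_neg (by linarith)]
        refine ⟨?_, by linarith, by linarith⟩
        convert h using 1; ring
  have e2 : s ∩ Ico 0 1 = (s ∩ Ico α 1) ∪ (s ∩ Ico 0 α) := by
    rw [← inter_union_distrib_left, union_comm, Ico_union_Ico_eq_Ico h0.le h1.le]
  have d2 : Disjoint (s ∩ Ico α 1) (s ∩ Ico 0 α) :=
    Set.disjoint_left.2 fun x hx hx' => absurd hx.2.1 (not_le.2 hx'.2.2)
  have d1 : Disjoint ((fun x => x + α) ⁻¹' (s ∩ Ico α 1))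
      ((fun x => x + (α - 1)) ⁻¹' (s ∩ Ico 0 α)) :=
    Set.disjoint_left.2 fun x hx hx' => by
      have a := hx.2.2
      have b := hx'.2.1
      simp only at a b
      linarith
  have m1 : MeasurableSet (s ∩ Ico 0 α) := hs.inter measurableSet_Ico
  rw [e1, e2, measure_union d1 (measurable_add_const _ m1), measure_union d2 m1,
    measure_preimage_add_right, measure_preimage_add_right]

/-- The image of Lebesgue measure under the coding, which conjugates the rotation to the shift. -/
lemma exists_isInvariantProb {α : ℝ} (h0 : 0 < α) (h1 : α < 1) :
    ∃ μ, IsInvariantProb (rotationLanguage α) μ := by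
  have hprob : IsProbabilityMeasure (volume.restrict (Ico (0 : ℝ) 1)) :=
    ⟨by rw [Measure.restrict_apply_univ, Real.volume_Ico]; simp⟩
  have hm := measurable_rotationCode α
  refine ⟨(volume.restrict (Ico (0 : ℝ) 1)).map (rotationCode α), ?_, ?_, measurable_shift, ?_⟩
  · exact Measure.isProbabilityMeasure_map hm.aemeasurable
  · have hL := (measurableSet_symbolicSpace (rotationLanguage α)).compl
    rw [Measure.map_apply hm hL, Measure.restrict_apply (hm hL)]
    convert measure_empty (μ := (volume : Measure ℝ))
    ext x
    simp only [mem_inter_iff, mem_preimage, mem_compl_iff, mem_empty_iff_false, iff_false, not_and]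
    exact fun h hx => h fun r s _ => factor_mem_rotationLanguage hx r _
  · rw [Measure.map_map measurable_shift hm]
    have e : shift ∘ rotationCode α = rotationCode α ∘ rotationMap α := by
      ext x n
      rfl
    rw [e, ← Measure.map_map hm (measurable_rotationMap α),
      (measurePreserving_rotationMap h0 h1).map_eq]

lemma uniquelyErgodic_rotationLanguage (d : ℕ → ℕ) :
    UniquelyErgodic (rotationLanguage (cfVal d)) := by
  obtain ⟨μ, hμ⟩ := exists_isInvariantProb (cfVal_pos d) (cfVal_lt_one d)
  exact ⟨μ, hμ, fun ν hν => hν.eq hμ⟩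

/-- The smallest frequency of the words of length `n` is the distance of `{α, ..., n α}` to `ℤ`. -/
lemma smallestFrequency_rotationLanguage {d : ℕ → ℕ} {μ : Measure (ℕ → Fin 2)}
    (hμ : IsInvariantProb (rotationLanguage (cfVal d)) μ) {n : ℕ} (hn : 1 ≤ n) {δ : ℝ}
    (hδ : IsMinDist (cfVal d) n δ) :
    smallestFrequency (rotationLanguage (cfVal d)) μ n = ENNReal.ofReal δ := by
  have h0 := cfVal_pos d
  have h1 := cfVal_lt_one d
  have hirr := irrational_cfVal d
  have hprob := hμ.isProbabilityMeasure
  have hval : ∀ x ∈ Ico (0 : ℝ) 1, ∀ lo hi, rotationCell (cfVal d) x n = Ico lo hi →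
      μ (cylinderSet (rotationLanguage (cfVal d)) (factor (rotationCode (cfVal d) x) 0 n))
        = ENNReal.ofReal (hi - lo) := fun x hx lo hi hc => by
    rw [hμ.measure_cylinderSet, ← hμ.measureReal_prefixSet hx hc, ofReal_measureReal]
  have hlow : ∀ m, (0 < m ∧ ∃ w ∈ rotationLanguage (cfVal d), w.length = n ∧
      μ (cylinderSet (rotationLanguage (cfVal d)) w) = m) → ENNReal.ofReal δ ≤ m := by
    rintro m ⟨-, w, hw, hwl, rfl⟩
    obtain ⟨x, hx, e⟩ := (mem_rotationLanguage_iff h0 h1).1 hw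
    rw [hwl] at e
    obtain ⟨i, -, j, -, hc⟩ := exists_rotationCell_eq_Ico (cfVal d) x n
    rw [e, hval x hx _ _ hc]
    exact ENNReal.ofReal_le_ofReal (hδ.le_sub_of_rotationCell_eq h0 h1 hn hc)
  refine le_antisymm (sInf_le ⟨ENNReal.ofReal_pos.2 (hδ.pos hirr), ?_⟩) (le_sInf hlow)
  -- A cell inside an interval of length δ, while no cell is shorter than δ, has length exactly δ.
  obtain ⟨x, hx, a, ha⟩ := hδ.exists_rotationCell_subset hirr h0 h1 hn
  refine ⟨_, factor_mem_rotationLanguage hx 0 n, length_factor _ _ _, ?_⟩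
  obtain ⟨i, -, j, -, hc⟩ := exists_rotationCell_eq_Ico (cfVal d) x n
  rw [hval x hx _ _ hc]
  have hge := hδ.le_sub_of_rotationCell_eq h0 h1 hn hc
  rw [hc] at ha
  obtain ⟨b1, b2⟩ := (Ico_subset_Ico_iff (by linarith [hδ.pos hirr])).1 ha
  congr 1
  linarith

end UniqueErgodicity

/-! ### The spectrum as a translate of the set of product limits. -/

section Spectrum

lemma HasLiminf.liminf_ofReal_eq {g : ℕ → ℝ} {ℓ : ℝ} (h : HasLiminf g ℓ) {F : ℕ → ℝ≥0∞}
    (hF : ∀ᶠ n in atTop, F n = ENNReal.ofReal (g n)) : liminf F atTop = ENNReal.ofReal ℓ := by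
  apply le_antisymm
  · refine ENNReal.le_of_forall_pos_le_add fun ε hε _ => ?_
    have hε' : (0 : ℝ) < ε := hε
    have h1 : liminf F atTop ≤ ENNReal.ofReal (ℓ + ε) :=
      liminf_le_of_frequently_le' (((h.2 ε hε').and_eventually hF).mono fun n hn => by
        rw [hn.2]; exact ENNReal.ofReal_le_ofReal hn.1.le)
    refine h1.trans (ENNReal.ofReal_add_le.trans ?_)
    rw [ENNReal.ofReal_coe_nnreal]
  · refine ENNReal.le_of_forall_pos_le_add fun ε hε _ => ?_
    have hε' : (0 : ℝ) < ε := hε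
    have h1 : ENNReal.ofReal (ℓ - ε) ≤ liminf F atTop :=
      le_liminf_of_le (h := by
        filter_upwards [h.1 ε hε', hF] with n h1 h2
        rw [h2]; exact ENNReal.ofReal_le_ofReal h1.le)
    calc ENNReal.ofReal ℓ = ENNReal.ofReal (ℓ - ε + ε) := by rw [sub_add_cancel]
      _ ≤ ENNReal.ofReal (ℓ - ε) + ENNReal.ofReal ε := ENNReal.ofReal_add_le
      _ ≤ liminf F atTop + ε := by rw [ENNReal.ofReal_coe_nnreal]; gcongr

lemma lowerB_rotationLanguage {d : ℕ → ℕ} {ℓ : ℝ}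
    (h : HasLiminf (fun n : ℕ => prodVal (extendDigits d) n) ℓ)
    (hU : UniquelyErgodic (rotationLanguage (cfVal d))) : lowerB hU = ENNReal.ofReal (1 + ℓ) := by
  have hδ : ∀ N : ℕ, ∃ δ, 1 ≤ N → IsMinDist (cfVal d) N δ := fun N => by
    rcases Nat.eq_zero_or_pos N with rfl | hN
    · exact ⟨0, fun h => absurd h (by norm_num)⟩
    · obtain ⟨n, h1, h2⟩ := exists_cfDen_le_lt d hN
      exact ⟨_, fun _ => isMinDist_cfErr d h1 h2⟩
  choose δ hδ using hδ
  refine (hasLiminf_one_div_mul_minDist h hδ).liminf_ofReal_eq ?_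
  filter_upwards [eventually_ge_atTop 1] with N hN
  have hpos := (hδ N hN).pos (irrational_cfVal d)
  have hN' : (0 : ℝ) < N := by exact_mod_cast hN
  have hinv : IsInvariantProb (rotationLanguage (cfVal d)) hU.measure := hU.choose_spec.1
  rw [smallestFrequency_rotationLanguage hinv hN (hδ N hN),
    ENNReal.ofReal_div_of_pos (by positivity), ENNReal.ofReal_one, ENNReal.ofReal_mul hN'.le,
    ENNReal.ofReal_natCast]

/-- An angle only provides digits to the right, a bi-infinite sequence has them on both sides; the
far left does not affect the lower limit, so either can be replaced by the other. -/
lemma rotationLowerBLSpectrum_eq :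
    rotationLowerBLSpectrum = (fun s : ℝ => ENNReal.ofReal (1 + s)) '' prodSpectrum := by
  ext x
  constructor
  · rintro ⟨α, ⟨hirr, h0, h1⟩, hU, rfl⟩
    obtain ⟨d, rfl⟩ := exists_eq_cfVal hirr h0 h1
    obtain ⟨ℓ, hℓ⟩ := exists_hasLiminf_prodVal (extendDigits d)
    exact ⟨ℓ, ⟨_, hℓ⟩, (lowerB_rotationLanguage hℓ hU).symm⟩
  · rintro ⟨ℓ, ⟨b, hb⟩, rfl⟩
    set d : ℕ → ℕ := fun n => b n with hd
    have hℓ : HasLiminf (fun n : ℕ => prodVal (extendDigits d) n) ℓ := by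
      refine hb.congr ?_
      have := tendsto_prodVal_sub_of_tail_eq (b := b) (c := extendDigits d) (N := 0) (d := 0)
        fun n hn => by
          rw [add_zero, extendDigits, hd]
          simp only
          rw [Int.toNat_of_nonneg (by exact_mod_cast hn)]
      simpa using this
    exact ⟨cfVal d, ⟨irrational_cfVal d, cfVal_pos d, cfVal_lt_one d⟩,
      uniquelyErgodic_rotationLanguage d, lowerB_rotationLanguage hℓ _⟩

lemma eq_of_ofReal_one_add_eq {s t : ℝ} (hs : 0 ≤ s) (ht : 0 ≤ t)
    (h : ENNReal.ofReal (1 + s) = ENNReal.ofReal (1 + t)) : s = t := by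
  rw [ENNReal.ofReal_eq_ofReal_iff (by linarith) (by linarith)] at h
  linarith

lemma sqrt_bounds : (223 : ℝ) / 100 < √5 ∧ √5 < 224 / 100 ∧ 173 / 100 < √3 ∧ √3 < 174 / 100 :=
  ⟨Real.lt_sqrt_of_sq_lt (by norm_num), (Real.sqrt_lt' (by norm_num)).2 (by norm_num),
    Real.lt_sqrt_of_sq_lt (by norm_num), (Real.sqrt_lt' (by norm_num)).2 (by norm_num)⟩

end Spectrum

theorem theorem3 :
    IsLeast rotationLowerBLSpectrum 1 ∧
    (∀ α ∈ rotationAngles, ∃ h : UniquelyErgodic (rotationLanguage α),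
      (lowerB h = 1 ↔ UnboundedPartialQuotients α)) ∧
    IsClosed rotationLowerBLSpectrum ∧
    IsGreatest rotationLowerBLSpectrum (ENNReal.ofReal ((5 - √5) / 2)) ∧
    IsGreatest (rotationLowerBLSpectrum \ {ENNReal.ofReal ((5 - √5) / 2)})
      (ENNReal.ofReal (3 - √3)) ∧
    (∀ b ∈ rotationLowerBLSpectrum, ENNReal.ofReal (5 / 4) < b →
      b = ENNReal.ofReal ((5 - √5) / 2) ∨ b = ENNReal.ofReal (3 - √3)) ∧
    (ENNReal.ofReal (√5 - 1) ∈ rotationLowerBLSpectrum ∧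
      AccPt (ENNReal.ofReal (√5 - 1)) (𝓟 rotationLowerBLSpectrum)) ∧
    Icc 1 (ENNReal.ofReal (1 + 4 / (83 + 18 * √2))) ⊆ rotationLowerBLSpectrum := by
  obtain ⟨h5, h5', h3, h3'⟩ := sqrt_bounds
  have e1 : (5 - √5) / 2 = 1 + (3 - √5) / 2 := by ring
  have e2 : 3 - √3 = 1 + (2 - √3) := by ring
  have e3 : √5 - 1 = 1 + (√5 - 2) := by ring
  have e4 : (5 : ℝ) / 4 = 1 + 1 / 4 := by norm_num
  have one_eq : (1 : ℝ≥0∞) = ENNReal.ofReal (1 + 0) := by simp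
  have hcases : ∀ s ∈ prodSpectrum, s = (3 - √5) / 2 ∨ s = 2 - √3 ∨ s ≤ 1 / 4 := fun s hs => by
    rcases le_or_gt s (1 / 4) with h | h
    · exact Or.inr (Or.inr h)
    · rcases eq_of_mem_prodSpectrum_of_quarter_lt hs h with h | h
      exacts [Or.inl h, Or.inr (Or.inl h)]
  have hnonneg : ∀ s ∈ prodSpectrum, 0 ≤ s := fun s hs => (prodSpectrum_subset_Icc hs).1
  rw [rotationLowerBLSpectrum_eq]
  refine ⟨⟨⟨0, zero_mem_prodSpectrum, one_eq.symm⟩, ?_⟩, ?_, ?_, ⟨⟨_,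
    three_sub_sqrt_five_mem_prodSpectrum, by rw [e1]⟩, ?_⟩, ⟨⟨⟨_,
    two_sub_sqrt_three_mem_prodSpectrum, by rw [e2]⟩, ?_⟩, ?_⟩, ?_, ⟨⟨_,
    sqrt_five_sub_two_mem_prodSpectrum, by rw [e3]⟩, ?_⟩, ?_⟩
  · rintro _ ⟨s, hs, rfl⟩
    rw [one_eq]
    exact ENNReal.ofReal_le_ofReal (by linarith [hnonneg s hs])
  · rintro α ⟨hirr, h0, h1⟩
    obtain ⟨d, rfl⟩ := exists_eq_cfVal hirr h0 h1
    obtain ⟨ℓ, hℓ⟩ := exists_hasLiminf_prodVal (extendDigits d)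
    refine ⟨uniquelyErgodic_rotationLanguage d, ?_⟩
    rw [lowerB_rotationLanguage hℓ, unboundedPartialQuotients_cfVal,
      ← hasLiminf_extendDigits_eq_zero_iff hℓ, one_eq]
    exact ⟨eq_of_ofReal_one_add_eq (hnonneg ℓ ⟨_, hℓ⟩) le_rfl, fun h => by rw [h]⟩
  -- Compactness, rather than closedness alone, survives the continuous map into `ℝ≥0∞`.
  · have hc : IsCompact prodSpectrum :=
      isCompact_Icc.of_isClosed_subset isClosed_prodSpectrum prodSpectrum_subset_Icc
    exact (hc.image (ENNReal.continuous_ofReal.comp (continuous_const.add continuous_id))).isClosed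
  · rintro _ ⟨s, hs, rfl⟩
    rw [e1]
    refine ENNReal.ofReal_le_ofReal ?_
    rcases hcases s hs with h | h | h <;> linarith
  · rw [mem_singleton_iff, e1, e2]
    intro h
    have := eq_of_ofReal_one_add_eq (by linarith) (by linarith) h
    linarith
  · rintro _ ⟨⟨s, hs, rfl⟩, hne⟩
    rw [e2]
    refine ENNReal.ofReal_le_ofReal ?_
    rcases hcases s hs with h | h | h
    · exact absurd (by rw [e1, h]; rfl) hne
    · linarith
    · linarith
  · rintro _ ⟨s, hs, rfl⟩ hb
    rw [e4] at hb
    rcases hcases s hs with h | h | h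
    · left; rw [e1, h]
    · right; rw [e2, h]
    · exact absurd (ENNReal.ofReal_le_ofReal (by linarith)) (not_le.2 hb)
  · rw [accPt_iff_frequently, e3]
    obtain ⟨v, hv, hlim⟩ := exists_seq_prodSpectrum_tendsto
    have hlim' : Tendsto (fun n => ENNReal.ofReal (1 + v n)) atTop
        (𝓝 (ENNReal.ofReal (1 + (√5 - 2)))) :=
      (ENNReal.continuous_ofReal.tendsto _).comp (tendsto_const_nhds.add hlim)
    refine hlim'.frequently (Frequently.of_forall fun n => ⟨fun h => (hv n).2 ?_, v n, (hv n).1, rfl⟩)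
    exact eq_of_ofReal_one_add_eq (hnonneg _ (hv n).1) (by linarith) h
  · rintro b ⟨hb1, hb2⟩
    have hb : b ≠ ∞ := (hb2.trans_lt ENNReal.ofReal_lt_top).ne
    have hr1 : 1 ≤ b.toReal := by
      rw [← ENNReal.toReal_one]; exact ENNReal.toReal_mono hb hb1
    have hr2 : b.toReal ≤ 1 + 4 / (83 + 18 * √2) := ENNReal.toReal_le_of_le_ofReal (by positivity) hb2
    refine ⟨b.toReal - 1, Icc_subset_prodSpectrum ⟨by linarith, by linarith⟩, ?_⟩
    simp only [add_sub_cancel, ENNReal.ofReal_toReal hb]
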